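/- Let $k$ be a field of characteristic $0$ and $\mathsf{Field}_k$ the class of fields containing $k$. For $K\in\mathsf{Field}_k$ write $\operatorname{ord}$ and $\operatorname{ac}$ for the $t$-adic valuation and the angular component (leading coefficient) of $K((t))$. Let $\mathcal L_{DP}(k)$ be a three-sorted Denef–Pas language with constants: the ring language on the valued field sort, with a constant for each element of $k((t))$; the ring language on the residue field sort, with a constant for each element of $k$ and possibly further constant symbols; the Presburger language on the value group sort, possibly with further constant symbols; and the symbols $\operatorname{ord}$ and $\operatorname{ac}$. It is interpreted in $(K((t)),K,\mathbf Z)$ for every $K\in\mathsf{Field}_k$. Put $h[n,\ell,r](K)=K((t))^n\times K^\ell\times\mathbf Z^r$. A definable set $X\subset h[n,\ell,r]$ is a family of subsets $X(K)\subset h[n,\ell,r](K)$, $K\in\mathsf{Field}_k$, cut out by one $\mathcal L_{DP}(k)$-formula independent of $K$. A definable morphism $g\colon X\to Y$ is a family of maps $g_K\colon X(K)\to Y(K)$ with definable graph; a definable constant $c$ of $X$ is a definable morphism $h[0,0,0]\to X$, i.e. a family of points $c_K\in X(K)$ that is definable uniformly in $K$. Write $\mathcal O=(K[[t]])_K$,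 $\mathcal O^\times=(K[[t]]^\times)_K$, and, for a definable constant $\alpha$ of $h[0,0,1]$, $\mathrm B(0,\alpha)^n(K)=\{x\in K((t))^n : \operatorname{ord}x_i\ge\alpha_K \text{ for all } i\}$. A definable morphism between subsets of $\mathcal O^n$ and $\mathcal O^m$ is globally analytic if, for every $K$, each of its components is given on the whole domain by a convergent power series with coefficients in $K[[t]]$; it is bianalytic if it is a globally analytic definable isomorphism whose inverse is globally analytic. A critical point of a globally analytic definable morphism $f$ is a definable constant $x$ of its domain with $\operatorname{grad}f_K(x_K)=0$ for all $K$. Proposition. Let $n\ge 0$, let $\alpha$ be a definable constant of $h[0,0,1]$ with $\alpha_K\ge1$ for all $K\in\mathsf{Field}_k$, and let $f\colon \mathrm B(0,\alpha)^n\to\mathcal O$ be a globally analytic definable morphism whose origin is a critical point modulo $t^\alpha$, nondegenerate modulo $t$: for all $K$, $\operatorname{grad}f_K(0)\equiv0 \bmod t^{\alpha_K}$ and $\det\operatorname{Hess}f_K(0)\not\equiv0\bmod t$. Then $f$ has a unique critical point $c\in \mathrm B(0,\alpha)^n$; moreover, for every $K$, $c_K$ is the only point of $\mathrm B(0,\alpha)^n(K)$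 at which $\operatorname{grad}f_K$ vanishes. There exist a bianalytic definable morphism $T=(T_1,\dots,T_n)\colon \mathrm B(0,\alpha)^n\to \mathrm B(0,\alpha)^n$ with $T(c)=0$ and definable constants $a_1,\dots,a_n$ of $\mathcal O^\times$ such that, for all $K\in\mathsf{Field}_k$ and all $x\in \mathrm B(0,\alpha)^n(K)$, $$f_K(x)=f_K(c_K)+\sum_{i=1}^n a_{iK}\,T_{iK}(x)^2 .$$ -/

import Mathlib

open Filter Topology

universe u

noncomputable section

namespace MotivicMorse

/-! ### Denef-Pas languages -/

/-- The data that distinguish one Denef-Pas language from another: sets of extra constant symbols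
in the residue field sort and in the value group sort, together with their interpretations in
the structures `(K((t)), K, ℤ)`, for `K` a field containing `k`. -/
structure DenefPas (k : Type u) [Field k] where
  /-- extra constant symbols of the residue field sort -/
  RFConst : Type u
  /-- extra constant symbols of the value group sort -/
  VGConst : Type u
  /-- interpretation of the extra residue field constants -/
  rfVal : ∀ (K : Type u) [Field K] [Algebra k K], RFConst → K
  /-- interpretation of the extra value group constants -/
  vgVal : ∀ (K : Type u) [Field K] [Algebra k K], VGConst → ℤ

/-- Terms of the valued field sort in `n` variables: the ring language with a constant symbol for
each element of `k((t))` (among which `0` and `1`). -/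
inductive VFTerm (k : Type u) [Field k] (n : ℕ) : Type u
  | var (i : Fin n) : VFTerm k n
  | const (c : LaurentSeries k) : VFTerm k n
  | add (s t : VFTerm k n) : VFTerm k n
  | neg (s : VFTerm k n) : VFTerm k n
  | mul (s t : VFTerm k n) : VFTerm k n

/-- Terms of the residue field sort in `n` valued field variables and `l` residue field variables:
the ring language with a constant symbol for each element of `k` (among which `0` and `1`), the
extra constants of the language, and the angular component. -/
inductive RFTerm {k : Type u} [Field k] (L : DenefPas k) (n l : ℕ) : Type u
  | var (i : Fin l) : RFTerm L n l
  | const (c : k) : RFTerm L n l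
  | extra (c : L.RFConst) : RFTerm L n l
  | add (s t : RFTerm L n l) : RFTerm L n l
  | neg (s : RFTerm L n l) : RFTerm L n l
  | mul (s t : RFTerm L n l) : RFTerm L n l
  | ac (s : VFTerm k n) : RFTerm L n l

/-- Terms of the value group sort in `n` valued field variables and `r` value group variables:
the Presburger language, the extra constants of the language, and the valuation. -/
inductive VGTerm {k : Type u} [Field k] (L : DenefPas k) (n r : ℕ) : Type u
  | var (i : Fin r) : VGTerm L n r
  | zero : VGTerm L n r
  | one : VGTerm L n r
  | extra (c : L.VGConst) : VGTerm L n r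
  | add (s t : VGTerm L n r) : VGTerm L n r
  | neg (s : VGTerm L n r) : VGTerm L n r
  | ord (s : VFTerm k n) : VGTerm L n r

/-- First order formulas of the three-sorted language `L_DP(k)` with `n` free variables of the
valued field sort, `l` of the residue field sort and `r` of the value group sort. A quantifier
binds the variable of index `0` of its sort. -/
inductive Formula {k : Type u} [Field k] (L : DenefPas k) : ℕ → ℕ → ℕ → Type u
  | vfEq {n l r : ℕ} (s t : VFTerm k n) : Formula L n l r
  | rfEq {n l r : ℕ} (s t : RFTerm L n l) : Formula L n l r
  | vgEq {n l r : ℕ} (s t : VGTerm L n r) : Formula L n l r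
  | vgLe {n l r : ℕ} (s t : VGTerm L n r) : Formula L n l r
  | vgCong {n l r : ℕ} (m : ℕ) (s t : VGTerm L n r) : Formula L n l r
  | not {n l r : ℕ} (φ : Formula L n l r) : Formula L n l r
  | and {n l r : ℕ} (φ ψ : Formula L n l r) : Formula L n l r
  | vfEx {n l r : ℕ} (φ : Formula L (n + 1) l r) : Formula L n l r
  | rfEx {n l r : ℕ} (φ : Formula L n (l + 1) r) : Formula L n l r
  | vgEx {n l r : ℕ} (φ : Formula L n l (r + 1)) : Formula L n l r

/-! ### Semantics in `(K((t)), K, ℤ)` -/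

/-- The set `h[n, l, r](K) = K((t))ⁿ × Kˡ × ℤʳ`. -/
@[ext]
structure HPoint (n l r : ℕ) (K : Type u) [Field K] where
  /-- valued field coordinates -/
  vf : Fin n → LaurentSeries K
  /-- residue field coordinates -/
  rf : Fin l → K
  /-- value group coordinates -/
  vg : Fin r → ℤ

/-- Concatenation, i.e. `h[n, l, r](K) × h[n', l', r'](K) = h[n + n', l + l', r + r'](K)`. -/
def HPoint.append {n l r n' l' r' : ℕ} {K : Type u} [Field K]
    (p : HPoint n l r K) (q : HPoint n' l' r' K) : HPoint (n + n') (l + l') (r + r') K :=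
  ⟨Fin.append p.vf q.vf, Fin.append p.rf q.rf, Fin.append p.vg q.vg⟩

section Semantics

variable {k : Type u} [Field k] {L : DenefPas k} (K : Type u) [Field K] [Algebra k K]

/-- Value of a valued field term; constants of `k((t))` are read in `K((t))` coefficientwise. -/
def VFTerm.eval {n : ℕ} (x : Fin n → LaurentSeries K) : VFTerm k n → LaurentSeries K
  | .var i => x i
  | .const c => HahnSeries.map c (algebraMap k K)
  | .add s t => s.eval x + t.eval x
  | .neg s => - s.eval x
  | .mul s t => s.eval x * t.eval x

/-- Value of a residue field term; `ac` is the leading coefficient, with `ac 0 = 0`. -/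
def RFTerm.eval {n l : ℕ} (x : Fin n → LaurentSeries K) (ξ : Fin l → K) : RFTerm L n l → K
  | .var i => ξ i
  | .const c => algebraMap k K c
  | .extra c => L.rfVal K c
  | .add s t => s.eval x ξ + t.eval x ξ
  | .neg s => - s.eval x ξ
  | .mul s t => s.eval x ξ * t.eval x ξ
  | .ac s => (s.eval K x).leadingCoeff

/-- Value of a value group term. The symbol `ord` is interpreted by the `t`-adic valuation on
`K((t)) \ {0}`, and by `0` at `0`; as `{0}` is definable in the ring language, the choice of the
value at `0` does not change which sets are definable. -/
def VGTerm.eval {n r : ℕ} (x : Fin n → LaurentSeries K) (a : Fin r → ℤ) : VGTerm L n r → ℤ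
  | .var i => a i
  | .zero => 0
  | .one => 1
  | .extra c => L.vgVal K c
  | .add s t => s.eval x a + t.eval x a
  | .neg s => - s.eval x a
  | .ord s => (s.eval K x).order

variable {K} in
/-- Satisfaction of a formula at a point of `h[n, l, r](K)`. -/
def Formula.Realize : {n l r : ℕ} → Formula L n l r → HPoint n l r K → Prop
  | _, _, _, .vfEq s t, p => s.eval K p.vf = t.eval K p.vf
  | _, _, _, .rfEq s t, p => s.eval K p.vf p.rf = t.eval K p.vf p.rf
  | _, _, _, .vgEq s t, p => s.eval K p.vf p.vg = t.eval K p.vf p.vg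
  | _, _, _, .vgLe s t, p => s.eval K p.vf p.vg ≤ t.eval K p.vf p.vg
  | _, _, _, .vgCong m s t, p => s.eval K p.vf p.vg ≡ t.eval K p.vf p.vg [ZMOD m]
  | _, _, _, .not φ, p => ¬ φ.Realize p
  | _, _, _, .and φ ψ, p => φ.Realize p ∧ ψ.Realize p
  | _, _, _, .vfEx φ, p => ∃ y : LaurentSeries K, φ.Realize ⟨Fin.cons y p.vf, p.rf, p.vg⟩
  | _, _, _, .rfEx φ, p => ∃ y : K, φ.Realize ⟨p.vf, Fin.cons y p.rf, p.vg⟩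
  | _, _, _, .vgEx φ, p => ∃ y : ℤ, φ.Realize ⟨p.vf, p.rf, Fin.cons y p.vg⟩

end Semantics

/-! ### Definable subassignments, morphisms and constants -/

/-- A subassignment of `h[n, l, r]`: a set `X(K) ⊆ h[n, l, r](K)` for each field `K ⊇ k`. -/
abbrev Subassignment (k : Type u) [Field k] (n l r : ℕ) : Type (u + 1) :=
  ∀ (K : Type u) [Field K] [Algebra k K], Set (HPoint n l r K)

section Definable

variable {k : Type u} [Field k] (L : DenefPas k)

/-- A subassignment is definable if one formula cuts it out for all `K`. -/
def IsDefinable {n l r : ℕ} (X : Subassignment k n l r) : Prop :=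
  ∃ φ : Formula L n l r, ∀ (K : Type u) [Field K] [Algebra k K] (p : HPoint n l r K),
    p ∈ X K ↔ φ.Realize p

/-- A definable morphism `X → Y`: a family of maps `X(K) → Y(K)` whose graph is definable. -/
structure DefMor {n l r n' l' r' : ℕ}
    (X : Subassignment k n l r) (Y : Subassignment k n' l' r') where
  /-- the map at `K` -/
  app : ∀ (K : Type u) [Field K] [Algebra k K], X K → Y K
  /-- the graph is definable -/
  definable_graph : IsDefinable L (n := n + n') (l := l + l') (r := r + r') fun K _ _ =>
    {p | ∃ x : X K, p = x.1.append (app K x).1}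

/-- The subassignment `h[n, l, r]`. -/
def full (k : Type u) [Field k] (n l r : ℕ) : Subassignment k n l r := fun _ _ _ => Set.univ

/-- A definable constant of `X`: a definable morphism from the final object `{*} = h[0, 0, 0]`. -/
abbrev DefConst {n l r : ℕ} (X : Subassignment k n l r) := DefMor L (full k 0 0 0) X

variable {L}

/-- The value `c_K` in `X(K)` of a definable constant of `X`. -/
def DefMor.val {n l r : ℕ} {X : Subassignment k n l r} (c : DefConst L X)
    (K : Type u) [Field K] [Algebra k K] : X K :=
  c.app K ⟨⟨Fin.elim0, Fin.elim0, Fin.elim0⟩, trivial⟩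

/-- The integer `α_K` of a definable constant `α` of `h[0, 0, 1]`. -/
def intVal (α : DefConst L (full k 0 0 1)) (K : Type u) [Field K] [Algebra k K] : ℤ :=
  (α.val K).1.vg 0

variable (k) in
/-- `𝒪 = (K[[t]])_K` in `h[1, 0, 0]`. -/
def integers : Subassignment k 1 0 0 := fun _ _ _ => {p | 0 ≤ (p.vf 0).orderTop}

variable (k) in
/-- `𝒪ˣ = (K[[t]]ˣ)_K` in `h[1, 0, 0]`. -/
def integerUnits : Subassignment k 1 0 0 := fun _ _ _ => {p | (p.vf 0).orderTop = 0}

/-- The polydisc `B(0, α)ⁿ` in `h[n, 0, 0]`: all coordinates have valuation at least `α`. -/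
def polydisc (α : DefConst L (full k 0 0 1)) (n : ℕ) : Subassignment k n 0 0 := fun K _ _ =>
  {p | ∀ i, (intVal α K : WithTop ℤ) ≤ (p.vf i).orderTop}

/-! ### Globally analytic and bianalytic morphisms -/

/-- A function on `A ⊆ K((t))ⁿ` is globally analytic if it is given on `A` by a power series
with coefficients in `K[[t]]` converging (`t`-adically) at all points of `A`. -/
def IsGloballyAnalyticFun {n : ℕ} {K : Type u} [Field K] {A : Set (HPoint n 0 0 K)}
    (g : A → LaurentSeries K) : Prop :=
  ∃ F : MvPowerSeries (Fin n) (PowerSeries K), ∀ x : A,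
    HasSum (fun e : Fin n →₀ ℕ =>
      ((MvPowerSeries.coeff e F : PowerSeries K) : LaurentSeries K) * ∏ i, x.1.vf i ^ e i) (g x)

/-- A definable morphism is globally analytic if all its components are, for each `K`. -/
def DefMor.IsGloballyAnalytic {n m : ℕ} {A : Subassignment k n 0 0} {B : Subassignment k m 0 0}
    (f : DefMor L A B) : Prop :=
  ∀ (K : Type u) [Field K] [Algebra k K] (j : Fin m),
    IsGloballyAnalyticFun fun x : A K => (f.app K x).1.vf j

/-- A bianalytic definable morphism: a globally analytic definable isomorphism whose inverse is
globally analytic. -/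
def DefMor.IsBianalytic {n m : ℕ} {A : Subassignment k n 0 0} {B : Subassignment k m 0 0}
    (T : DefMor L A B) : Prop :=
  T.IsGloballyAnalytic ∧ ∃ S : DefMor L B A, S.IsGloballyAnalytic ∧
    ∀ (K : Type u) [Field K] [Algebra k K],
      Function.LeftInverse (S.app K) (T.app K) ∧ Function.RightInverse (S.app K) (T.app K)

/-! ### Gradient, Hessian and critical points -/

/-- The `i`-th partial derivative of `g : K((t))ⁿ → K((t))` at `x`, as the limit of the difference
quotients for the `t`-adic topology. -/
def partialDeriv {n : ℕ} {K : Type u} [Field K] (g : (Fin n → LaurentSeries K) → LaurentSeries K)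
    (i : Fin n) (x : Fin n → LaurentSeries K) : LaurentSeries K :=
  limUnder (𝓝[≠] (0 : LaurentSeries K)) fun h => (g (x + Pi.single i h) - g x) / h

open Classical in
/-- A map `A → 𝒪` as a function on `K((t))ⁿ`, extended by `0` outside of `A(K)`. When `A` is open,
the extension plays no role for the derivatives at the points of `A(K)`. -/
def DefMor.extend {n : ℕ} {A : Subassignment k n 0 0} (f : DefMor L A (integers k))
    (K : Type u) [Field K] [Algebra k K] (x : Fin n → LaurentSeries K) : LaurentSeries K :=
  if hx : (⟨x, Fin.elim0, Fin.elim0⟩ : HPoint n 0 0 K) ∈ A K then (f.app K ⟨_, hx⟩).1.vf 0 else 0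

/-- The gradient of `f_K` at `x`. -/
def DefMor.grad {n : ℕ} {A : Subassignment k n 0 0} (f : DefMor L A (integers k))
    (K : Type u) [Field K] [Algebra k K] (x : A K) : Fin n → LaurentSeries K :=
  fun i => partialDeriv (f.extend K) i x.1.vf

/-- The Hessian matrix of `f_K` at `x`. -/
def DefMor.hess {n : ℕ} {A : Subassignment k n 0 0} (f : DefMor L A (integers k))
    (K : Type u) [Field K] [Algebra k K] (x : A K) : Matrix (Fin n) (Fin n) (LaurentSeries K) :=
  Matrix.of fun i j => partialDeriv (partialDeriv (f.extend K) j) i x.1.vf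

/-- The definable constant `x` of `A` is a critical point of `f`. -/
def DefMor.IsCriticalPoint {n : ℕ} {A : Subassignment k n 0 0} (f : DefMor L A (integers k))
    (x : DefConst L A) : Prop :=
  ∀ (K : Type u) [Field K] [Algebra k K], f.grad K (x.val K) = 0

/-- The definable constant `x` of `A` is a critical point of `f` modulo `t^α`. -/
def DefMor.IsCriticalPointMod {n : ℕ} {A : Subassignment k n 0 0} (f : DefMor L A (integers k))
    (α : DefConst L (full k 0 0 1)) (x : DefConst L A) : Prop :=
  ∀ (K : Type u) [Field K] [Algebra k K] (i : Fin n),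
    (intVal α K : WithTop ℤ) ≤ (f.grad K (x.val K) i).orderTop

/-- The definable constant `x` of `A` is nondegenerate modulo `t` for `f`. -/
def DefMor.IsNondegenerateMod {n : ℕ} {A : Subassignment k n 0 0} (f : DefMor L A (integers k))
    (x : DefConst L A) : Prop :=
  ∀ (K : Type u) [Field K] [Algebra k K], ¬ (1 : WithTop ℤ) ≤ (f.hess K (x.val K)).det.orderTop

/-! ### The origin as a definable constant -/

/-- The formula `x_i = 0` for all `i` in a list. -/
def Formula.allZero {n l r : ℕ} : List (Fin n) → Formula L n l r
  | [] => .vgEq .zero .zero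
  | i :: is => .and (.vfEq (.var i) (.const 0)) (Formula.allZero is)

theorem Formula.realize_allZero {n l r : ℕ} {K : Type u} [Field K] [Algebra k K]
    (is : List (Fin n)) (p : HPoint n l r K) :
    (Formula.allZero (L := L) is).Realize p ↔ ∀ i ∈ is, p.vf i = 0 := by
  induction is with
  | nil => simp [Formula.allZero, Formula.Realize]
  | cons i is ih =>
    simp only [Formula.allZero, Formula.Realize, VFTerm.eval, ih, List.forall_mem_cons]
    have h : HahnSeries.map (0 : LaurentSeries k) (algebraMap k K) = 0 := by ext; simp
    rw [h]

/-- The origin of `B(0, α)ⁿ`. -/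
def origin (α : DefConst L (full k 0 0 1)) (n : ℕ) : DefConst L (polydisc α n) where
  app K _ _ _ := ⟨⟨0, Fin.elim0, Fin.elim0⟩, fun i => by simp⟩
  definable_graph := by
    refine ⟨Formula.allZero (List.finRange (0 + n)), fun K _ _ p => ?_⟩
    rw [Formula.realize_allZero]
    constructor
    · rintro ⟨x, rfl⟩ i -
      refine Fin.addCases (fun j => j.elim0) (fun j => ?_) i
      exact Fin.append_right x.1.vf (0 : Fin n → LaurentSeries K) j
    · intro h
      refine ⟨⟨⟨Fin.elim0, Fin.elim0, Fin.elim0⟩, trivial⟩, ?_⟩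
      ext1
      · funext i
        rw [h i (List.mem_finRange i)]
        refine Fin.addCases (fun j => j.elim0) (fun j => ?_) i
        simp [HPoint.append]
      · funext i; exact Fin.elim0 (i.cast (by simp))
      · funext i; exact Fin.elim0 (i.cast (by simp))

end Definable

end MotivicMorse

end

/-!
# The Morse lemma for definable analytic functions

Over a fixed `K` the statement is a Morse lemma with parameter `t`. As `α_K ≥ 1`, all points of
the polydisc have coordinates in `t K[[t]]`, where a globally analytic function is the formal
evaluation `ev` of a power series `F` over `K` in `t` and the coordinates. The gradient of `F`
vanishes modulo `t` at the origin and its Jacobian is invertible there, so the formal inverse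
function theorem (`exists_inverse_series`) gives exactly one critical point `c`, and Hadamard's
lemma for the gradient shows that `c` is divisible by `t ^ α` (`exists_critical_point`). After
translation to `c`, Hadamard's lemma gives `f (c + y) = f c + ᵗy A(y) y` with `A(y)` a symmetric
matrix of power series (`eq_add_quadMatrix`). The matrix `A(0)⁻¹ A(y)` is congruent to `1` modulo
the maximal ideal, hence has a unique square root `B(y)` congruent to `1`
(`existsUnique_matrix_sqrt`), and uniqueness implies `A(y) = ᵗB(y) A(0) B(y)`
(`exists_congruence`). If `A(0) = ᵗP D P` with `D` diagonal, the coordinates are `T = P B(y) y`;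
they are inverted by the formal inverse function theorem once more.

The remaining point is that all this is definable uniformly in `K`. The power series themselves
are not definable objects, but their values at points are: each function used is characterised by
a first order condition on its values. The critical point is the only zero of the gradient, `B(y)`
is the only solution of a matrix equation over `K[[t]]`, and the inverse of `T` has the transposed
graph. Derivatives and divided differences are obtained without limits, as the only solutions `y`
of congruences over `K[[t]]` that hold for every small increment `h` of one coordinate, such as
`f (x + h) - f x ≡ y h` modulo `h ^ 2` (`IsDefinableFun.of_increments`). The diagonalisation of
`A(0)` involves a choice of pivots; one fixes finitely many integer matrices, one of which always
provides an invertible pivot, and takes the first that works (`hasDefinableDiagonalization`).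

Definability is expressed for relations between elements of `K[[t]]` (`IsDefinableRel`) and for
functions on `K[[t]]` (`IsDefinableFun`), which are closed under first order operations and under
composition; only at the end are they translated into definable morphisms (`exists_defMor`).
-/

namespace MotivicMorse

/-! ### Renaming of variables in formulas -/

section Definability

variable {k : Type u} [Field k]

/-- Renaming of the variables of a valued field term. -/
def VFTerm.rename {m n : ℕ} (σ : Fin m → Fin n) : VFTerm k m → VFTerm k n
  | .var i => .var (σ i)
  | .const c => .const c
  | .add s t => .add (s.rename σ) (t.rename σ)
  | .neg s => .neg (s.rename σ)
  | .mul s t => .mul (s.rename σ) (t.rename σ)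

theorem VFTerm.eval_rename {m n : ℕ} (σ : Fin m → Fin n) (K : Type u) [Field K] [Algebra k K]
    (x : Fin n → LaurentSeries K) (s : VFTerm k m) :
    (s.rename σ).eval K x = s.eval K (x ∘ σ) := by
  induction s <;> simp_all [VFTerm.rename, VFTerm.eval]

variable {L : DenefPas k}

/-- Renaming of the valued field variables of a residue field term. -/
def RFTerm.rename {m n l : ℕ} (σ : Fin m → Fin n) : RFTerm L m l → RFTerm L n l
  | .var i => .var i
  | .const c => .const c
  | .extra c => .extra c
  | .add s t => .add (s.rename σ) (t.rename σ)
  | .neg s => .neg (s.rename σ)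
  | .mul s t => .mul (s.rename σ) (t.rename σ)
  | .ac s => .ac (s.rename σ)

theorem RFTerm.eval_rename {m n l : ℕ} (σ : Fin m → Fin n) (K : Type u) [Field K] [Algebra k K]
    (x : Fin n → LaurentSeries K) (ξ : Fin l → K) (s : RFTerm L m l) :
    (s.rename σ).eval K x ξ = s.eval K (x ∘ σ) ξ := by
  induction s <;> simp_all [RFTerm.rename, RFTerm.eval, VFTerm.eval_rename]

/-- Renaming of the valued field variables of a value group term. -/
def VGTerm.rename {m n r : ℕ} (σ : Fin m → Fin n) : VGTerm L m r → VGTerm L n r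
  | .var i => .var i
  | .zero => .zero
  | .one => .one
  | .extra c => .extra c
  | .add s t => .add (s.rename σ) (t.rename σ)
  | .neg s => .neg (s.rename σ)
  | .ord s => .ord (s.rename σ)

theorem VGTerm.eval_rename {m n r : ℕ} (σ : Fin m → Fin n) (K : Type u) [Field K] [Algebra k K]
    (x : Fin n → LaurentSeries K) (a : Fin r → ℤ) (s : VGTerm L m r) :
    (s.rename σ).eval K x a = s.eval K (x ∘ σ) a := by
  induction s <;> simp_all [VGTerm.rename, VGTerm.eval, VFTerm.eval_rename]

/-- Renaming of the free valued field variables of a formula. -/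
def Formula.rename : {m l r : ℕ} → Formula L m l r → {n : ℕ} → (Fin m → Fin n) → Formula L n l r
  | _, _, _, .vfEq s t, _, σ => .vfEq (s.rename σ) (t.rename σ)
  | _, _, _, .rfEq s t, _, σ => .rfEq (s.rename σ) (t.rename σ)
  | _, _, _, .vgEq s t, _, σ => .vgEq (s.rename σ) (t.rename σ)
  | _, _, _, .vgLe s t, _, σ => .vgLe (s.rename σ) (t.rename σ)
  | _, _, _, .vgCong m s t, _, σ => .vgCong m (s.rename σ) (t.rename σ)
  | _, _, _, .not φ, _, σ => .not (φ.rename σ)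
  | _, _, _, .and φ ψ, _, σ => .and (φ.rename σ) (ψ.rename σ)
  | _, _, _, .vfEx φ, _, σ => .vfEx (φ.rename (Fin.cons 0 (Fin.succ ∘ σ)))
  | _, _, _, .rfEx φ, _, σ => .rfEx (φ.rename σ)
  | _, _, _, .vgEx φ, _, σ => .vgEx (φ.rename σ)

theorem Formula.realize_rename {m l r : ℕ} (φ : Formula L m l r) {n : ℕ} (σ : Fin m → Fin n)
    {K : Type u} [Field K] [Algebra k K] (p : HPoint n l r K) :
    (φ.rename σ).Realize p ↔ φ.Realize ⟨p.vf ∘ σ, p.rf, p.vg⟩ := by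
  induction φ generalizing n with
  | vfEx φ ih =>
    have h (y : LaurentSeries K) : (Fin.cons y p.vf : Fin (n + 1) → LaurentSeries K) ∘
        (Fin.cons 0 (Fin.succ ∘ σ) : Fin _ → Fin (n + 1)) = Fin.cons y (p.vf ∘ σ) := by
      funext i
      refine Fin.cases ?_ (fun j => ?_) i <;> simp
    simp only [Formula.rename, Formula.Realize, ih, h]
  | _ => simp_all [Formula.rename, Formula.Realize, VFTerm.eval_rename, RFTerm.eval_rename,
      VGTerm.eval_rename]

/-! ### Definable relations on `K[[t]]` -/

/-- The point of `h[m, 0, 0](K)` with the given coordinates in `K[[t]]`. -/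
noncomputable def integralPoint {m : ℕ} {K : Type u} [Field K] (p : Fin m → PowerSeries K) :
    HPoint m 0 0 K :=
  ⟨fun i => (p i : LaurentSeries K), Fin.elim0, Fin.elim0⟩

variable (L) in
/-- A family of relations on `K[[t]]`, in variables indexed by `ι`, is definable if one formula of
`L_DP(k)` cuts it out for all `K`. The variables are allowed to be placed anywhere in the context
of the formula, so that formulas for different relations can be combined without renaming. -/
def IsDefinableRel {ι : Type} (R : ∀ (K : Type u) [Field K] [Algebra k K],
    (ι → PowerSeries K) → Prop) : Prop :=
  ∀ (m : ℕ) (σ : ι → Fin m), ∃ φ : Formula L m 0 0,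
    ∀ (K : Type u) [Field K] [Algebra k K] (p : Fin m → PowerSeries K),
      φ.Realize (integralPoint p) ↔ R K (p ∘ σ)

variable (k) in
/-- A family of functions on `K[[t]]` is a term function if one term of the valued field sort
computes it for all `K`. -/
def IsTermFun {ι : Type} (g : ∀ (K : Type u) [Field K] [Algebra k K],
    (ι → PowerSeries K) → PowerSeries K) : Prop :=
  ∀ (m : ℕ) (σ : ι → Fin m), ∃ t : VFTerm k m,
    ∀ (K : Type u) [Field K] [Algebra k K] (p : Fin m → PowerSeries K),
      t.eval K (fun i => (p i : LaurentSeries K)) = (g K (p ∘ σ) : PowerSeries K)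

section TermFun

variable {ι : Type} {g h : ∀ (K : Type u) [Field K] [Algebra k K],
    (ι → PowerSeries K) → PowerSeries K}

theorem IsTermFun.var (i : ι) : IsTermFun k fun _ _ _ (p : ι → PowerSeries _) => p i :=
  fun _ σ => ⟨.var (σ i), fun _ _ _ _ => rfl⟩

theorem IsTermFun.const (c : PowerSeries k) : IsTermFun k (ι := ι)
    fun K _ _ _ => PowerSeries.map (algebraMap k K) c := by
  refine fun _ σ => ⟨.const c, fun K _ _ p => ?_⟩
  simp only [VFTerm.eval]
  ext z
  simp only [HahnSeries.map_coeff, PowerSeries.coeff_coe, PowerSeries.coeff_map]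
  split_ifs <;> simp

theorem IsTermFun.add (hg : IsTermFun k g) (hh : IsTermFun k h) :
    IsTermFun k fun K _ _ p => g K p + h K p := by
  intro m σ
  obtain ⟨s, hs⟩ := hg m σ
  obtain ⟨t, ht⟩ := hh m σ
  exact ⟨.add s t, fun K _ _ p => by simp [VFTerm.eval, hs, ht]⟩

theorem IsTermFun.mul (hg : IsTermFun k g) (hh : IsTermFun k h) :
    IsTermFun k fun K _ _ p => g K p * h K p := by
  intro m σ
  obtain ⟨s, hs⟩ := hg m σ
  obtain ⟨t, ht⟩ := hh m σ
  exact ⟨.mul s t, fun K _ _ p => by simp [VFTerm.eval, hs, ht]⟩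

theorem IsTermFun.neg (hg : IsTermFun k g) : IsTermFun k fun K _ _ p => - g K p := by
  intro m σ
  obtain ⟨s, hs⟩ := hg m σ
  exact ⟨.neg s, fun K _ _ p => by simp [VFTerm.eval, hs]⟩

theorem IsTermFun.intCast (z : ℤ) :
    IsTermFun k (ι := ι) fun K _ _ _ => (z : PowerSeries K) := by
  simpa using IsTermFun.const (ι := ι) (z : PowerSeries k)

theorem IsTermFun.eq (hg : IsTermFun k g) (hh : IsTermFun k h) :
    IsDefinableRel L fun K _ _ p => g K p = h K p := by
  intro m σ
  obtain ⟨s, hs⟩ := hg m σ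
  obtain ⟨t, ht⟩ := hh m σ
  exact ⟨.vfEq s t, fun K _ _ p => by
    simp [Formula.Realize, integralPoint, hs, ht, HahnSeries.ofPowerSeries_injective.eq_iff]⟩

end TermFun

section Rel

variable {ι κ : Type} {R S : ∀ (K : Type u) [Field K] [Algebra k K],
    (ι → PowerSeries K) → Prop}

theorem IsDefinableRel.congr (hR : IsDefinableRel L R)
    (h : ∀ (K : Type u) [Field K] [Algebra k K] (p : ι → PowerSeries K), S K p ↔ R K p) :
    IsDefinableRel L S := fun m σ =>
  (hR m σ).imp fun _ hφ K _ _ p => (hφ K p).trans (h K _).symm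

theorem IsDefinableRel.comap (hR : IsDefinableRel L R) (τ : ι → κ) :
    IsDefinableRel L fun K _ _ (p : κ → PowerSeries K) => R K (p ∘ τ) :=
  fun m σ => hR m (σ ∘ τ)

theorem IsDefinableRel.not (hR : IsDefinableRel L R) :
    IsDefinableRel L fun K _ _ p => ¬ R K p := by
  intro m σ
  obtain ⟨φ, hφ⟩ := hR m σ
  exact ⟨.not φ, fun K _ _ p => by simp [Formula.Realize, hφ]⟩

theorem IsDefinableRel.and (hR : IsDefinableRel L R) (hS : IsDefinableRel L S) :
    IsDefinableRel L fun K _ _ p => R K p ∧ S K p := by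
  intro m σ
  obtain ⟨φ, hφ⟩ := hR m σ
  obtain ⟨ψ, hψ⟩ := hS m σ
  exact ⟨.and φ ψ, fun K _ _ p => by simp [Formula.Realize, hφ, hψ]⟩

theorem IsDefinableRel.or (hR : IsDefinableRel L R) (hS : IsDefinableRel L S) :
    IsDefinableRel L fun K _ _ p => R K p ∨ S K p :=
  (hR.not.and hS.not).not.congr fun _ _ _ _ => by tauto

theorem IsDefinableRel.imp (hR : IsDefinableRel L R) (hS : IsDefinableRel L S) :
    IsDefinableRel L fun K _ _ p => R K p → S K p :=
  (hR.not.or hS).congr fun _ _ _ _ => by tauto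

theorem IsDefinableRel.true : IsDefinableRel L fun _ _ _ (_ : ι → PowerSeries _) => True :=
  fun _ _ => ⟨.vgEq .zero .zero, fun _ _ _ _ => by simp [Formula.Realize]⟩

/-- Integrality in terms of `HahnSeries.order`, the interpretation of the symbol `ord`. The junk
value `order 0 = 0` is harmless here. -/
theorem exists_coe_eq_iff_order_nonneg {K : Type u} [Field K] (y : LaurentSeries K) :
    (∃ z : PowerSeries K, (z : LaurentSeries K) = y) ↔ 0 ≤ y.order := by
  constructor
  · rintro ⟨z, rfl⟩
    by_cases hz : (z : LaurentSeries K) = 0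
    · simp [hz]
    · by_contra h
      have h1 := HahnSeries.coeff_order_eq_zero.not.mpr hz
      rw [PowerSeries.coeff_coe, if_pos (by omega)] at h1
      exact h1 rfl
  · intro h
    obtain ⟨d, hd⟩ := Int.eq_ofNat_of_zero_le h
    exact ⟨PowerSeries.X ^ d * y.powerSeriesPart, LaurentSeries.X_order_mul_powerSeriesPart hd.symm⟩

/-- Definable relations are closed under existential quantification over `K[[t]]`; the quantifier
of the language ranges over `K((t))`, and is relativised by the condition `ord ≥ 0`. -/
theorem IsDefinableRel.ex {R : ∀ (K : Type u) [Field K] [Algebra k K],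
    (Option ι → PowerSeries K) → Prop} (hR : IsDefinableRel L R) :
    IsDefinableRel L fun K _ _ p => ∃ y : PowerSeries K, R K (fun o => o.elim y p) := by
  intro m σ
  obtain ⟨φ, hφ⟩ := hR (m + 1) (fun o => o.elim 0 fun i => (σ i).succ)
  refine ⟨.vfEx (.and (.vgLe .zero (.ord (.var 0))) φ), fun K _ _ p => ?_⟩
  have key (y : PowerSeries K) :
      φ.Realize ⟨Fin.cons (y : LaurentSeries K) (integralPoint p).vf, (integralPoint p).rf,
        (integralPoint p).vg⟩ ↔
        R K (fun o => o.elim y (p ∘ σ)) := by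
    have h1 : (Fin.cons (y : LaurentSeries K) (integralPoint p).vf : Fin (m + 1) → _) =
        (integralPoint (Fin.cons y p)).vf := by
      funext i
      refine Fin.cases ?_ (fun j => ?_) i <;> simp [integralPoint]
    have h2 : (fun o => o.elim y (p ∘ σ) : Option ι → PowerSeries K) =
        (Fin.cons y p : Fin (m + 1) → PowerSeries K) ∘
          (fun o => o.elim 0 fun i => (σ i).succ) := by
      funext o
      cases o <;> simp
    rw [h1, h2]
    exact hφ K (Fin.cons y p)
  simp only [Formula.Realize, VGTerm.eval, VFTerm.eval, Fin.cons_zero]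
  constructor
  · rintro ⟨y, hy, h⟩
    obtain ⟨z, rfl⟩ := (exists_coe_eq_iff_order_nonneg y).mpr hy
    exact ⟨z, (key z).mp h⟩
  · rintro ⟨z, hz⟩
    exact ⟨z, (exists_coe_eq_iff_order_nonneg _).mp ⟨z, rfl⟩, (key z).mpr hz⟩

theorem IsDefinableRel.all {R : ∀ (K : Type u) [Field K] [Algebra k K],
    (Option ι → PowerSeries K) → Prop} (hR : IsDefinableRel L R) :
    IsDefinableRel L fun K _ _ p => ∀ y : PowerSeries K, R K (fun o => o.elim y p) :=
  hR.not.ex.not.congr fun _ _ _ _ => by push Not; rfl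

theorem IsDefinableRel.forall_finite {κ : Type} [Finite κ] {R : κ → ∀ (K : Type u) [Field K]
    [Algebra k K], (ι → PowerSeries K) → Prop} (hR : ∀ j, IsDefinableRel L (R j)) :
    IsDefinableRel L fun K _ _ p => ∀ j, R j K p := by
  cases nonempty_fintype κ
  classical
  have h (s : Finset κ) : IsDefinableRel L fun K _ _ p => ∀ j ∈ s, R j K p := by
    induction s using Finset.induction_on with
    | empty => exact IsDefinableRel.true.congr fun _ _ _ _ => by simp
    | insert j s _ ih => exact ((hR j).and ih).congr fun _ _ _ _ => by simp
  exact (h Finset.univ).congr fun _ _ _ _ => by simp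

theorem IsDefinableRel.exists_finite {κ : Type} [Finite κ] {R : κ → ∀ (K : Type u) [Field K]
    [Algebra k K], (ι → PowerSeries K) → Prop} (hR : ∀ j, IsDefinableRel L (R j)) :
    IsDefinableRel L fun K _ _ p => ∃ j, R j K p :=
  (IsDefinableRel.forall_finite fun j => (hR j).not).not.congr fun _ _ _ _ => by
    push Not; rfl

theorem IsDefinableRel.ex_tuple [hκ : Finite κ] {R : ∀ (K : Type u) [Field K] [Algebra k K],
    (ι ⊕ κ → PowerSeries K) → Prop} (hR : IsDefinableRel L R) :
    IsDefinableRel L fun K _ _ p => ∃ y : κ → PowerSeries K, R K (Sum.elim p y) := by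
  revert R
  induction κ using Finite.induction_empty_option generalizing ι with
  | of_equiv e ih =>
    intro R hR
    refine (ih (hR.comap (Sum.map id e.symm))).congr fun K _ _ p => ?_
    constructor
    · rintro ⟨y, hy⟩
      refine ⟨y ∘ e, ?_⟩
      convert hy using 1
      funext o; rcases o <;> simp
    · rintro ⟨y, hy⟩
      refine ⟨y ∘ e.symm, ?_⟩
      convert hy using 1
      funext o; rcases o <;> simp
  | h_empty =>
    intro R hR
    refine (hR.comap (Sum.elim id PEmpty.elim)).congr fun K _ _ p => ?_
    constructor
    · rintro ⟨y, hy⟩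
      convert hy using 1
      funext o; rcases o with i | i
      · simp
      · exact i.elim
    · intro hy
      refine ⟨PEmpty.elim, ?_⟩
      convert hy using 1
      funext o; rcases o with i | i
      · simp
      · exact i.elim
  | h_option ih =>
    rename_i κ _
    intro R hR
    let τ : ι ⊕ Option κ → Option ι ⊕ κ := Sum.elim (fun i => .inl (some i))
      (fun o => o.elim (.inl none) .inr)
    refine ((ih (hR.comap τ)).ex).congr fun K _ _ p => ?_
    constructor
    · rintro ⟨y, hy⟩
      refine ⟨y none, y ∘ some, ?_⟩
      convert hy using 1
      funext o; rcases o with i | _ | i <;> simp [τ]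
    · rintro ⟨y, z, hy⟩
      refine ⟨fun o => o.elim y z, ?_⟩
      convert hy using 1
      funext o; rcases o with i | _ | i <;> simp [τ]

end Rel

/-! ### Definable functions on `K[[t]]` -/

variable (L) in
/-- A family of functions is definable on the family of sets `D` if its graph over `D` is
definable. The values outside of `D` are irrelevant. -/
def IsDefinableFun {ι : Type} (D : ∀ (K : Type u) [Field K] [Algebra k K],
    (ι → PowerSeries K) → Prop) (g : ∀ (K : Type u) [Field K] [Algebra k K],
    (ι → PowerSeries K) → PowerSeries K) : Prop :=
  IsDefinableRel L fun K _ _ (q : Option ι → PowerSeries K) =>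
    D K (q ∘ some) ∧ q none = g K (q ∘ some)

section Fun

variable {ι κ : Type} {D : ∀ (K : Type u) [Field K] [Algebra k K], (ι → PowerSeries K) → Prop}
  {g h : ∀ (K : Type u) [Field K] [Algebra k K], (ι → PowerSeries K) → PowerSeries K}

theorem IsDefinableFun.congr (hg : IsDefinableFun L D g)
    (H : ∀ (K : Type u) [Field K] [Algebra k K] (p : ι → PowerSeries K), D K p → h K p = g K p) :
    IsDefinableFun L D h :=
  IsDefinableRel.congr hg fun K _ _ p => by
    constructor
    · rintro ⟨hp, e⟩; exact ⟨hp, by rw [e, H K _ hp]⟩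
    · rintro ⟨hp, e⟩; exact ⟨hp, by rw [e, H K _ hp]⟩

/-- Substitution of definable functions into a definable relation. -/
theorem IsDefinableRel.subst [Finite κ] (hD : IsDefinableRel L D) {R : ∀ (K : Type u) [Field K]
    [Algebra k K], (κ → PowerSeries K) → Prop} (hR : IsDefinableRel L R)
    {g : κ → ∀ (K : Type u) [Field K] [Algebra k K], (ι → PowerSeries K) → PowerSeries K}
    (hg : ∀ j, IsDefinableFun L D (g j)) :
    IsDefinableRel L fun K _ _ p => D K p ∧ R K (fun j => g j K p) := by
  have h1 (j : κ) : IsDefinableRel L fun K _ _ (q : ι ⊕ κ → PowerSeries K) =>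
      D K (q ∘ Sum.inl) ∧ q (.inr j) = g j K (q ∘ Sum.inl) :=
    (hg j).comap (fun o : Option ι => o.elim (Sum.inr j : ι ⊕ κ) Sum.inl)
  have h2 := hD.and
    ((IsDefinableRel.forall_finite h1).and (hR.comap (Sum.inr : κ → ι ⊕ κ))).ex_tuple
  refine h2.congr fun K _ _ p => ?_
  constructor
  · rintro ⟨hp, h⟩
    exact ⟨hp, fun j => g j K p, fun j => ⟨hp, rfl⟩, h⟩
  · rintro ⟨hp, y, hy, h⟩
    have : (fun j => g j K p) = y := funext fun j => ((hy j).2).symm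
    exact ⟨hp, this ▸ h⟩

theorem IsDefinableFun.comap (hg : IsDefinableFun L D g) (τ : ι → κ) :
    IsDefinableFun L (fun K _ _ (p : κ → PowerSeries K) => D K (p ∘ τ))
      (fun K _ _ p => g K (p ∘ τ)) :=
  IsDefinableRel.comap hg (Option.map τ)

theorem IsTermFun.isDefinableFun (hD : IsDefinableRel L D) (hg : IsTermFun k g) :
    IsDefinableFun L D g := by
  have h1 : IsTermFun k fun K _ _ (q : Option ι → PowerSeries K) => g K (q ∘ some) :=
    fun m σ => hg m (σ ∘ some)
  exact (hD.comap some).and ((IsTermFun.var none).eq h1)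

/-- A function determined by a definable relation is definable. -/
theorem IsDefinableFun.of_rel (hD : IsDefinableRel L D) {Q : ∀ (K : Type u) [Field K]
    [Algebra k K], (Option ι → PowerSeries K) → Prop} (hQ : IsDefinableRel L Q)
    (h : ∀ (K : Type u) [Field K] [Algebra k K] (p : ι → PowerSeries K), D K p →
      ∀ y, Q K (fun o => o.elim y p) ↔ y = g K p) : IsDefinableFun L D g := by
  refine ((hD.comap some).and hQ).congr fun K _ _ q => and_congr_right fun hq => ?_
  rw [← h K _ hq]
  convert Iff.rfl using 2
  funext o; cases o <;> rfl

/-- The components of a tuple of functions determined by a definable relation are definable. -/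
theorem IsDefinableFun.of_rel_tuple [Finite κ] (hD : IsDefinableRel L D) {Q : ∀ (K : Type u)
    [Field K] [Algebra k K], (ι ⊕ κ → PowerSeries K) → Prop} (hQ : IsDefinableRel L Q)
    {g : κ → ∀ (K : Type u) [Field K] [Algebra k K], (ι → PowerSeries K) → PowerSeries K}
    (h : ∀ (K : Type u) [Field K] [Algebra k K] (p : ι → PowerSeries K), D K p →
      ∀ y, Q K (Sum.elim p y) ↔ y = fun j => g j K p) (j : κ) : IsDefinableFun L D (g j) := by
  have h1 := (hQ.comap (Sum.map (some : ι → Option ι) (id : κ → κ))).and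
    ((IsTermFun.var (k := k) (Sum.inl none : Option ι ⊕ κ)).eq (IsTermFun.var (Sum.inr j)))
  refine IsDefinableFun.of_rel hD h1.ex_tuple fun K _ _ p hp y => ?_
  have e (z : κ → PowerSeries K) : (Sum.elim (fun o : Option ι => o.elim y p) z) ∘
      (Sum.map (some : ι → Option ι) (id : κ → κ)) = Sum.elim p z := by
    funext o; rcases o <;> rfl
  simp only [e, h K p hp, exists_eq_left, Sum.elim_inl, Sum.elim_inr, Option.elim_none]

/-- Composition of a definable function with a tuple of definable functions. -/
theorem IsDefinableFun.comp [Finite κ] (hD : IsDefinableRel L D) {E : ∀ (K : Type u) [Field K]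
    [Algebra k K], (κ → PowerSeries K) → Prop} {F : ∀ (K : Type u) [Field K] [Algebra k K],
    (κ → PowerSeries K) → PowerSeries K} (hF : IsDefinableFun L E F)
    {g : κ → ∀ (K : Type u) [Field K] [Algebra k K], (ι → PowerSeries K) → PowerSeries K}
    (hg : ∀ j, IsDefinableFun L D (g j))
    (hE : ∀ (K : Type u) [Field K] [Algebra k K] (p : ι → PowerSeries K), D K p →
      E K (fun j => g j K p)) :
    IsDefinableFun L D fun K _ _ p => F K (fun j => g j K p) := by
  have hD' : IsDefinableRel L fun K _ _ (q : Option ι → PowerSeries K) => D K (q ∘ some) :=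
    hD.comap some
  have h1 := hD'.subst (R := fun K _ _ (q : Option κ → PowerSeries K) =>
      E K (q ∘ some) ∧ q none = F K (q ∘ some)) hF
    (g := fun o => o.elim (fun _ _ _ q => q none) (fun j K _ _ q => g j K (q ∘ some)))
    (fun o => by
      cases o with
      | none => exact (IsTermFun.var none).isDefinableFun hD'
      | some j => exact (hg j).comap some)
  refine h1.congr fun K _ _ q => and_congr_right fun hq => ?_
  exact ⟨fun h => ⟨hE K _ hq, h⟩, fun h => h.2⟩

theorem IsDefinableFun.comp_term {κ : Type} [Finite κ] (hD : IsDefinableRel L D)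
    {F : ∀ (K : Type u) [Field K] [Algebra k K],
    (κ → PowerSeries K) → PowerSeries K} (hF : IsTermFun k F)
    {g : κ → ∀ (K : Type u) [Field K] [Algebra k K], (ι → PowerSeries K) → PowerSeries K}
    (hg : ∀ j, IsDefinableFun L D (g j)) :
    IsDefinableFun L D fun K _ _ p => F K (fun j => g j K p) :=
  IsDefinableFun.comp hD (hF.isDefinableFun IsDefinableRel.true) hg fun _ _ _ _ _ => trivial

theorem IsDefinableFun.add (hD : IsDefinableRel L D) (hg : IsDefinableFun L D g)
    (hh : IsDefinableFun L D h) : IsDefinableFun L D fun K _ _ p => g K p + h K p :=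
  IsDefinableFun.comp_term (κ := Bool) hD (IsTermFun.add (IsTermFun.var true) (IsTermFun.var false))
    (g := fun b => if b then g else h) (by rintro (_ | _) <;> simpa)

theorem IsDefinableFun.mul (hD : IsDefinableRel L D) (hg : IsDefinableFun L D g)
    (hh : IsDefinableFun L D h) : IsDefinableFun L D fun K _ _ p => g K p * h K p :=
  IsDefinableFun.comp_term (κ := Bool) hD (IsTermFun.mul (IsTermFun.var true) (IsTermFun.var false))
    (g := fun b => if b then g else h) (by rintro (_ | _) <;> simpa)

theorem IsDefinableFun.neg (hD : IsDefinableRel L D) (hg : IsDefinableFun L D g) :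
    IsDefinableFun L D fun K _ _ p => - g K p :=
  IsDefinableFun.comp_term (κ := Unit) hD (IsTermFun.neg (IsTermFun.var ())) (g := fun _ => g)
    fun _ => hg

theorem IsDefinableFun.sub (hD : IsDefinableRel L D) (hg : IsDefinableFun L D g)
    (hh : IsDefinableFun L D h) : IsDefinableFun L D fun K _ _ p => g K p - h K p := by
  simpa [sub_eq_add_neg] using hg.add hD (hh.neg hD)

theorem IsDefinableFun.sum (hD : IsDefinableRel L D) {κ : Type} (s : Finset κ)
    {g : κ → ∀ (K : Type u) [Field K] [Algebra k K], (ι → PowerSeries K) → PowerSeries K}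
    (hg : ∀ j ∈ s, IsDefinableFun L D (g j)) :
    IsDefinableFun L D fun K _ _ p => ∑ j ∈ s, g j K p := by
  classical
  induction s using Finset.induction_on with
  | empty => simpa using (IsTermFun.intCast 0).isDefinableFun hD
  | insert j s hj ih =>
    simp only [Finset.sum_insert hj]
    exact (hg j (by simp)).add hD (ih fun i hi => hg i (by simp [hi]))

/-- The equality of two definable functions is a definable condition. -/
theorem IsDefinableFun.eq (hD : IsDefinableRel L D) (hg : IsDefinableFun L D g)
    (hh : IsDefinableFun L D h) : IsDefinableRel L fun K _ _ p => D K p ∧ g K p = h K p :=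
  hD.subst (κ := Bool) (IsTermFun.eq (IsTermFun.var true) (IsTermFun.var false))
    (g := fun b => if b then g else h) (by rintro (_ | _) <;> simpa)

theorem isDefinableRel_isUnit : IsDefinableRel L fun K _ _ (p : Unit → PowerSeries K) =>
    IsUnit (p ()) := by
  have h1 := (IsTermFun.eq (L := L) (IsTermFun.mul (IsTermFun.var (some ())) (IsTermFun.var none))
    (IsTermFun.intCast 1)).ex
  refine h1.congr fun K _ _ p => ?_
  simp only [isUnit_iff_exists_inv, Option.elim_none, Option.elim_some, Int.cast_one]

theorem IsDefinableFun.isUnit (hD : IsDefinableRel L D) (hg : IsDefinableFun L D g) :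
    IsDefinableRel L fun K _ _ p => D K p ∧ IsUnit (g K p) :=
  hD.subst isDefinableRel_isUnit (g := fun _ => g) fun _ => hg

/-- The inverse of a definable function with values in the units is definable. -/
theorem IsDefinableFun.inverse (hD : IsDefinableRel L D) (hg : IsDefinableFun L D g)
    (hu : ∀ (K : Type u) [Field K] [Algebra k K] (p : ι → PowerSeries K), D K p →
      IsUnit (g K p)) :
    IsDefinableFun L D fun K _ _ p => Ring.inverse (g K p) := by
  have hD' : IsDefinableRel L fun K _ _ (q : Option ι → PowerSeries K) => D K (q ∘ some) :=
    hD.comap some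
  have h2 := IsDefinableFun.eq hD' ((hg.comap some).mul hD'
    ((IsTermFun.var none).isDefinableFun hD')) ((IsTermFun.intCast 1).isDefinableFun hD')
  refine IsDefinableFun.of_rel hD h2 fun K _ _ p hp y => ?_
  have e : ((fun o : Option ι => o.elim y p) ∘ some) = p := rfl
  simp only [e, Option.elim_none, Int.cast_one, hp, true_and]
  obtain ⟨u, hu⟩ := hu K p hp
  rw [← hu, Ring.inverse_unit]
  constructor
  · intro h
    calc y = ↑u⁻¹ * (↑u * y) := by simp
      _ = _ := by rw [h, mul_one]
  · rintro rfl; simp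

/-- A definable choice among finitely many definable conditions, one of which always holds. The
choice is the first one in a fixed enumeration. -/
theorem exists_definable_choice {Ω : Type} [Finite Ω]
    {V : Ω → ∀ (K : Type u) [Field K] [Algebra k K], (ι → PowerSeries K) → Prop}
    (hV : ∀ w, IsDefinableRel L fun K _ _ p => D K p ∧ V w K p)
    (hex : ∀ (K : Type u) [Field K] [Algebra k K] (p : ι → PowerSeries K), D K p → ∃ w, V w K p) :
    ∃ s : ∀ (K : Type u) [Field K] [Algebra k K], (ι → PowerSeries K) → Option Ω,
      (∀ w, IsDefinableRel L fun K _ _ p => D K p ∧ s K p = some w) ∧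
      ∀ (K : Type u) [Field K] [Algebra k K] (p : ι → PowerSeries K), D K p →
        ∃ w, s K p = some w ∧ V w K p := by
  classical
  obtain ⟨N, ⟨e⟩⟩ := Finite.exists_equiv_fin Ω
  let good (K : Type u) [Field K] [Algebra k K] (p : ι → PowerSeries K) (w : Ω) : Prop :=
    V w K p ∧ ∀ w', e w' < e w → ¬ V w' K p
  have huniq (K : Type u) [Field K] [Algebra k K] (p : ι → PowerSeries K) (w w' : Ω)
      (h : good K p w) (h' : good K p w') : w = w' := by
    rcases lt_trichotomy (e w) (e w') with hlt | heq | hlt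
    · exact absurd h.1 (h'.2 _ hlt)
    · exact e.injective heq
    · exact absurd h'.1 (h.2 _ hlt)
  have hgood (K : Type u) [Field K] [Algebra k K] (p : ι → PowerSeries K) (hp : D K p) :
      ∃ w, good K p w := by
    obtain ⟨w, hw, hmin⟩ := WellFounded.has_min (InvImage.wf e (wellFounded_lt (α := Fin N)))
      {w | V w K p} (hex K p hp)
    exact ⟨w, hw, fun w' h' hV' => hmin w' hV' h'⟩
  refine ⟨fun K _ _ p => if h : ∃ w, good K p w then some h.choose else none, fun w => ?_,
    fun K _ _ p hp => ?_⟩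
  · have h1 := (hV w).and (IsDefinableRel.forall_finite
      (κ := {w' : Ω // e w' < e w}) fun w' => (hV w').not)
    refine h1.congr fun K _ _ p => ?_
    constructor
    · rintro ⟨hp, hs⟩
      have h := hgood K p hp
      beta_reduce at hs
      rw [dif_pos h, Option.some.injEq] at hs
      have h2 := h.choose_spec
      rw [hs] at h2
      exact ⟨⟨hp, h2.1⟩, fun w' h' => h2.2 _ w'.2 h'.2⟩
    · rintro ⟨⟨hp, hw⟩, hw'⟩
      have hg : good K p w := ⟨hw, fun w' hlt h => hw' ⟨w', hlt⟩ ⟨hp, h⟩⟩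
      have h : ∃ w, good K p w := ⟨w, hg⟩
      exact ⟨hp, by beta_reduce; rw [dif_pos h, huniq K p _ _ h.choose_spec hg]⟩
  · have h := hgood K p hp
    exact ⟨h.choose, by beta_reduce; rw [dif_pos h], h.choose_spec.1⟩

/-- Definition by cases along a definable choice. -/
theorem IsDefinableFun.cases {Ω : Type} [Finite Ω]
    {s : ∀ (K : Type u) [Field K] [Algebra k K], (ι → PowerSeries K) → Option Ω}
    (hs' : ∀ (K : Type u) [Field K] [Algebra k K] (p : ι → PowerSeries K), D K p →
        ∃ w, s K p = some w)
    {g : Ω → ∀ (K : Type u) [Field K] [Algebra k K], (ι → PowerSeries K) → PowerSeries K}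
    (hg : ∀ w, IsDefinableFun L (fun K _ _ p => D K p ∧ s K p = some w) (g w)) :
    IsDefinableFun L D fun K _ _ p => (s K p).elim 0 fun w => g w K p := by
  refine (IsDefinableRel.exists_finite hg).congr fun K _ _ q => ?_
  constructor
  · rintro ⟨hq, e⟩
    obtain ⟨w, hw⟩ := hs' K _ hq
    exact ⟨w, ⟨hq, hw⟩, by beta_reduce at e ⊢; rw [e, hw]; rfl⟩
  · rintro ⟨w, ⟨hq, hw⟩, e⟩
    exact ⟨hq, by beta_reduce; rw [e, hw]; rfl⟩

end Fun

end Definability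

section FormalSeries

open MvPowerSeries

variable {K : Type*} [Field K] {σ τ : Type*}

/-! ### The order filtration -/

variable (τ K) in
/-- The ideal of power series of order at least `d`. -/
def orderIdeal (d : ℕ) : Ideal (MvPowerSeries τ K) where
  carrier := {F | ∀ m : τ →₀ ℕ, m.degree < d → coeff m F = 0}
  add_mem' hF hG m hm := by simp [hF m hm, hG m hm]
  zero_mem' m _ := by simp
  smul_mem' c F hF m hm := by
    classical
    rw [smul_eq_mul, coeff_mul]
    refine Finset.sum_eq_zero fun p hp => ?_
    have h : p.1.degree + p.2.degree = m.degree := by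
      rw [← Finset.HasAntidiagonal.mem_antidiagonal.mp hp, map_add]
    rw [hF p.2 (by omega), mul_zero]

theorem mem_orderIdeal {d : ℕ} {F : MvPowerSeries τ K} :
    F ∈ orderIdeal K τ d ↔ ∀ m : τ →₀ ℕ, m.degree < d → coeff m F = 0 := Iff.rfl

theorem orderIdeal_anti {d e : ℕ} (h : d ≤ e) : orderIdeal K τ e ≤ orderIdeal K τ d :=
  fun _ hF m hm => hF m (hm.trans_le h)

theorem mem_orderIdeal_zero (F : MvPowerSeries τ K) : F ∈ orderIdeal K τ 0 :=
  fun _ hm => absurd hm (Nat.not_lt_zero _)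

theorem mem_orderIdeal_one {F : MvPowerSeries τ K} :
    F ∈ orderIdeal K τ 1 ↔ constantCoeff F = 0 := by
  rw [mem_orderIdeal]
  constructor
  · intro h
    simpa using h 0 (by simp)
  · intro h m hm
    have : m = 0 := by
      rw [← Finsupp.degree_eq_zero_iff]; omega
    simpa [this] using h

theorem mul_mem_orderIdeal {d e : ℕ} {F G : MvPowerSeries τ K} (hF : F ∈ orderIdeal K τ d)
    (hG : G ∈ orderIdeal K τ e) : F * G ∈ orderIdeal K τ (d + e) := by
  classical
  intro m hm
  rw [coeff_mul]
  refine Finset.sum_eq_zero fun p hp => ?_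
  have h : p.1.degree + p.2.degree = m.degree := by
    rw [← Finset.HasAntidiagonal.mem_antidiagonal.mp hp, map_add]
  by_cases h1 : p.1.degree < d
  · rw [hF p.1 h1, zero_mul]
  · rw [hG p.2 (by omega), mul_zero]

theorem eq_of_forall_sub_mem_orderIdeal {F G : MvPowerSeries τ K}
    (h : ∀ d, F - G ∈ orderIdeal K τ d) : F = G := by
  ext m
  have := h (m.degree + 1) m (Nat.lt_succ_self _)
  rwa [map_sub, sub_eq_zero] at this

/-! ### Monomials and substitution -/

/-- The monomial with exponent `e` evaluated at `a`. -/
noncomputable def monomialAt (a : σ → MvPowerSeries τ K) (e : σ →₀ ℕ) : MvPowerSeries τ K :=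
  e.prod fun s m => a s ^ m

theorem monomialAt_zero (a : σ → MvPowerSeries τ K) : monomialAt a 0 = 1 := by
  simp [monomialAt]

theorem monomialAt_single_add (a : σ → MvPowerSeries τ K) (s : σ) (e : σ →₀ ℕ) :
    monomialAt a (Finsupp.single s 1 + e) = a s * monomialAt a e := by
  rw [monomialAt, Finsupp.prod_add_index' (by simp) (by simp [pow_add])]
  simp [monomialAt]

theorem exponent_induction {p : (σ →₀ ℕ) → Prop} (h0 : p 0)
    (h1 : ∀ s e, p e → p (Finsupp.single s 1 + e)) (e : σ →₀ ℕ) : p e := by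
  induction e using Finsupp.induction_linear with
  | zero => exact h0
  | add f g hf hg =>
    clear hf
    induction f using Finsupp.induction with
    | zero => simpa
    | single_add a b f ha hb ih =>
      clear hb ha
      induction b with
      | zero => simpa
      | succ b ihb =>
        have := h1 a _ ihb
        convert this using 1
        rw [Finsupp.single_add]
        abel
  | single a b =>
    induction b with
    | zero => simpa
    | succ b ihb =>
      have := h1 a _ ihb
      convert this using 1
      rw [add_comm, Finsupp.single_add]

theorem exponent_cases (e : σ →₀ ℕ) : e = 0 ∨ ∃ s e', e = Finsupp.single s 1 + e' := by
  induction e using exponent_induction with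
  | h0 => exact .inl rfl
  | h1 s e _ => exact .inr ⟨s, e, rfl⟩

theorem monomialAt_mem_orderIdeal {a : σ → MvPowerSeries τ K} (ha : ∀ s, constantCoeff (a s) = 0)
    (e : σ →₀ ℕ) : monomialAt a e ∈ orderIdeal K τ e.degree := by
  induction e using exponent_induction with
  | h0 => simpa using mem_orderIdeal_zero _
  | h1 s e ih =>
    rw [monomialAt_single_add, map_add, Finsupp.degree_single]
    exact mul_mem_orderIdeal (mem_orderIdeal_one.mpr (ha s)) ih

theorem monomialAt_sub_mem_orderIdeal {a b : σ → MvPowerSeries τ K} {d : ℕ}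
    (h : ∀ s, a s - b s ∈ orderIdeal K τ d) (e : σ →₀ ℕ) :
    monomialAt a e - monomialAt b e ∈ orderIdeal K τ d := by
  induction e using exponent_induction with
  | h0 => simp [monomialAt_zero]
  | h1 s e ih =>
    rw [monomialAt_single_add, monomialAt_single_add]
    have : a s * monomialAt a e - b s * monomialAt b e =
      monomialAt a e * (a s - b s) + b s * (monomialAt a e - monomialAt b e) := by ring
    rw [this]
    exact add_mem (Ideal.mul_mem_left _ _ (h s)) (Ideal.mul_mem_left _ _ ih)

/-- Monomials that are not linear gain one order of congruence. -/
theorem monomialAt_sub_mem_orderIdeal_succ {a b : σ → MvPowerSeries τ K} {d : ℕ}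
    (ha : ∀ s, constantCoeff (a s) = 0) (hb : ∀ s, constantCoeff (b s) = 0)
    (h : ∀ s, a s - b s ∈ orderIdeal K τ d) (e : σ →₀ ℕ)
    (he : ∀ s, a s ≠ b s → e ≠ Finsupp.single s 1) :
    monomialAt a e - monomialAt b e ∈ orderIdeal K τ (d + 1) := by
  obtain rfl | ⟨s, e', rfl⟩ := exponent_cases e
  · simp [monomialAt_zero]
  · rw [monomialAt_single_add, monomialAt_single_add]
    have h1 : a s * monomialAt a e' - b s * monomialAt b e' =
      (a s - b s) * monomialAt a e' + (monomialAt a e' - monomialAt b e') * b s := by ring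
    rw [h1]
    refine add_mem ?_ (mul_mem_orderIdeal (monomialAt_sub_mem_orderIdeal h e')
      (mem_orderIdeal_one.mpr (hb s)))
    by_cases hs : a s = b s
    · simp [hs]
    · have he' : e' ≠ 0 := fun h0 => he s hs (by simp [h0])
      refine mul_mem_orderIdeal (h s) (orderIdeal_anti ?_ (monomialAt_mem_orderIdeal ha e'))
      rw [Nat.one_le_iff_ne_zero, Ne, Finsupp.degree_eq_zero_iff]
      exact he'

theorem coeff_subst_congr {a b : σ → MvPowerSeries τ K} (ha : HasSubst a) (hb : HasSubst b)
    {F G : MvPowerSeries σ K} {m : τ →₀ ℕ} (h : ∀ e, coeff e F * coeff m (monomialAt a e) =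
      coeff e G * coeff m (monomialAt b e)) :
    coeff m (subst a F) = coeff m (subst b G) := by
  rw [coeff_subst ha, coeff_subst hb]
  exact finsum_congr h

theorem subst_sub_mem_orderIdeal_of_monomials {a b : σ → MvPowerSeries τ K} (ha : HasSubst a)
    (hb : HasSubst b) {F : MvPowerSeries σ K} {d : ℕ}
    (h : ∀ e, coeff e F ≠ 0 → monomialAt a e - monomialAt b e ∈ orderIdeal K τ d) :
    subst a F - subst b F ∈ orderIdeal K τ d := by
  intro m hm
  rw [map_sub, sub_eq_zero]
  refine coeff_subst_congr ha hb fun e => ?_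
  by_cases he : coeff e F = 0
  · simp [he]
  · have := h e he m hm
    rw [map_sub, sub_eq_zero] at this
    rw [this]

theorem subst_sub_mem_orderIdeal {a b : σ → MvPowerSeries τ K} (ha : HasSubst a)
    (hb : HasSubst b) (F : MvPowerSeries σ K) {d : ℕ}
    (h : ∀ s, a s - b s ∈ orderIdeal K τ d) : subst a F - subst b F ∈ orderIdeal K τ d :=
  subst_sub_mem_orderIdeal_of_monomials ha hb fun e _ => monomialAt_sub_mem_orderIdeal h e

theorem subst_mem_orderIdeal {a : σ → MvPowerSeries τ K} (ha : HasSubst a)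
    (ha0 : ∀ s, constantCoeff (a s) = 0) {F : MvPowerSeries σ K} {d : ℕ}
    (hF : F ∈ orderIdeal K σ d) : subst a F ∈ orderIdeal K τ d := by
  intro m hm
  rw [coeff_subst ha, finsum_eq_zero_of_forall_eq_zero]
  intro e
  by_cases he : e.degree < d
  · rw [hF e he, zero_smul]
  · rw [show (e.prod fun s m => a s ^ m) = monomialAt a e from rfl,
      monomialAt_mem_orderIdeal ha0 e m (by omega), smul_zero]

theorem constantCoeff_subst_of_zero {a : σ → MvPowerSeries τ K} (ha : HasSubst a)
    (ha0 : ∀ s, constantCoeff (a s) = 0) (F : MvPowerSeries σ K) :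
    constantCoeff (subst a F) = constantCoeff F := by
  have h : F = C (constantCoeff F) + (F - C (constantCoeff F)) := by ring
  conv_lhs => rw [h]
  rw [subst_add ha, map_add, constantCoeff_subst_eq_zero ha ha0 (f := F - _) (by simp)]
  rw [← substAlgHom_apply ha, show (C (constantCoeff F) : MvPowerSeries σ K) =
    algebraMap K _ (constantCoeff F) from rfl, AlgHom.commutes]
  simp [MvPowerSeries.algebraMap_apply]

/-! ### Fixed points of contractions -/

/-- A map on tuples of power series without constant term that improves congruences by one order
has a unique fixed point. -/
theorem existsUnique_fixedPoint {ι : Type*}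
    (Φ : (ι → MvPowerSeries τ K) → ι → MvPowerSeries τ K)
    (hΦ0 : ∀ a, (∀ i, constantCoeff (a i) = 0) → ∀ i, constantCoeff (Φ a i) = 0)
    (hΦ : ∀ a b, (∀ i, constantCoeff (a i) = 0) → (∀ i, constantCoeff (b i) = 0) →
      ∀ d, 1 ≤ d → (∀ i, a i - b i ∈ orderIdeal K τ d) →
        ∀ i, Φ a i - Φ b i ∈ orderIdeal K τ (d + 1)) :
    ∃! a : ι → MvPowerSeries τ K, (∀ i, constantCoeff (a i) = 0) ∧ Φ a = a := by
  let a (d : ℕ) : ι → MvPowerSeries τ K := Φ^[d] 0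
  have ha_succ (d : ℕ) : a (d + 1) = Φ (a d) := Function.iterate_succ_apply' Φ d 0
  have ha0 (d : ℕ) : ∀ i, constantCoeff (a d i) = 0 := by
    induction d with
    | zero => simp [a]
    | succ d ih => rw [ha_succ]; exact hΦ0 _ ih
  have hstep (d : ℕ) : ∀ i, a (d + 1) i - a d i ∈ orderIdeal K τ (d + 1) := by
    induction d with
    | zero => exact fun i => mem_orderIdeal_one.mpr (by simp [ha0])
    | succ d ih =>
      rw [ha_succ, ha_succ]
      exact hΦ _ _ (by rw [← ha_succ]; exact ha0 _) (ha0 _) _ (by omega)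
        (by simpa [ha_succ] using ih)
  have hcauchy (d j : ℕ) : ∀ i, a (d + j) i - a d i ∈ orderIdeal K τ (d + 1) := by
    induction j with
    | zero => simp
    | succ j ih =>
      intro i
      have := add_mem (orderIdeal_anti (by omega) (hstep (d + j) i)) (ih i)
      simpa [add_assoc] using this
  let A : ι → MvPowerSeries τ K := fun i m => coeff m (a m.degree i)
  have hA (d : ℕ) (i : ι) : A i - a d i ∈ orderIdeal K τ (d + 1) := by
    intro m hm
    obtain ⟨j, rfl⟩ := Nat.exists_eq_add_of_le (Nat.lt_succ_iff.mp hm)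
    have := hcauchy m.degree j i m (Nat.lt_succ_self _)
    rw [map_sub, sub_eq_zero] at this ⊢
    exact this.symm
  have hA0 (i : ι) : constantCoeff (A i) = 0 := by
    have := mem_orderIdeal_one.mp (hA 0 i)
    rwa [map_sub, ha0, sub_zero] at this
  refine ⟨A, ⟨hA0, ?_⟩, ?_⟩
  · funext i
    refine eq_of_forall_sub_mem_orderIdeal fun d => ?_
    have h1 := hΦ A (a d) hA0 (ha0 d) (d + 1) (by omega) (hA d) i
    have h2 := hA (d + 1) i
    rw [ha_succ] at h2
    have h3 := sub_mem h1 h2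
    refine orderIdeal_anti (by omega : d ≤ d + 1 + 1) ?_
    have e : Φ A i - A i = Φ A i - Φ (a d) i - (A i - Φ (a d) i) := by ring
    rwa [e]
  · rintro B ⟨hB0, hB⟩
    have h (d : ℕ) : ∀ i, B i - a d i ∈ orderIdeal K τ (d + 1) := by
      induction d with
      | zero => exact fun i => mem_orderIdeal_one.mpr (by simp [ha0, hB0])
      | succ d ih =>
        intro i
        have := hΦ B (a d) hB0 (ha0 d) _ (by omega) ih i
        rwa [hB, ← ha_succ] at this
    funext i
    refine eq_of_forall_sub_mem_orderIdeal fun d => ?_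
    have := sub_mem (h d i) (hA d i)
    refine orderIdeal_anti (by omega : d ≤ d + 1) ?_
    simpa using this

/-- A matrix of power series congruent to `1` modulo the maximal ideal has a unique square root
congruent to `1`. -/
theorem existsUnique_matrix_sqrt [CharZero K] {N : Type*} [Fintype N] [DecidableEq N]
    (C : Matrix N N (MvPowerSeries τ K)) (hC : ∀ i j, constantCoeff ((C - 1) i j) = 0) :
    ∃! B : Matrix N N (MvPowerSeries τ K), (∀ i j, constantCoeff ((B - 1) i j) = 0) ∧
      B * B = C := by
  let half : MvPowerSeries τ K := MvPowerSeries.C (1 / 2)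
  have h2 : half * 2 = 1 := by
    rw [← map_ofNat (MvPowerSeries.C (σ := τ) (R := K)) 2, ← map_mul]
    simp
  -- `B = 1 + E` is a square root of `C` exactly if `E = (C - 1 - E ^ 2) / 2`
  let Φ (a : N × N → MvPowerSeries τ K) (q : N × N) : MvPowerSeries τ K :=
    half * ((C - 1) q.1 q.2 - ∑ j, a (q.1, j) * a (j, q.2))
  obtain ⟨a, ⟨ha0, ha⟩, huniq⟩ := existsUnique_fixedPoint Φ
    (fun a ha q => by simp only [Φ, map_mul, map_sub, map_sum, hC, ha]; simp)
    (fun a b ha hb d hd hab q => by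
      have e : Φ a q - Φ b q = half * ∑ j, (-((a (q.1, j) - b (q.1, j)) * a (j, q.2)) -
          (a (j, q.2) - b (j, q.2)) * b (q.1, j)) := by
        simp only [Φ, ← mul_sub]
        rw [sub_sub_sub_cancel_left, ← Finset.sum_sub_distrib]
        congr 1
        exact Finset.sum_congr rfl fun j _ => by ring
      rw [e]
      refine Ideal.mul_mem_left _ _ (Ideal.sum_mem _ fun j _ => sub_mem (neg_mem ?_) ?_)
      · exact mul_mem_orderIdeal (hab _) (mem_orderIdeal_one.mpr (ha _))
      · exact mul_mem_orderIdeal (hab _) (mem_orderIdeal_one.mpr (hb _)))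
  have key (E : Matrix N N (MvPowerSeries τ K)) : (1 + E) * (1 + E) = C ↔
      Φ (fun q => E q.1 q.2) = fun q => E q.1 q.2 := by
    have e1 : (1 + E) * (1 + E) = 1 + (2 : MvPowerSeries τ K) • E + E * E := by
      rw [two_smul]; noncomm_ring
    have h1 (i j : N) : (1 + (2 : MvPowerSeries τ K) • E + E * E) i j = C i j ↔
        half * ((C - 1) i j - ∑ l, E i l * E l j) = E i j := by
      simp only [Matrix.add_apply, Matrix.smul_apply, smul_eq_mul, Matrix.mul_apply,
        Matrix.sub_apply]
      constructor
      · intro h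
        rw [← h]
        linear_combination E i j * h2
      · intro h
        rw [← h]
        linear_combination (C i j - (1 : Matrix N N _) i j - ∑ l, E i l * E l j) * h2
    rw [e1, ← Matrix.ext_iff, funext_iff]
    exact ⟨fun h q => (h1 _ _).mp (h _ _), fun h i j => (h1 i j).mpr (h (i, j))⟩
  refine ⟨1 + Matrix.of fun i j => a (i, j), ⟨fun i j => by simp [ha0], (key _).mpr ha⟩, ?_⟩
  rintro B ⟨hB0, hB⟩
  have hB' := (key (B - 1)).mp (by simpa using hB)
  have := huniq _ ⟨fun q => hB0 q.1 q.2, hB'⟩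
  ext1 i j
  have hij := congrFun this (i, j)
  simp only [Matrix.sub_apply] at hij
  simp [← hij]

end FormalSeries

section Evaluation

open MvPowerSeries

variable {K : Type*} [Field K] {σ τ ι : Type*}

/-! ### Splitting off variables and Taylor's formula -/

open Classical in
/-- The power series obtained from `F` by setting the variables in `S` to `0`. -/
noncomputable def kill (S : Set σ) (F : MvPowerSeries σ K) : MvPowerSeries σ K :=
  fun e => if ∀ s ∈ S, e s = 0 then coeff e F else 0

/-- The coefficient of `X s` in `F`, as a power series: `F` is the sum of a power series free of
`X s` and of `X s * shift s F`. -/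
noncomputable def shift (s : σ) (F : MvPowerSeries σ K) : MvPowerSeries σ K :=
  fun e => coeff (e + Finsupp.single s 1) F

open Classical in
theorem coeff_kill (S : Set σ) (F : MvPowerSeries σ K) (e : σ →₀ ℕ) :
    coeff e (kill S F) = if ∀ s ∈ S, e s = 0 then coeff e F else 0 := rfl

theorem coeff_shift (s : σ) (F : MvPowerSeries σ K) (e : σ →₀ ℕ) :
    coeff e (shift s F) = coeff (e + Finsupp.single s 1) F := rfl

theorem kill_add_X_mul_shift (s : σ) (F : MvPowerSeries σ K) :
    kill {s} F + X s * shift s F = F := by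
  classical
  ext e
  rw [map_add, coeff_kill, X, coeff_monomial_mul]
  by_cases he : e s = 0
  · rw [if_pos (by simpa using he), if_neg, add_zero]
    intro h
    have := h s
    simp [he] at this
  · have h : Finsupp.single s 1 ≤ e := by
      rw [Finsupp.single_le_iff]; omega
    rw [if_neg (by simpa using he), if_pos h, zero_add, one_mul, coeff_shift,
      tsub_add_cancel_of_le h]

theorem kill_insert (s : σ) (S : Set σ) (F : MvPowerSeries σ K) :
    kill {s} (kill S F) = kill (insert s S) F := by
  classical
  ext e
  have h : (∀ s' ∈ insert s S, e s' = 0) ↔ e s = 0 ∧ ∀ s' ∈ S, e s' = 0 := by simp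
  simp only [coeff_kill, Set.mem_singleton_iff, forall_eq]
  rw [if_congr h rfl rfl, ite_and]

open Classical in
theorem monomialAt_ite (a : σ → MvPowerSeries τ K) (S : Set σ) (e : σ →₀ ℕ) :
    monomialAt (fun s => if s ∈ S then 0 else a s) e =
      if ∀ s ∈ S, e s = 0 then monomialAt a e else 0 := by
  split_ifs with h
  · refine Finset.prod_congr rfl fun s hs => ?_
    have : s ∉ S := fun hS => Finsupp.mem_support_iff.mp hs (h s hS)
    simp only [this, if_false]
  · push Not at h
    obtain ⟨s, hS, hs⟩ := h
    refine Finset.prod_eq_zero (Finsupp.mem_support_iff.mpr hs) ?_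
    simp [hS, hs]

open Classical in
theorem subst_kill [Finite σ] {a : σ → MvPowerSeries τ K} (ha : ∀ s, constantCoeff (a s) = 0)
    (S : Set σ) (F : MvPowerSeries σ K) :
    subst a (kill S F) = subst (fun s => if s ∈ S then 0 else a s) F := by
  ext m
  refine coeff_subst_congr (hasSubst_of_constantCoeff_zero ha)
    (hasSubst_of_constantCoeff_zero fun s => by split_ifs <;> simp [ha]) fun e => ?_
  rw [monomialAt_ite, coeff_kill]
  split_ifs <;> simp

theorem pderiv_kill {s : σ} {S : Set σ} (hs : s ∈ S) (F : MvPowerSeries σ K) :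
    pderiv K s (kill S F) = 0 := by
  ext e
  rw [coeff_pderiv, coeff_kill, if_neg fun h => by simpa using h s hs]
  simp

theorem pderiv_eq_shift (s : σ) (F : MvPowerSeries σ K) :
    pderiv K s F = shift s F + X s * pderiv K s (shift s F) := by
  conv_lhs => rw [← kill_add_X_mul_shift s F]
  rw [map_add, pderiv_kill (Set.mem_singleton s), zero_add, Derivation.leibniz, pderiv_X_self]
  simp [add_comm]

/-- Taylor's formula with a remainder of second order. -/
theorem taylor_mem_orderIdeal [Finite σ] {a b : σ → MvPowerSeries τ K}
    (ha : ∀ s, constantCoeff (a s) = 0) (hb : ∀ s, constantCoeff (b s) = 0) (s : σ)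
    {h : MvPowerSeries τ K} (hs : b s = a s + h) (hne : ∀ s', s' ≠ s → b s' = a s') {d : ℕ}
    (hd : h ∈ orderIdeal K τ d) (F : MvPowerSeries σ K) :
    subst b F - subst a F - h * subst a (pderiv K s F) ∈ orderIdeal K τ (2 * d) := by
  classical
  have hsa := hasSubst_of_constantCoeff_zero ha
  have hsb := hasSubst_of_constantCoeff_zero hb
  have hab (s' : σ) : b s' - a s' ∈ orderIdeal K τ d := by
    by_cases h' : s' = s
    · subst h'; simpa [hs] using hd
    · simp [hne s' h']
  -- each step splits off one factor `X s` of the part of the remainder that is not yet controlled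
  have key (N : ℕ) : ∀ F : MvPowerSeries σ K,
      subst b F - subst a F - h * subst a (pderiv K s F) ∈ orderIdeal K τ (min N (2 * d)) := by
    induction N with
    | zero => intro F; simpa using mem_orderIdeal_zero _
    | succ N ih =>
      intro F
      have hkill : subst b (kill {s} F) = subst a (kill {s} F) := by
        rw [subst_kill ha, subst_kill hb]
        congr 1
        funext s'
        by_cases h' : s' = s
        · simp [h']
        · simp [h', hne]
      have e1 : subst b F = subst b (kill {s} F) + b s * subst b (shift s F) := by
        conv_lhs => rw [← kill_add_X_mul_shift s F]
        rw [subst_add hsb, subst_mul hsb, subst_X hsb]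
      have e2 : subst a F = subst a (kill {s} F) + a s * subst a (shift s F) := by
        conv_lhs => rw [← kill_add_X_mul_shift s F]
        rw [subst_add hsa, subst_mul hsa, subst_X hsa]
      have e3 : subst a (pderiv K s F) =
          subst a (shift s F) + a s * subst a (pderiv K s (shift s F)) := by
        rw [pderiv_eq_shift, subst_add hsa, subst_mul hsa, subst_X hsa]
      have e4 : subst b F - subst a F - h * subst a (pderiv K s F) =
          a s * (subst b (shift s F) - subst a (shift s F) -
            h * subst a (pderiv K s (shift s F))) +
          h * (subst b (shift s F) - subst a (shift s F)) := by
        rw [e1, e2, e3, hkill, hs]; ring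
      rw [e4]
      refine add_mem ?_ ?_
      · exact orderIdeal_anti (by omega)
          (mul_mem_orderIdeal (mem_orderIdeal_one.mpr (ha s)) (ih (shift s F)))
      · exact orderIdeal_anti (by omega)
          (mul_mem_orderIdeal hd (subst_sub_mem_orderIdeal hsb hsa _ hab))
  simpa using key (2 * d) F

/-! ### Evaluation of series in `t` and in variables indexed by `ι` -/

/-- The substitution of `t₀` for `t` and of `x` for the variables indexed by `ι`. -/
def substPoint (t₀ : MvPowerSeries τ K) (x : ι → MvPowerSeries τ K) :
    Option ι → MvPowerSeries τ K := fun o => o.elim t₀ x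

theorem constantCoeff_substPoint {t₀ : MvPowerSeries τ K} {x : ι → MvPowerSeries τ K}
    (ht : constantCoeff t₀ = 0) (hx : ∀ i, constantCoeff (x i) = 0) (o : Option ι) :
    constantCoeff (substPoint t₀ x o) = 0 := by
  cases o
  · exact ht
  · exact hx _

theorem hasSubst_substPoint [Finite ι] {t₀ : MvPowerSeries τ K} {x : ι → MvPowerSeries τ K}
    (ht : constantCoeff t₀ = 0) (hx : ∀ i, constantCoeff (x i) = 0) :
    HasSubst (substPoint t₀ x) :=
  hasSubst_of_constantCoeff_zero (constantCoeff_substPoint ht hx)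

theorem constantCoeff_X' : MvPowerSeries.constantCoeff (PowerSeries.X : PowerSeries K) = 0 :=
  MvPowerSeries.constantCoeff_X ()

/-- The value at `x ∈ (t K[[t]])^ι` of a power series over `K` in `t` (the variable `none`) and in
variables indexed by `ι`. Regarding a series with coefficients in `K[[t]]` as a series over `K`
with `t` as an additional variable makes evaluation an instance of formal substitution. -/
noncomputable def ev (x : ι → PowerSeries K) (F : MvPowerSeries (Option ι) K) : PowerSeries K :=
  subst (substPoint PowerSeries.X x) F

/-- The series in `t` as a series in `t` and in variables indexed by `ι`. -/
noncomputable def ofSeries (ι : Type*) (c : PowerSeries K) : MvPowerSeries (Option ι) K :=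
  subst (fun _ : Unit => X none) c

theorem hasSubst_X_none : HasSubst (fun _ : Unit => (X none : MvPowerSeries (Option ι) K)) :=
  hasSubst_of_constantCoeff_zero fun _ => constantCoeff_X _

section

variable [Finite ι] {x : ι → PowerSeries K} (hx : ∀ i, PowerSeries.constantCoeff (x i) = 0)

include hx

theorem hasSubst_ev : HasSubst (substPoint PowerSeries.X x) :=
  hasSubst_substPoint constantCoeff_X' hx

theorem ev_add (F G : MvPowerSeries (Option ι) K) : ev x (F + G) = ev x F + ev x G :=
  subst_add (hasSubst_ev hx) F G

theorem ev_sub (F G : MvPowerSeries (Option ι) K) : ev x (F - G) = ev x F - ev x G :=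
  subst_sub (hasSubst_ev hx) F G

theorem ev_mul (F G : MvPowerSeries (Option ι) K) : ev x (F * G) = ev x F * ev x G :=
  subst_mul (hasSubst_ev hx) F G

theorem ev_X_some (i : ι) : ev x (X (some i)) = x i := subst_X (hasSubst_ev hx) _

theorem ev_X_none : ev x (X none) = PowerSeries.X := subst_X (hasSubst_ev hx) _

theorem constantCoeff_ev (F : MvPowerSeries (Option ι) K) :
    PowerSeries.constantCoeff (ev x F) = constantCoeff F :=
  constantCoeff_subst_of_zero (hasSubst_ev hx)
    (constantCoeff_substPoint constantCoeff_X' hx) F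

theorem ev_subst {κ : Type*} [Finite κ] {Q : κ → MvPowerSeries (Option ι) K}
    (hQ : ∀ j, constantCoeff (Q j) = 0) (F : MvPowerSeries (Option κ) K) :
    ev x (subst (substPoint (X none) Q) F) = ev (fun j => ev x (Q j)) F := by
  unfold ev
  rw [subst_comp_subst_apply (hasSubst_substPoint (constantCoeff_X _) hQ) (hasSubst_ev hx)]
  congr 1
  funext o
  cases o
  · exact ev_X_none hx
  · rfl

theorem ev_ofSeries (c : PowerSeries K) : ev x (ofSeries ι c) = c := by
  unfold ev ofSeries
  rw [subst_comp_subst_apply hasSubst_X_none (hasSubst_ev hx)]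
  have h : (fun _ : Unit => subst (substPoint PowerSeries.X x)
      (X none : MvPowerSeries (Option ι) K)) = (X : Unit → MvPowerSeries Unit K) :=
    funext fun _ => ev_X_none hx
  rw [h, subst_self, id]

/-- Evaluation as a ring homomorphism. -/
noncomputable def evHom : MvPowerSeries (Option ι) K →+* PowerSeries K :=
  (substAlgHom (hasSubst_ev hx)).toRingHom

theorem evHom_apply (F : MvPowerSeries (Option ι) K) : evHom hx F = ev x F :=
  substAlgHom_apply (hasSubst_ev hx) F

theorem ev_sum {κ : Type*} (s : Finset κ) (F : κ → MvPowerSeries (Option ι) K) :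
    ev x (∑ j ∈ s, F j) = ∑ j ∈ s, ev x (F j) := by
  simp only [← evHom_apply hx, map_sum]

omit hx in
theorem mem_orderIdeal_unit {d : ℕ} {F : PowerSeries K} :
    F ∈ orderIdeal K Unit d ↔ PowerSeries.X ^ d ∣ F := by
  rw [PowerSeries.X_pow_dvd_iff, mem_orderIdeal]
  constructor
  · intro h m hm
    exact h _ (by simpa using hm)
  · intro h m hm
    have e : m = Finsupp.single () (m ()) := by ext; simp
    rw [e]
    refine h _ ?_
    rwa [e, Finsupp.degree_single] at hm

theorem X_pow_dvd_ev_sub {y : ι → PowerSeries K}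
    (hy : ∀ i, PowerSeries.constantCoeff (y i) = 0) {d : ℕ}
    (h : ∀ i, PowerSeries.X ^ d ∣ y i - x i) (F : MvPowerSeries (Option ι) K) :
    PowerSeries.X ^ d ∣ ev y F - ev x F := by
  rw [← mem_orderIdeal_unit]
  refine subst_sub_mem_orderIdeal (hasSubst_ev hy) (hasSubst_ev hx) F fun o => ?_
  cases o
  · simp [substPoint]
  · exact mem_orderIdeal_unit.mpr (h _)

theorem X_pow_dvd_taylor [DecidableEq ι] (i : ι) {h : PowerSeries K}
    (h0 : PowerSeries.constantCoeff h = 0) {d : ℕ} (hd : PowerSeries.X ^ d ∣ h)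
    (F : MvPowerSeries (Option ι) K) :
    PowerSeries.X ^ (2 * d) ∣
      ev (x + Pi.single i h) F - ev x F - h * ev x (pderiv K (some i) F) := by
  rw [← mem_orderIdeal_unit]
  refine taylor_mem_orderIdeal (constantCoeff_substPoint constantCoeff_X' hx)
    (constantCoeff_substPoint constantCoeff_X' fun j => ?_) (some i) ?_ (fun s hs => ?_)
    (mem_orderIdeal_unit.mpr hd) F
  · change PowerSeries.constantCoeff ((x + Pi.single i h : ι → PowerSeries K) j) = 0
    by_cases hj : j = i
    · subst hj; simp [hx, h0]
    · simp [hj, hx]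
  · simp [substPoint]
  · cases s with
    | none => rfl
    | some j =>
      have hj : j ≠ i := fun e => hs (by rw [e])
      simp [substPoint, hj]

end

/-! ### Analytic inverse functions -/

/-- The formal inverse function theorem with parameters, in the form of the unique solvability of
`P(t₀, x) = y`. -/
theorem existsUnique_subst_eq [Fintype ι] [DecidableEq ι] (P : ι → MvPowerSeries (Option ι) K)
    (hP0 : ∀ i, constantCoeff (P i) = 0)
    (hdet : IsUnit (Matrix.of fun i j => coeff (Finsupp.single (some j) 1) (P i)).det)
    {t₀ : MvPowerSeries τ K} (ht : constantCoeff t₀ = 0) {y : ι → MvPowerSeries τ K}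
    (hy : ∀ i, constantCoeff (y i) = 0) :
    ∃! x : ι → MvPowerSeries τ K, (∀ i, constantCoeff (x i) = 0) ∧
      ∀ i, subst (substPoint t₀ x) (P i) = y i := by
  set J : Matrix ι ι K := Matrix.of fun i j => coeff (Finsupp.single (some j) 1) (P i) with hJ
  -- `N` is `X - J⁻¹ P`, whose linear terms in `X` vanish
  let N (i : ι) : MvPowerSeries (Option ι) K := X (some i) - ∑ j, (J⁻¹ i j) • P j
  have hN (i l : ι) : coeff (Finsupp.single (some l) 1) (N i) = 0 := by
    have h1 : ∑ j, J⁻¹ i j * coeff (Finsupp.single (some l) 1) (P j) = (J⁻¹ * J) i l := by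
      rw [Matrix.mul_apply]; rfl
    simp only [N, map_sub, map_sum, coeff_smul, h1]
    rw [Matrix.nonsing_inv_mul _ hdet, coeff_index_single_X, Matrix.one_apply]
    by_cases h : l = i
    · simp [h]
    · simp [h, Ne.symm h]
  have hN0 (i : ι) : constantCoeff (N i) = 0 := by simp [N, hP0]
  let Φ (x : ι → MvPowerSeries τ K) (i : ι) : MvPowerSeries τ K :=
    subst (substPoint t₀ x) (N i) + ∑ j, J⁻¹ i j • y j
  have hΦ0 (x : ι → MvPowerSeries τ K) (hx : ∀ i, constantCoeff (x i) = 0) (i : ι) :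
      constantCoeff (Φ x i) = 0 := by
    simp only [Φ, map_add, map_sum, constantCoeff_smul, hy]
    rw [constantCoeff_subst_of_zero (hasSubst_substPoint ht hx)
      (constantCoeff_substPoint ht hx), hN0]
    simp
  have hΦ := existsUnique_fixedPoint Φ hΦ0 (fun a b ha hb d _ hab i => by
    simp only [Φ, add_sub_add_right_eq_sub]
    refine subst_sub_mem_orderIdeal_of_monomials (hasSubst_substPoint ht ha)
      (hasSubst_substPoint ht hb) fun e he => ?_
    refine monomialAt_sub_mem_orderIdeal_succ (constantCoeff_substPoint ht ha)
      (constantCoeff_substPoint ht hb) (fun o => ?_) e fun o ho => ?_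
    · cases o
      · simp [substPoint]
      · exact hab _
    · rintro rfl
      cases o with
      | none => exact ho rfl
      | some l => exact he (hN i l))
  have key (x : ι → MvPowerSeries τ K) (hx : ∀ i, constantCoeff (x i) = 0) :
      Φ x = x ↔ ∀ i, subst (substPoint t₀ x) (P i) = y i := by
    have hsx := hasSubst_substPoint ht hx
    have e1 (i : ι) : Φ x i = x i - ∑ j, J⁻¹ i j • (subst (substPoint t₀ x) (P j) - y j) := by
      simp only [Φ, N]
      rw [subst_sub hsx, subst_X hsx, ← coe_substAlgHom hsx, map_sum]
      simp only [map_smul, smul_sub, Finset.sum_sub_distrib]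
      simp only [substPoint, Option.elim]
      ring
    constructor
    · intro h
      have h1 (i : ι) : ∑ j, J⁻¹ i j • (subst (substPoint t₀ x) (P j) - y j) = 0 := by
        have := congrFun h i
        rw [e1] at this
        simpa using this
      intro l
      have h2 : ∑ i, J l i • ∑ j, J⁻¹ i j • (subst (substPoint t₀ x) (P j) - y j) =
          ∑ j, (J * J⁻¹) l j • (subst (substPoint t₀ x) (P j) - y j) := by
        simp only [Finset.smul_sum, smul_smul, Matrix.mul_apply, Finset.sum_smul]
        exact Finset.sum_comm
      rw [Matrix.mul_nonsing_inv _ hdet] at h2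
      simp only [h1, smul_zero, Finset.sum_const_zero, Matrix.one_apply, ite_smul, one_smul,
        zero_smul, Finset.sum_ite_eq, Finset.mem_univ, if_true] at h2
      exact (sub_eq_zero.mp h2.symm)
    · intro h
      funext i
      rw [e1]
      simp [h]
  obtain ⟨x, ⟨hx0, hx⟩, huniq⟩ := hΦ
  exact ⟨x, ⟨hx0, (key x hx0).mp hx⟩, fun z ⟨hz0, hz⟩ => huniq z ⟨hz0, (key z hz0).mpr hz⟩⟩

/-- The formal inverse function theorem with parameter `t`, at the level of points. -/
theorem exists_inverse_series [Fintype ι] [DecidableEq ι] (P : ι → MvPowerSeries (Option ι) K)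
    (hP0 : ∀ i, constantCoeff (P i) = 0)
    (hdet : IsUnit (Matrix.of fun i j => coeff (Finsupp.single (some j) 1) (P i)).det) :
    ∃ Q : ι → MvPowerSeries (Option ι) K, (∀ i, constantCoeff (Q i) = 0) ∧
      ∀ x y : ι → PowerSeries K, (∀ i, PowerSeries.constantCoeff (x i) = 0) →
        (∀ i, PowerSeries.constantCoeff (y i) = 0) →
        ((∀ i, ev x (P i) = y i) ↔ ∀ i, x i = ev y (Q i)) := by
  obtain ⟨Q, ⟨hQ0, hQ⟩, -⟩ := existsUnique_subst_eq P hP0 hdet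
    (constantCoeff_X (none : Option ι)) (fun i => constantCoeff_X (some i : Option ι))
  refine ⟨Q, hQ0, fun x y hx hy => ?_⟩
  have h1 (i : ι) : ev (fun j => ev y (Q j)) (P i) = y i := by
    rw [← ev_subst hy hQ0, hQ, ev_X_some hy]
  constructor
  · intro h
    have := (existsUnique_subst_eq P hP0 hdet (τ := Unit) constantCoeff_X' hy).unique
      ⟨hx, h⟩ ⟨fun i => (constantCoeff_ev hy (Q i)).trans (hQ0 i), h1⟩
    exact congrFun this
  · intro h i
    rw [funext h]
    exact h1 i

/-! ### Translation -/

/-- The Taylor expansion of `F` at the point `c`. -/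
noncomputable def translate (c : ι → PowerSeries K) (F : MvPowerSeries (Option ι) K) :
    MvPowerSeries (Option ι) K :=
  subst (substPoint (X none) fun i => ofSeries ι (c i) + X (some i)) F

theorem constantCoeff_ofSeries (c : PowerSeries K) :
    constantCoeff (ofSeries ι c) = PowerSeries.constantCoeff c :=
  constantCoeff_subst_of_zero hasSubst_X_none (fun _ => constantCoeff_X _) c

theorem constantCoeff_translate_var {c : ι → PowerSeries K}
    (hc : ∀ i, PowerSeries.constantCoeff (c i) = 0) (i : ι) :
    constantCoeff (ofSeries ι (c i) + X (some i)) = 0 := by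
  rw [map_add, constantCoeff_ofSeries, hc, constantCoeff_X, add_zero]

theorem ev_translate [Finite ι] {c y : ι → PowerSeries K}
    (hc : ∀ i, PowerSeries.constantCoeff (c i) = 0)
    (hy : ∀ i, PowerSeries.constantCoeff (y i) = 0) (F : MvPowerSeries (Option ι) K) :
    ev y (translate c F) = ev (c + y) F := by
  rw [translate, ev_subst hy (constantCoeff_translate_var hc)]
  congr 1
  funext i
  rw [ev_add hy, ev_ofSeries hy, ev_X_some hy, Pi.add_apply]

/-- If `h u` and `h v` agree to second order in `h` for `h = t ^ d` with `d` large, then `u = v`.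
This identifies derivatives without passing to a limit. -/
theorem eq_of_forall_le_X_pow_dvd {u v : PowerSeries K} (m : ℕ)
    (h : ∀ d, m ≤ d → PowerSeries.X ^ (2 * d) ∣ PowerSeries.X ^ d * (u - v)) : u = v := by
  refine eq_of_forall_sub_mem_orderIdeal (τ := Unit) fun d => ?_
  rw [mem_orderIdeal_unit]
  have h1 := h (d + m) (by omega)
  rw [two_mul, pow_add, mul_dvd_mul_iff_left (pow_ne_zero _ PowerSeries.X_ne_zero)] at h1
  exact (pow_dvd_pow _ (by omega)).trans h1

/-- Derivatives of a translate are the translated derivatives. Only the values at points are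
compared. -/
theorem ev_pderiv_translate [Finite ι] {c y : ι → PowerSeries K}
    (hc : ∀ i, PowerSeries.constantCoeff (c i) = 0)
    (hy : ∀ i, PowerSeries.constantCoeff (y i) = 0) (i : ι) (F : MvPowerSeries (Option ι) K) :
    ev y (pderiv K (some i) (translate c F)) = ev (c + y) (pderiv K (some i) F) := by
  classical
  refine eq_of_forall_le_X_pow_dvd 1 fun d hd => ?_
  have h0 : PowerSeries.constantCoeff (PowerSeries.X ^ d : PowerSeries K) = 0 := by
    simp [show d ≠ 0 by omega]
  have h1 := X_pow_dvd_taylor hy i h0 dvd_rfl (translate c F)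
  have hcy (j : ι) : PowerSeries.constantCoeff ((c + y) j) = 0 := by simp [hc, hy]
  have h2 := X_pow_dvd_taylor hcy i h0 dvd_rfl F
  have hys (j : ι) : PowerSeries.constantCoeff
      ((y + Pi.single i (PowerSeries.X ^ d) : ι → PowerSeries K) j) = 0 := by
    by_cases hj : j = i
    · subst hj; simp [hy, show d ≠ 0 by omega]
    · simp [hj, hy]
  rw [ev_translate hc hys, ev_translate hc hy, ← add_assoc] at h1
  have := dvd_sub h2 h1
  convert this using 1
  ring

end Evaluation

section Laurent

open MvPowerSeries

variable {K : Type*} [Field K]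

/-! ### Laurent series and power series -/

/-- The elements of `K((t))` of valuation at least `N` are the power series divisible by `t ^ N`. -/
theorem le_orderTop_iff_exists (N : ℕ) (y : LaurentSeries K) :
    ((N : ℤ) : WithTop ℤ) ≤ y.orderTop ↔
      ∃ z : PowerSeries K, PowerSeries.X ^ N ∣ z ∧ (z : LaurentSeries K) = y := by
  rw [HahnSeries.le_orderTop_iff_forall]
  constructor
  · intro h
    refine ⟨PowerSeries.mk fun m => y.coeff m, ?_, ?_⟩
    · rw [PowerSeries.X_pow_dvd_iff]
      intro m hm
      rw [PowerSeries.coeff_mk]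
      exact h _ (by exact_mod_cast hm)
    · ext m
      rw [PowerSeries.coeff_coe]
      split_ifs with hm
      · exact (h _ (by exact_mod_cast (by omega : m < N))).symm
      · rw [PowerSeries.coeff_mk, Int.natAbs_of_nonneg (by omega)]
  · rintro ⟨z, hz, rfl⟩ m hm
    rw [PowerSeries.coeff_coe]
    split_ifs with h
    · rfl
    · have : m < N := by exact_mod_cast hm
      exact PowerSeries.X_pow_dvd_iff.mp hz _ (by omega)

theorem coe_injective : Function.Injective (fun z : PowerSeries K => (z : LaurentSeries K)) :=
  HahnSeries.ofPowerSeries_injective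

open WithZero MonoidWithZeroHom in
/-- The `t`-adic topology in terms of divisibility by powers of `t`. -/
theorem mem_nhds_laurentSeries {s : Set (LaurentSeries K)} {x : LaurentSeries K} :
    s ∈ 𝓝 x ↔ ∃ N : ℕ, ∀ z : PowerSeries K, PowerSeries.X ^ N ∣ z → x + z ∈ s := by
  constructor
  · intro hs
    obtain ⟨γ, hγ⟩ := Valued.mem_nhds.mp hs
    set D := -(log (ValueGroup₀.embedding γ.1) - 1) with hD
    have hD' : exp (-D) < ValueGroup₀.embedding γ.1 := by
      rw [← lt_log_iff_exp_lt (by simp), hD]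
      simp
    refine ⟨D.toNat, fun z hz => hγ ?_⟩
    change (Valued.v (R := LaurentSeries K)).restrict _ < _
    rw [Valuation.restrict_lt_iff_lt_embedding]
    refine lt_of_le_of_lt ((LaurentSeries.valuation_le_iff_coeff_lt_eq_zero K).mpr ?_) hD'
    intro m hm
    rw [add_sub_cancel_left]
    refine HahnSeries.coeff_eq_zero_of_lt_orderTop (lt_of_lt_of_le ?_
      ((le_orderTop_iff_exists D.toNat (z : LaurentSeries K)).mpr ⟨z, hz, rfl⟩))
    exact_mod_cast (by omega : m < D.toNat)
  · rintro ⟨N, hN⟩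
    have hne : Valued.v.restrict (HahnSeries.single (N : ℤ) (1 : K) : LaurentSeries K) ≠ 0 :=
      (Valuation.ne_zero_iff _).mpr (by simp)
    refine Valued.mem_nhds.mpr ⟨Units.mk0 _ hne, fun y hy => ?_⟩
    change (Valued.v (R := LaurentSeries K)).restrict (y - x) <
      (Valued.v (R := LaurentSeries K)).restrict _ at hy
    rw [Valuation.restrict_lt_iff, LaurentSeries.valuation_single_zpow] at hy
    have h := (LaurentSeries.valuation_le_iff_coeff_lt_eq_zero K).mp hy.le
    obtain ⟨z, hz, hzy⟩ := (le_orderTop_iff_exists N (y - x)).mp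
      (HahnSeries.le_orderTop_iff_forall.mpr fun m hm => h m (by exact_mod_cast hm))
    have := hN z hz
    rwa [hzy, add_sub_cancel] at this

instance neBot_nhdsNE_laurentSeries : (𝓝[≠] (0 : LaurentSeries K)).NeBot := by
  refine mem_closure_iff_nhdsWithin_neBot.mp (mem_closure_iff_nhds.mpr fun s hs => ?_)
  obtain ⟨N, hN⟩ := mem_nhds_laurentSeries.mp hs
  refine ⟨((PowerSeries.X ^ N : PowerSeries K) : LaurentSeries K), ?_, ?_⟩
  · simpa using hN _ dvd_rfl
  · intro h
    exact pow_ne_zero N PowerSeries.X_ne_zero (coe_injective (h.trans (map_zero _).symm))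

/-! ### Partial derivatives -/

/-- On a ball where a function is the evaluation of a power series, its partial derivatives, as
limits of difference quotients, are the evaluations of the formal partial derivatives. -/
theorem partialDeriv_eq_ev_pderiv {n : ℕ} (g : (Fin n → LaurentSeries K) → LaurentSeries K)
    {a : ℕ} (ha : 1 ≤ a) (F : MvPowerSeries (Option (Fin n)) K)
    (hg : ∀ p : Fin n → PowerSeries K, (∀ i, PowerSeries.X ^ a ∣ p i) →
      g (fun i => (p i : LaurentSeries K)) = (ev p F : PowerSeries K))
    (i : Fin n) (p : Fin n → PowerSeries K) (hp : ∀ i, PowerSeries.X ^ a ∣ p i) :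
    partialDeriv g i (fun i => (p i : LaurentSeries K)) =
      (ev p (pderiv K (some i) F) : PowerSeries K) := by
  refine Tendsto.limUnder_eq ?_
  intro s hs
  obtain ⟨N, hN⟩ := mem_nhds_laurentSeries.mp hs
  rw [mem_map, mem_nhdsWithin_iff_eventually]
  have hsmall : {h : LaurentSeries K | ∃ z : PowerSeries K, PowerSeries.X ^ (N + a) ∣ z ∧
      (z : LaurentSeries K) = h} ∈ 𝓝 0 :=
    mem_nhds_laurentSeries.mpr ⟨N + a, fun z hz => ⟨z, hz, (zero_add _).symm⟩⟩
  filter_upwards [hsmall]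
  rintro _ ⟨h, hh, rfl⟩ h0
  have hne : h ≠ 0 := by
    rintro rfl
    exact h0 (map_zero _)
  have hX (q : PowerSeries K) (hq : PowerSeries.X ^ a ∣ q) : PowerSeries.constantCoeff q = 0 := by
    rw [← PowerSeries.X_dvd_iff]
    exact (dvd_pow_self _ (by omega)).trans hq
  have hpi (j : Fin n) : PowerSeries.X ^ a ∣ (p + Pi.single i h : Fin n → PowerSeries K) j := by
    by_cases hj : j = i
    · subst hj
      simpa using dvd_add (hp j) ((pow_dvd_pow _ (by omega)).trans hh)
    · simpa [hj] using hp j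
  obtain ⟨d, u, hu⟩ : ∃ (d : ℕ) (u : PowerSeries K), IsUnit u ∧ h = PowerSeries.X ^ d * u :=
    ⟨_, _, PowerSeries.isUnit_divided_by_X_pow_order hne,
      PowerSeries.X_pow_order_mul_divXPowOrder.symm⟩
  have hd : N ≤ d := by
    by_contra hlt
    have h1 : PowerSeries.X ^ (d + 1) ∣ PowerSeries.X ^ d * u :=
      hu.2 ▸ (pow_dvd_pow _ (by omega)).trans hh
    rw [pow_succ, mul_dvd_mul_iff_left (pow_ne_zero _ PowerSeries.X_ne_zero)] at h1
    exact PowerSeries.X_prime.not_isUnit (isUnit_of_dvd_unit h1 hu.1)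
  obtain ⟨w, hw⟩ := X_pow_dvd_taylor (fun j => hX _ (hp j)) i
    (hX _ ((pow_dvd_pow _ (by omega)).trans hh)) (Dvd.intro _ hu.2.symm) F
  obtain ⟨v, hv⟩ := hu.1.exists_right_inv
  have e1 : (fun j => (p j : LaurentSeries K)) + Pi.single i (h : LaurentSeries K) =
      fun j => ((p + Pi.single i h : Fin n → PowerSeries K) j : LaurentSeries K) := by
    funext j
    by_cases hj : j = i
    · subst hj; simp
    · simp [hj]
  have e2 : ev (p + Pi.single i h) F - ev p F =
      h * (ev p (pderiv K (some i) F) + PowerSeries.X ^ d * (w * v)) := by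
    have h3 : PowerSeries.X ^ (2 * d) * w = h * (PowerSeries.X ^ d * (w * v)) := by
      rw [hu.2, two_mul, pow_add]
      linear_combination (-(PowerSeries.X ^ d * PowerSeries.X ^ d * w)) * hv
    rw [mul_add, ← h3, ← hw]; ring
  change (g _ - g _) / _ ∈ s
  rw [e1, hg _ hpi, hg _ hp, ← map_sub, e2, map_mul, mul_div_cancel_left₀ _ h0, map_add]
  exact hN _ (Dvd.dvd.mul_right (pow_dvd_pow _ hd) _)

/-! ### Convergent series over `K[[t]]` as series in an additional variable -/

section Flatten

variable {ι : Type*}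

/-- A series with coefficients in `K[[t]]` as a series over `K` with additional variable `t`. -/
noncomputable def flatten (F : MvPowerSeries ι (PowerSeries K)) : MvPowerSeries (Option ι) K :=
  fun e => PowerSeries.coeff (e none) (coeff e.some F)

/-- A series over `K` as a series in the variables indexed by `ι` with coefficients in `K[[t]]`. -/
noncomputable def unflatten (F : MvPowerSeries (Option ι) K) : MvPowerSeries ι (PowerSeries K) :=
  fun e => PowerSeries.mk fun m => coeff (e.optionElim m) F

theorem coeff_flatten (F : MvPowerSeries ι (PowerSeries K)) (e : Option ι →₀ ℕ) :
    coeff e (flatten F) = PowerSeries.coeff (e none) (coeff e.some F) := rfl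

theorem flatten_unflatten (F : MvPowerSeries (Option ι) K) : flatten (unflatten F) = F := by
  ext e
  have h : coeff e.some (unflatten F) =
    PowerSeries.mk fun m => coeff (e.some.optionElim m) F := rfl
  rw [coeff_flatten, h, PowerSeries.coeff_mk, Finsupp.optionElim_some]

theorem monomialAt_X (s : Option ι) (e : Unit →₀ ℕ) :
    monomialAt (fun _ : Unit => (X s : MvPowerSeries (Option ι) K)) e =
      monomial (Finsupp.single s (e ())) 1 := by
  have : e = Finsupp.single () (e ()) := by ext; simp
  rw [this, monomialAt, Finsupp.prod_single_index (h := fun _ m => X s ^ m) (pow_zero _), X_pow_eq]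
  simp

open Classical in
theorem coeff_ofSeries (c : PowerSeries K) (e : Option ι →₀ ℕ) :
    coeff e (ofSeries ι c) = if e.some = 0 then PowerSeries.coeff (e none) c else 0 := by
  rw [ofSeries, coeff_subst hasSubst_X_none]
  have h (d : Unit →₀ ℕ) : coeff d c • coeff e (d.prod fun _ m =>
      (X none : MvPowerSeries (Option ι) K) ^ m) =
      if e = Finsupp.single none (d ()) then coeff d c else 0 := by
    rw [show (d.prod fun _ m => (X none : MvPowerSeries (Option ι) K) ^ m) =
      monomialAt (fun _ : Unit => X none) d from rfl, monomialAt_X, coeff_monomial]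
    split_ifs <;> simp
  simp only [h]
  rw [finsum_eq_single _ (Finsupp.single () (e none))]
  · have : e = Finsupp.single none (e none) ↔ e.some = 0 := by
      constructor
      · intro h1
        rw [h1]
        simp
      · intro h1
        rw [← Finsupp.optionElim_some e, h1, Finsupp.optionElim_zero]
        simp
    simp only [Finsupp.single_eq_same, this]
    rfl
  · intro d hd
    rw [if_neg]
    intro h1
    apply hd
    rw [h1]
    ext
    simp

open Classical in
theorem coeff_ofSeries_mul_monomial (c : PowerSeries K) (e : ι →₀ ℕ) (d : Option ι →₀ ℕ) :
    coeff d (ofSeries ι c * monomial (e.optionElim 0) 1) =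
      if d.some = e then PowerSeries.coeff (d none) c else 0 := by
  rw [coeff_mul_monomial, coeff_ofSeries, mul_one]
  have h1 : (d - e.optionElim 0) none = d none := by
    simp
  have h2 : (d - e.optionElim 0).some = d.some - e := by
    ext i
    simp
  rw [h1, h2]
  by_cases h : d.some = e
  · have h3 : e.optionElim 0 ≤ d := by
      intro o
      cases o
      · simp
      · simp [← h]
    simp [h, h3]
  · rw [if_neg h]
    split_ifs with h3 h4
    · exact absurd (le_antisymm (tsub_eq_zero_iff_le.mp h4) fun i => by
        simpa [Finsupp.optionElim_apply_some] using h3 (some i)) h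
    · rfl
    · rfl

theorem ev_monomial [Fintype ι] {x : ι → PowerSeries K}
    (hx : ∀ i, PowerSeries.constantCoeff (x i) = 0) (e : ι →₀ ℕ) :
    ev x (monomial (e.optionElim 0) 1) = ∏ i, x i ^ e i := by
  rw [ev, subst_monomial (hasSubst_ev hx), map_one, one_mul,
    Finsupp.prod_fintype _ _ (fun _ => pow_zero _), Fintype.prod_option]
  simp [substPoint]

/-- A power series over `K[[t]]` converges at every point with coordinates in `t K[[t]]`; the sum
is the formal evaluation of the series. -/
theorem hasSum_ev_flatten {n : ℕ} (F : MvPowerSeries (Fin n) (PowerSeries K))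
    {x : Fin n → PowerSeries K} (hx : ∀ i, PowerSeries.constantCoeff (x i) = 0) :
    HasSum (fun e : Fin n →₀ ℕ => ((coeff e F : PowerSeries K) : LaurentSeries K) *
      ∏ i, (x i : LaurentSeries K) ^ e i) (ev x (flatten F) : PowerSeries K) := by
  classical
  intro U hU
  obtain ⟨N, hN⟩ := mem_nhds_laurentSeries.mp hU
  have hfin : {e : Fin n →₀ ℕ | e.degree < N}.Finite :=
    (Finsupp.finite_of_degree_le N).subset fun e (he : e.degree < N) => he.le
  rw [mem_map, SummationFilter.unconditional_filter]
  filter_upwards [mem_atTop hfin.toFinset] with s hs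
  change ∑ e ∈ s, _ ∈ U
  let R : MvPowerSeries (Option (Fin n)) K :=
    (∑ e ∈ s, ofSeries (Fin n) (coeff e F) * monomial (e.optionElim 0) 1) - flatten F
  have hR : R ∈ orderIdeal K _ N := by
    intro d hd
    have h1 : d.some.degree < N := by
      refine lt_of_le_of_lt ?_ hd
      rw [Finsupp.degree_eq_sum, Finsupp.degree_eq_sum, Fintype.sum_option]
      exact Nat.le_add_left _ _
    have h2 : d.some ∈ s := hs (hfin.mem_toFinset.mpr h1)
    simp only [R, map_sub, map_sum, coeff_ofSeries_mul_monomial, coeff_flatten]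
    exact sub_eq_zero.mpr ((Finset.sum_eq_single_of_mem _ h2
      fun e _ he => if_neg (Ne.symm he)).trans (if_pos rfl))
  have h1 : PowerSeries.X ^ N ∣ ev x R :=
    mem_orderIdeal_unit.mp (subst_mem_orderIdeal (hasSubst_ev hx)
      (constantCoeff_substPoint constantCoeff_X' hx) hR)
  have h2 : ev x R = (∑ e ∈ s, coeff e F * ∏ i, x i ^ e i) - ev x (flatten F) := by
    rw [ev_sub hx, ev_sum hx]
    simp only [ev_mul hx, ev_ofSeries hx, ev_monomial hx]
  have := hN _ h1
  rw [h2, map_sub, add_sub_cancel, map_sum] at this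
  simpa using this

end Flatten

end Laurent

section QuadraticForm

open MvPowerSeries

variable {K : Type*} [Field K] {n : ℕ}

/-! ### Divided differences and Hadamard's lemma -/

/-- The variables with index at least `m`. -/
def tailVars (n m : ℕ) : Set (Option (Fin n)) := {s | ∃ j : Fin n, s = some j ∧ m ≤ j}

theorem some_mem_tailVars {m : ℕ} {j : Fin n} : some j ∈ tailVars n m ↔ m ≤ j := by
  simp [tailVars]

theorem none_notMem_tailVars {m : ℕ} : none ∉ tailVars n m := by
  simp [tailVars]

theorem insert_tailVars (i : Fin n) : insert (some i) (tailVars n (i + 1)) = tailVars n i := by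
  ext s
  cases s with
  | none => simp [none_notMem_tailVars]
  | some j =>
    rw [Set.mem_insert_iff, some_mem_tailVars, some_mem_tailVars, Option.some.injEq, Fin.ext_iff]
    omega

/-- The divided difference of `F` with respect to the variable of index `i`, in which the variables
of index greater than `i` are set to `0`. In contrast to the integral remainder in Taylor's formula,
divided differences of a definable function are definable. -/
noncomputable def divVar (i : Fin n) (F : MvPowerSeries (Option (Fin n)) K) :
    MvPowerSeries (Option (Fin n)) K :=
  shift (some i) (kill (tailVars n (i + 1)) F)

theorem X_mul_divVar (i : Fin n) (F : MvPowerSeries (Option (Fin n)) K) :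
    X (some i) * divVar i F = kill (tailVars n (i + 1)) F - kill (tailVars n i) F := by
  rw [eq_sub_iff_add_eq, ← insert_tailVars i, ← kill_insert, add_comm]
  exact kill_add_X_mul_shift _ _

theorem kill_of_forall_notMem {σ : Type*} {S : Set σ} (hS : ∀ s, s ∉ S) (F : MvPowerSeries σ K) :
    kill S F = F := by
  ext e
  rw [coeff_kill, if_pos fun s hs => absurd hs (hS s)]

/-- Setting all variables except `t` to `0`. -/
theorem kill_tailVars_zero (F : MvPowerSeries (Option (Fin n)) K) :
    kill (tailVars n 0) F = ofSeries (Fin n) (ev 0 F) := by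
  classical
  have h1 : subst (X : Option (Fin n) → MvPowerSeries (Option (Fin n)) K)
      (kill (tailVars n 0) F) = kill (tailVars n 0) F := by
    rw [subst_self]; rfl
  rw [← h1, subst_kill (fun s => constantCoeff_X s), ofSeries, ev,
    subst_comp_subst_apply (hasSubst_ev fun i => by simp) hasSubst_X_none]
  congr 1
  funext o
  cases o with
  | none =>
    rw [if_neg none_notMem_tailVars]
    exact (subst_X hasSubst_X_none ()).symm
  | some j =>
    rw [if_pos (some_mem_tailVars.mpr (Nat.zero_le _))]
    exact (map_zero (substAlgHom (hasSubst_X_none (K := K) (ι := Fin n)))).symm.trans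
      (substAlgHom_apply _ _)

/-- Hadamard's lemma. -/
theorem eq_add_sum_X_mul_divVar (F : MvPowerSeries (Option (Fin n)) K) :
    F = ofSeries (Fin n) (ev 0 F) + ∑ i, X (some i) * divVar i F := by
  rw [← kill_tailVars_zero]
  simp only [X_mul_divVar]
  rw [Fin.sum_univ_eq_sum_range (fun i => kill (tailVars n (i + 1)) F - kill (tailVars n i) F) n,
    Finset.sum_range_sub (fun i => kill (tailVars n i) F), add_sub_cancel,
    kill_of_forall_notMem (fun s => ?_)]
  rintro ⟨j, -, hj⟩
  exact absurd j.2 (by omega)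

theorem mul_ev_divVar (i : Fin n) (F : MvPowerSeries (Option (Fin n)) K)
    {x : Fin n → PowerSeries K} (hx : ∀ i, PowerSeries.constantCoeff (x i) = 0) :
    x i * ev x (divVar i F) = ev (fun j : Fin n => if (i : ℕ) + 1 ≤ j then 0 else x j) F -
      ev (fun j : Fin n => if (i : ℕ) ≤ j then 0 else x j) F := by
  classical
  have key (m : ℕ) : ev x (kill (tailVars n m) F) =
      ev (fun j : Fin n => if m ≤ j then 0 else x j) F := by
    rw [ev, subst_kill (constantCoeff_substPoint constantCoeff_X' hx), ev]
    congr 1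
    funext o
    cases o with
    | none => rw [if_neg none_notMem_tailVars]; rfl
    | some j => simp only [some_mem_tailVars, substPoint, Option.elim]
  rw [← ev_X_some hx i, ← ev_mul hx, X_mul_divVar, ev_sub hx, key, key]

theorem ev_zero_divVar (i : Fin n) (F : MvPowerSeries (Option (Fin n)) K) :
    ev 0 (divVar i F) = ev 0 (pderiv K (some i) F) := by
  have h0 : ∀ i : Fin n, PowerSeries.constantCoeff ((0 : Fin n → PowerSeries K) i) = 0 := by simp
  have h1 : pderiv K (some i) F = ∑ j, (X (some j) * pderiv K (some i) (divVar j F) +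
      divVar j F * pderiv K (some i) (X (some j))) := by
    conv_lhs => rw [eq_add_sum_X_mul_divVar F, map_add, ← kill_tailVars_zero,
      pderiv_kill (some_mem_tailVars.mpr (Nat.zero_le _)), zero_add, map_sum]
    exact Finset.sum_congr rfl fun j _ => by rw [Derivation.leibniz, smul_eq_mul, smul_eq_mul]
  rw [h1, ev_sum h0]
  simp only [ev_add h0, ev_mul h0, ev_X_some h0, Pi.zero_apply, zero_mul, zero_add]
  rw [Finset.sum_eq_single i]
  · rw [pderiv_X_self, ← ev_mul h0, mul_one]
  · intro j _ hj
    rw [pderiv_X_of_ne (by simpa using hj), ← ev_mul h0, mul_zero, ← evHom_apply h0, map_zero]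
  · simp

open Classical in
theorem coeff_divVar (i : Fin n) (F : MvPowerSeries (Option (Fin n)) K) (e : Option (Fin n) →₀ ℕ) :
    coeff e (divVar i F) =
      if ∀ j, i < j → e (some j) = 0 then coeff (e + Finsupp.single (some i) 1) F else 0 := by
  have h : (∀ s ∈ tailVars n (i + 1), (e + Finsupp.single (some i) 1 : Option (Fin n) →₀ ℕ) s = 0) ↔
      ∀ j, i < j → e (some j) = 0 := by
    constructor
    · intro h j hj
      have := h (some j) (some_mem_tailVars.mpr hj)
      rw [Finsupp.add_apply] at this
      omega
    · rintro h _ ⟨j, rfl, hj⟩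
      have hij : some i ≠ some j := by
        simp only [ne_eq, Option.some.injEq, Fin.ext_iff]; omega
      rw [Finsupp.add_apply, h j hj, Finsupp.single_eq_of_ne' hij, add_zero]
  rw [divVar, coeff_shift, coeff_kill]
  by_cases h' : ∀ j, i < j → e (some j) = 0
  · rw [if_pos h', if_pos (h.mpr h')]
  · rw [if_neg h', if_neg (h.not.mpr h')]

theorem constantCoeff_divVar_divVar (i j : Fin n) (F : MvPowerSeries (Option (Fin n)) K) :
    constantCoeff (divVar j (divVar i F)) = if j ≤ i then
      coeff (Finsupp.single (some j) 1 + Finsupp.single (some i) 1) F else 0 := by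
  classical
  rw [← coeff_zero_eq_constantCoeff_apply, coeff_divVar, if_pos (by simp), zero_add, coeff_divVar]
  refine if_congr ?_ rfl rfl
  constructor
  · intro h
    by_contra hij
    have := h j (not_le.mp hij)
    simp at this
  · intro h l hl
    have : some j ≠ some l := by
      simp only [ne_eq, Option.some.injEq]
      exact (h.trans_lt hl).ne
    exact Finsupp.single_eq_of_ne' this

/-- The symmetric matrix of series of second order divided differences of `F`. -/
noncomputable def quadMatrix (F : MvPowerSeries (Option (Fin n)) K) :
    Matrix (Fin n) (Fin n) (MvPowerSeries (Option (Fin n)) K) :=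
  Matrix.of fun i j => C (1 / 2) * (divVar j (divVar i F) + divVar i (divVar j F))

theorem quadMatrix_transpose (F : MvPowerSeries (Option (Fin n)) K) :
    (quadMatrix F).transpose = quadMatrix F := by
  ext1 i j
  simp only [quadMatrix, Matrix.transpose_apply, Matrix.of_apply, add_comm]

theorem two_mul_C_half [CharZero K] {σ : Type*} : (2 : MvPowerSeries σ K) * C (1 / 2) = 1 := by
  rw [← map_ofNat (C (σ := σ) (R := K)) 2, ← map_mul]
  simp

/-- A series whose gradient vanishes at the origin is a constant plus a quadratic form whose
coefficients are series. -/
theorem eq_add_quadMatrix [CharZero K] (F : MvPowerSeries (Option (Fin n)) K)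
    (hF : ∀ i, ev 0 (pderiv K (some i) F) = 0) :
    F = ofSeries (Fin n) (ev 0 F) + ∑ i, ∑ j, X (some i) * X (some j) * quadMatrix F i j := by
  have h0 : ofSeries (Fin n) (0 : PowerSeries K) = 0 :=
    (substAlgHom_apply hasSubst_X_none _).symm.trans
      (map_zero (substAlgHom (hasSubst_X_none (K := K) (ι := Fin n))))
  have h1 (i : Fin n) : divVar i F = ∑ j, X (some j) * divVar j (divVar i F) := by
    conv_lhs => rw [eq_add_sum_X_mul_divVar (divVar i F), ev_zero_divVar, hF, h0, zero_add]
  have h2 : ∑ i, ∑ j, X (some i) * X (some j) * divVar j (divVar i F) =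
      ∑ i, X (some i) * divVar i F := by
    refine Finset.sum_congr rfl fun i _ => ?_
    conv_rhs => rw [h1 i, Finset.mul_sum]
    exact Finset.sum_congr rfl fun j _ => by ring
  have h3 : ∑ i, ∑ j, X (some i) * X (some j) * quadMatrix F i j =
      C (1 / 2) * (∑ i, ∑ j, X (some i) * X (some j) * divVar j (divVar i F) +
        ∑ i, ∑ j, X (some j) * X (some i) * divVar j (divVar i F)) := by
    rw [Finset.sum_comm (f := fun i j => X (some j) * X (some i) * divVar j (divVar i F)),
      ← Finset.sum_add_distrib, Finset.mul_sum]
    refine Finset.sum_congr rfl fun i _ => ?_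
    rw [← Finset.sum_add_distrib, Finset.mul_sum]
    exact Finset.sum_congr rfl fun j _ => by rw [quadMatrix, Matrix.of_apply]; ring
  have h4 : ∑ i, ∑ j, X (some j) * X (some i) * divVar j (divVar i F) =
      ∑ i, ∑ j, X (some i) * X (some j) * divVar j (divVar i F) :=
    Finset.sum_congr rfl fun i _ => Finset.sum_congr rfl fun j _ => by ring
  rw [h3, h4, ← two_mul, ← mul_assoc, mul_comm (C (1 / 2)) 2, two_mul_C_half, one_mul, h2]
  exact eq_add_sum_X_mul_divVar F

theorem two_mul_constantCoeff_quadMatrix [CharZero K] (F : MvPowerSeries (Option (Fin n)) K)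
    (i j : Fin n) : 2 * constantCoeff (quadMatrix F i j) =
      constantCoeff (pderiv K (some i) (pderiv K (some j) F)) := by
  have h : constantCoeff (pderiv K (some i) (pderiv K (some j) F)) =
      coeff (Finsupp.single (some i) 1 + Finsupp.single (some j) 1) F *
        ((Finsupp.single (some i) 1 : Option (Fin n) →₀ ℕ) (some j) + 1) := by
    rw [← coeff_zero_eq_constantCoeff_apply, coeff_pderiv, zero_add, coeff_pderiv]
    simp
  rw [h, quadMatrix, Matrix.of_apply, map_mul, map_add, constantCoeff_divVar_divVar,
    constantCoeff_divVar_divVar, constantCoeff_C, add_comm (Finsupp.single (some j) 1)]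
  rcases lt_trichotomy i j with hij | rfl | hij
  · have : some i ≠ some j := by simpa using hij.ne
    rw [if_neg (not_le.mpr hij), if_pos hij.le, Finsupp.single_eq_of_ne' this]
    simp
  · simp; ring
  · have : some i ≠ some j := by simpa using hij.ne'
    rw [if_pos hij.le, if_neg (not_le.mpr hij), Finsupp.single_eq_of_ne' this]
    simp

end QuadraticForm

section DefinableSeries

open MvPowerSeries

/-! ### Definability of derivatives, divided differences and translates -/

variable {k : Type u} [Field k] {L : DenefPas k} {n : ℕ}

/-- The points with coordinates of valuation at least `a`. -/
def ball (n : ℕ) (a : ∀ (K : Type u) [Field K] [Algebra k K], ℕ) (K : Type u) [Field K]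
    [Algebra k K] (p : Fin n → PowerSeries K) : Prop :=
  ∀ i, PowerSeries.X ^ a K ∣ p i

variable {a : ∀ (K : Type u) [Field K] [Algebra k K], ℕ}

theorem ball.constantCoeff (ha : ∀ (K : Type u) [Field K] [Algebra k K], 1 ≤ a K) {K : Type u}
    [Field K] [Algebra k K] {p : Fin n → PowerSeries K} (hp : ball n a K p) (i : Fin n) :
    PowerSeries.constantCoeff (p i) = 0 := by
  have := ha K
  rw [← PowerSeries.X_dvd_iff]
  exact (dvd_pow_self _ (by omega)).trans (hp i)

theorem ball.add_single {K : Type u} [Field K] [Algebra k K] {p : Fin n → PowerSeries K}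
    (hp : ball n a K p) (i : Fin n) {h : PowerSeries K} :
    ball n a K (p + Pi.single i h) ↔ PowerSeries.X ^ a K ∣ h := by
  constructor
  · intro H
    have := dvd_sub (H i) (hp i)
    simpa using this
  · intro hh j
    by_cases hj : j = i
    · subst hj
      simpa using dvd_add (hp j) hh
    · simpa [hj] using hp j

theorem ball.ite_zero {K : Type u} [Field K] [Algebra k K] {p : Fin n → PowerSeries K}
    (hp : ball n a K p) (f : Fin n → Prop) [DecidablePred f] :
    ball n a K fun j => if f j then 0 else p j := by
  intro j
  dsimp only
  split_ifs
  · exact dvd_zero _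
  · exact hp j

/-- The pairs of a point of the ball (the variables `some j`) and an increment (the variable `none`)
of its coordinate of index `i` that does not leave the ball. -/
def incrementDomain (n : ℕ) (a : ∀ (K : Type u) [Field K] [Algebra k K], ℕ) (i : Fin n)
    (K : Type u) [Field K] [Algebra k K] (q : Option (Fin n) → PowerSeries K) : Prop :=
  ball n a K (q ∘ some) ∧ ball n a K (q ∘ some + Pi.single i (q none))

theorem isTermFun_increment (i j : Fin n) : IsTermFun k
    fun K _ _ (q : Option (Fin n) → PowerSeries K) =>
      (q ∘ some + Pi.single i (q none) : Fin n → PowerSeries K) j := by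
  by_cases hj : j = i
  · subst hj
    simpa using (IsTermFun.var (some j)).add (IsTermFun.var none)
  · simpa [hj] using IsTermFun.var (some j)

theorem isDefinableRel_incrementDomain (hD : IsDefinableRel L (ball n a)) (i : Fin n) :
    IsDefinableRel L (incrementDomain n a i) := by
  refine ((hD.comap some).and (IsDefinableRel.subst IsDefinableRel.true hD fun j =>
    (isTermFun_increment i j).isDefinableFun IsDefinableRel.true)).congr fun K _ _ q => ?_
  rw [true_and]
  rfl

/-- A function `g` on a ball is definable if `y = g p` is characterised by the solvability in `z`
of linear equations `A = B y + C z` with definable coefficients, for all small increments `h` of one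
coordinate of `p`. This replaces the passage to the limit in difference quotients. -/
theorem IsDefinableFun.of_increments (hD : IsDefinableRel L (ball n a)) (i : Fin n)
    {A B C : ∀ (K : Type u) [Field K] [Algebra k K], (Option (Fin n) → PowerSeries K) →
      PowerSeries K}
    (hA : IsDefinableFun L (incrementDomain n a i) A)
    (hB : IsDefinableFun L (incrementDomain n a i) B)
    (hC : IsDefinableFun L (incrementDomain n a i) C)
    {g : ∀ (K : Type u) [Field K] [Algebra k K], (Fin n → PowerSeries K) → PowerSeries K}
    (hg : ∀ (K : Type u) [Field K] [Algebra k K] (p : Fin n → PowerSeries K), ball n a K p →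
      ∀ y, (∀ h, PowerSeries.X ^ a K ∣ h → ∃ z, A K (fun o => o.elim h p) =
        B K (fun o => o.elim h p) * y + C K (fun o => o.elim h p) * z) ↔ y = g K p) :
    IsDefinableFun L (ball n a) g := by
  have hED := isDefinableRel_incrementDomain hD i
  -- contexts: `none` is `z`, `some none` is `h`, `some (some none)` is `y`
  let τ : Option (Fin n) → Option (Option (Option (Fin n))) :=
    fun o => o.elim (some none) fun i => some (some (some i))
  have hED' : IsDefinableRel L fun K _ _ (q : Option (Option (Option (Fin n))) → PowerSeries K) =>
      incrementDomain n a i K (q ∘ τ) := hED.comap τ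
  have h1 := (IsDefinableFun.eq hED' (hA.comap τ)
    (((hB.comap τ).mul hED' ((IsTermFun.var (some (some none))).isDefinableFun hED')).add hED'
      ((hC.comap τ).mul hED' ((IsTermFun.var none).isDefinableFun hED')))).ex
  let τ' : Option (Fin n) → Option (Option (Fin n)) :=
    fun o => o.elim none fun i => some (some i)
  have h2 := ((hED.comap τ').imp h1).all
  refine IsDefinableFun.of_rel hD h2 fun K _ _ p hp y => ?_
  rw [← hg K p hp]
  have e1 (h : PowerSeries K) : ((fun o => o.elim h fun o => o.elim y p :
      Option (Option (Fin n)) → PowerSeries K) ∘ τ') = fun o => o.elim h p := by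
    funext o; cases o <;> rfl
  have e2 (h z : PowerSeries K) : ((fun o => o.elim z fun o => o.elim h fun o => o.elim y p :
      Option (Option (Option (Fin n))) → PowerSeries K) ∘ τ) = fun o => o.elim h p := by
    funext o; cases o <;> rfl
  refine forall_congr' fun h => ?_
  have e3 : incrementDomain n a i K (fun o => o.elim h p) ↔ PowerSeries.X ^ a K ∣ h :=
    (and_iff_right hp).trans (hp.add_single i)
  simp only [e1, e2, e3, Option.elim_none, Option.elim_some]
  exact imp_congr_right fun hh => by simp only [hh, true_and]

section

variable (hD : IsDefinableRel L (ball n a)) (ha : ∀ (K : Type u) [Field K] [Algebra k K], 1 ≤ a K)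
  {F : ∀ (K : Type u) [Field K] [Algebra k K], MvPowerSeries (Option (Fin n)) K}
  (hF : IsDefinableFun L (ball n a) fun K _ _ p => ev p (F K)) (i : Fin n)

include hD hF

theorem isDefinableFun_ev_increment :
    IsDefinableFun L (incrementDomain n a i) fun K _ _ q =>
      ev (q ∘ some + Pi.single i (q none)) (F K) :=
  IsDefinableFun.comp (isDefinableRel_incrementDomain hD i) hF
    (fun j => (isTermFun_increment i j).isDefinableFun (isDefinableRel_incrementDomain hD i))
    fun _ _ _ _ hq => hq.2

theorem isDefinableFun_ev_increment_ite (f : Fin n → Prop) [DecidablePred f] :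
    IsDefinableFun L (incrementDomain n a i) fun K _ _ q =>
      ev (fun j => if f j then 0 else (q ∘ some + Pi.single i (q none) : Fin n → PowerSeries K) j)
        (F K) := by
  refine IsDefinableFun.comp (isDefinableRel_incrementDomain hD i) hF
    (fun j => IsTermFun.isDefinableFun (isDefinableRel_incrementDomain hD i) ?_)
    fun _ _ _ _ hq => hq.2.ite_zero f
  split_ifs
  · simpa using IsTermFun.intCast 0
  · exact isTermFun_increment i j

include ha

/-- The derivative at `p` is the only `y` such that `F (p + h) - F p = h y + h ^ 2 z` has a solution
`z` in `K[[t]]` for every small increment `h` of the coordinate. -/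
theorem isDefinableFun_ev_pderiv :
    IsDefinableFun L (ball n a) fun K _ _ p => ev p (pderiv K (some i) (F K)) := by
  have hE := isDefinableRel_incrementDomain hD i
  have hh : IsDefinableFun L (incrementDomain n a i) fun K _ _ q => q none :=
    (IsTermFun.var none).isDefinableFun hE
  have hp : IsDefinableFun L (incrementDomain n a i) fun K _ _ q => ev (q ∘ some) (F K) :=
    IsDefinableFun.comp hE hF (g := fun j _ _ _ q => q (some j))
      (fun j => (IsTermFun.var (some j)).isDefinableFun hE) fun _ _ _ _ hq => hq.1
  refine IsDefinableFun.of_increments hD i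
    ((isDefinableFun_ev_increment hD hF i).sub hE hp) hh (hh.mul hE hh) fun K _ _ p hp y => ?_
  have hp0 := hp.constantCoeff ha
  have haK := ha K
  have h0 (h : PowerSeries K) (hh : PowerSeries.X ^ a K ∣ h) : PowerSeries.constantCoeff h = 0 :=
    PowerSeries.X_dvd_iff.mp ((dvd_pow_self _ (by omega)).trans hh)
  have e (h : PowerSeries K) : (fun o => o.elim h p : Option (Fin n) → PowerSeries K) ∘ some = p :=
    rfl
  simp only [e, Option.elim_none]
  constructor
  · intro H
    refine eq_of_forall_le_X_pow_dvd (a K) fun d hd => ?_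
    obtain ⟨z, hz⟩ := H (PowerSeries.X ^ d) (pow_dvd_pow _ hd)
    have h1 := X_pow_dvd_taylor hp0 i (h0 _ (pow_dvd_pow _ hd)) dvd_rfl (F K)
    have h2 : PowerSeries.X ^ (2 * d) ∣ (PowerSeries.X ^ d * PowerSeries.X ^ d) * z := by
      rw [two_mul, pow_add]; exact Dvd.intro _ rfl
    have h3 := dvd_sub h1 h2
    convert h3 using 1
    linear_combination -hz
  · rintro rfl h hh
    by_cases hne : h = 0
    · subst hne
      exact ⟨0, by simp⟩
    · obtain ⟨d, u, hu, rfl⟩ : ∃ (d : ℕ) (u : PowerSeries K), IsUnit u ∧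
          h = PowerSeries.X ^ d * u :=
        ⟨_, _, PowerSeries.isUnit_divided_by_X_pow_order hne,
          PowerSeries.X_pow_order_mul_divXPowOrder.symm⟩
      obtain ⟨w, hw⟩ := X_pow_dvd_taylor hp0 i (h0 _ hh) (Dvd.intro _ rfl) (F K)
      obtain ⟨v, hv⟩ := hu.exists_right_inv
      refine ⟨w * v * v, ?_⟩
      rw [two_mul, pow_add] at hw
      linear_combination hw - (PowerSeries.X ^ d * PowerSeries.X ^ d * w * (u * v + 1)) * hv

/-- The value of the divided difference at `p` cannot be defined by a division if `p i = 0`. It is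
the only `y` that satisfies the defining equation at `p + h`, up to a multiple of `(p i + h) h`,
for every small increment `h` of the coordinate. -/
theorem isDefinableFun_ev_divVar :
    IsDefinableFun L (ball n a) fun K _ _ p => ev p (divVar i (F K)) := by
  have hE := isDefinableRel_incrementDomain hD i
  have hh : IsDefinableFun L (incrementDomain n a i) fun K _ _ q => q none :=
    (IsTermFun.var none).isDefinableFun hE
  have hx : IsDefinableFun L (incrementDomain n a i) fun K _ _ q =>
      (q ∘ some + Pi.single i (q none) : Fin n → PowerSeries K) i :=
    (isTermFun_increment i i).isDefinableFun hE
  refine IsDefinableFun.of_increments hD i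
    ((isDefinableFun_ev_increment_ite hD hF i fun j => (i : ℕ) + 1 ≤ j).sub hE
      (isDefinableFun_ev_increment_ite hD hF i fun j => (i : ℕ) ≤ j)) hx (hx.mul hE hh)
    fun K _ _ p hp y => ?_
  have hp0 := hp.constantCoeff ha
  have hadd (h : PowerSeries K) (hh : PowerSeries.X ^ a K ∣ h) :=
    ((hp.add_single i).mpr hh).constantCoeff ha
  have e (h : PowerSeries K) : (fun o => o.elim h p : Option (Fin n) → PowerSeries K) ∘ some = p :=
    rfl
  simp only [e, Option.elim_none]
  -- the equation says that `y` is the value of the divided difference up to a multiple of `h`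
  have key (h : PowerSeries K) (hh : PowerSeries.X ^ a K ∣ h) (z : PowerSeries K) :
      ev (fun j : Fin n => if (i : ℕ) + 1 ≤ j then 0 else
          (p + Pi.single i h : Fin n → PowerSeries K) j) (F K) -
        ev (fun j : Fin n => if (i : ℕ) ≤ j then 0 else
          (p + Pi.single i h : Fin n → PowerSeries K) j) (F K) =
        (p + Pi.single i h : Fin n → PowerSeries K) i * y +
          (p + Pi.single i h : Fin n → PowerSeries K) i * h * z ↔
      (p i + h) * (ev (p + Pi.single i h) (divVar i (F K)) - y - h * z) = 0 := by
    rw [← mul_ev_divVar i (F K) (hadd h hh), Pi.add_apply, Pi.single_eq_same]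
    constructor
    · intro H; linear_combination H
    · intro H; linear_combination H
  have hlip (h : PowerSeries K) (hh : PowerSeries.X ^ a K ∣ h) (d : ℕ)
      (hd : PowerSeries.X ^ d ∣ h) : PowerSeries.X ^ d ∣
        ev (p + Pi.single i h) (divVar i (F K)) - ev p (divVar i (F K)) := by
    refine X_pow_dvd_ev_sub hp0 (hadd h hh) (fun j => ?_) _
    by_cases hj : j = i
    · subst hj; simpa using hd
    · simp [hj]
  constructor
  · intro H
    refine eq_of_forall_le_X_pow_dvd (max (a K) ((p i).order.toNat + 1)) fun d hd => ?_
    have hd1 : PowerSeries.X ^ a K ∣ (PowerSeries.X ^ d : PowerSeries K) :=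
      pow_dvd_pow _ ((le_max_left _ _).trans hd)
    obtain ⟨z, hz⟩ := H (PowerSeries.X ^ d) hd1
    have h1 := (key _ hd1 z).mp hz
    have hne : p i + PowerSeries.X ^ d ≠ 0 := by
      intro h0
      have h2 : p i = - PowerSeries.X ^ d := eq_neg_of_add_eq_zero_left h0
      rw [h2, PowerSeries.order_neg, PowerSeries.order_X_pow] at hd
      have := (le_max_right _ _).trans hd
      simp at this
    have h2 := (mul_eq_zero.mp h1).resolve_left hne
    have h3 : PowerSeries.X ^ d ∣ y - ev p (divVar i (F K)) := by
      have h4 := dvd_sub (hlip _ hd1 d dvd_rfl) (Dvd.intro z rfl : PowerSeries.X ^ d ∣ _)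
      convert h4 using 1
      linear_combination -h2
    rw [two_mul, pow_add]
    exact mul_dvd_mul_left _ h3
  · rintro rfl h hh
    by_cases hne : h = 0
    · subst hne
      exact ⟨0, (key 0 hh 0).mpr (by simp)⟩
    · have hu := PowerSeries.isUnit_divided_by_X_pow_order hne
      have e := (PowerSeries.X_pow_order_mul_divXPowOrder (f := h)).symm
      obtain ⟨w, hw⟩ := hlip h hh _ (Dvd.intro _ e.symm)
      obtain ⟨v, hv⟩ := hu.exists_right_inv
      refine ⟨v * w, (key h hh _).mpr ?_⟩
      rw [hw]
      have e2 : h * (v * w) = PowerSeries.X ^ h.order.toNat * w := by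
        conv_lhs => rw [e]
        linear_combination (PowerSeries.X ^ h.order.toNat * w) * hv
      rw [e2]; ring

omit i in
theorem isDefinableFun_ev_translate
    {c : ∀ (K : Type u) [Field K] [Algebra k K], Fin n → PowerSeries K}
    (hc : ∀ j, IsDefinableFun L (ball n a) fun K _ _ _ => c K j)
    (hcD : ∀ (K : Type u) [Field K] [Algebra k K], ball n a K (c K)) :
    IsDefinableFun L (ball n a) fun K _ _ p => ev p (translate (c K) (F K)) := by
  have h1 : IsDefinableFun L (ball n a) fun K _ _ p => ev (fun j => c K j + p j) (F K) :=
    IsDefinableFun.comp hD hF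
      (fun j => (hc j).add hD ((IsTermFun.var j).isDefinableFun hD))
      fun K _ _ p hp j => dvd_add (hcD K j) (hp j)
  exact h1.congr fun K _ _ p hp => ev_translate ((hcD K).constantCoeff ha)
    (hp.constantCoeff ha) _

end

end DefinableSeries

/-! ### Diagonalisation of symmetric matrices -/

section Pivot

variable {S : Type} [Fintype S] [DecidableEq S]

/-- The integer matrices used to produce an invertible entry at the diagonal position `s₀`. The
column of index `s₀` is the sum of the basis vectors `i` and `j`, or the basis vector `i` if
`i = j`. -/
def pivotMatrix (s₀ : S) (w : S × S) : Matrix S S ℤ :=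
  (if w.1 = w.2 then 1 else Matrix.transvection w.2 w.1 1).submatrix id (Equiv.swap s₀ w.1)

theorem isUnit_det_pivotMatrix (s₀ : S) (w : S × S) : IsUnit (pivotMatrix s₀ w).det := by
  rw [pivotMatrix, Matrix.det_permute']
  refine IsUnit.mul (Units.isUnit _) ?_
  split_ifs with h
  · simp
  · rw [Matrix.det_transvection_of_ne _ _ (Ne.symm h)]
    exact isUnit_one

omit [Fintype S] in
theorem pivotMatrix_apply (s₀ : S) (w : S × S) (a : S) :
    pivotMatrix s₀ w a s₀ = if w.1 = w.2 then (if a = w.1 then 1 else 0) else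
      ((if a = w.1 then 1 else 0) + if a = w.2 then 1 else 0) := by
  rw [pivotMatrix, Matrix.submatrix_apply, Equiv.swap_apply_left, id]
  split_ifs with h1 h2 h3 h4 h5 <;>
    simp_all [Matrix.transvection, Matrix.one_apply, eq_comm]

/-- Since `2` is invertible, a symmetric matrix over a local ring with invertible determinant
represents a unit: if no diagonal entry is a unit, some entry `M i j` is one, and the sum of the
basis vectors `i` and `j` represents `M i i + M j j + 2 * M i j`. -/
theorem exists_isUnit_pivot {R : Type*} [CommRing R] [IsLocalRing R] (h2 : IsUnit (2 : R))
    (M : Matrix S S R) (hM : M.transpose = M) (hdet : IsUnit M.det) (s₀ : S) :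
    ∃ w : S × S, IsUnit ((((pivotMatrix s₀ w).map (Int.cast : ℤ → R)).transpose * M *
      (pivotMatrix s₀ w).map (Int.cast : ℤ → R)) s₀ s₀) := by
  have hentry (w : S × S) : (((pivotMatrix s₀ w).map (Int.cast : ℤ → R)).transpose * M *
      (pivotMatrix s₀ w).map (Int.cast : ℤ → R)) s₀ s₀ =
      if w.1 = w.2 then M w.1 w.1 else M w.1 w.1 + M w.2 w.2 + 2 * M w.1 w.2 := by
    have hsymm : M w.2 w.1 = M w.1 w.2 := congrFun (congrFun hM w.1) w.2
    simp only [Matrix.mul_apply, Matrix.transpose_apply, Matrix.map_apply, pivotMatrix_apply]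
    split_ifs with h
    · simp
    · simp only [Int.cast_add, Int.cast_ite, Int.cast_one, Int.cast_zero, add_mul, mul_add,
        ite_mul, mul_ite, one_mul, mul_one, zero_mul, mul_zero, Finset.sum_add_distrib,
        Finset.sum_ite_eq', Finset.mem_univ, if_true, hsymm]
      ring
  by_cases hd : ∃ i, IsUnit (M i i)
  · obtain ⟨i, hi⟩ := hd
    exact ⟨(i, i), by rwa [hentry, if_pos rfl]⟩
  · push Not at hd
    obtain ⟨i, j, hij⟩ : ∃ i j, IsUnit (M i j) := by
      by_contra hcon
      push Not at hcon
      have h0 : M.map (IsLocalRing.residue R) = 0 := by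
        ext i j
        simpa [IsLocalRing.residue_eq_zero_iff] using hcon i j
      have h1 : (IsLocalRing.residue R) M.det = 0 := by
        rw [RingHom.map_det, RingHom.mapMatrix_apply, h0]
        have : Nonempty S := ⟨s₀⟩
        exact Matrix.det_zero
      rw [IsLocalRing.residue_eq_zero_iff] at h1
      exact h1 hdet
    have hne : i ≠ j := by
      rintro rfl
      exact hd i hij
    refine ⟨(i, j), ?_⟩
    rw [hentry, if_neg hne]
    -- the sum of two non-units and of a unit
    have h3 : M i i + M j j ∈ IsLocalRing.maximalIdeal R := add_mem (hd i) (hd j)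
    by_contra hcon
    have h4 := sub_mem ((IsLocalRing.mem_maximalIdeal _).mpr hcon) h3
    rw [add_sub_cancel_left] at h4
    exact h4 (h2.mul hij)

variable {R : Type*} [CommRing R]

/-- The Schur complement of the upper left entry of a symmetric matrix, `v` being the inverse of
that entry. -/
def schurComplement (v : R) (M : Matrix (Unit ⊕ S) (Unit ⊕ S) R) : Matrix S S R :=
  Matrix.of fun i j => M (.inr i) (.inr j) - v * (M (.inl ()) (.inr i) * M (.inl ()) (.inr j))

/-- The unipotent matrix that completes the square for the first variable. -/
def completeSquare (v : R) (M : Matrix (Unit ⊕ S) (Unit ⊕ S) R) :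
    Matrix (Unit ⊕ S) (Unit ⊕ S) R :=
  Matrix.fromBlocks 1 (Matrix.of fun _ j => v * M (.inl ()) (.inr j)) 0 1

theorem eq_completeSquare (v : R) (M : Matrix (Unit ⊕ S) (Unit ⊕ S) R) (hM : M.transpose = M)
    (hv : M (.inl ()) (.inl ()) * v = 1) :
    M = (completeSquare v M).transpose * Matrix.fromBlocks
      (Matrix.of fun _ _ => M (.inl ()) (.inl ())) 0 0 (schurComplement v M) *
      completeSquare v M := by
  have hsymm (a b : Unit ⊕ S) : M b a = M a b := congrFun (congrFun hM a) b
  rw [completeSquare, Matrix.fromBlocks_transpose, Matrix.fromBlocks_multiply,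
    Matrix.fromBlocks_multiply]
  ext (⟨⟩ | i) (⟨⟩ | j)
  · simp
  · simp only [Matrix.transpose_one, Matrix.one_mul, Matrix.transpose_zero, Matrix.zero_mul,
      add_zero, Matrix.mul_zero, zero_add, Matrix.mul_one, Matrix.fromBlocks_apply₁₂,
      Matrix.mul_apply, Matrix.of_apply, Finset.univ_unique, Finset.sum_singleton]
    linear_combination (-M (.inl ()) (.inr j)) * hv
  · simp only [Matrix.transpose_one, Matrix.one_mul, Matrix.transpose_zero, Matrix.zero_mul,
      add_zero, Matrix.mul_zero, zero_add, Matrix.mul_one, Matrix.fromBlocks_apply₂₁,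
      Matrix.mul_apply, Matrix.of_apply, Finset.univ_unique, Finset.sum_singleton,
      Matrix.transpose_apply, hsymm (.inl ()) (.inr i)]
    linear_combination (-M (.inl ()) (.inr i)) * hv
  · simp only [Matrix.transpose_one, Matrix.one_mul, Matrix.transpose_zero, Matrix.zero_mul,
      add_zero, Matrix.mul_zero, zero_add, Matrix.mul_one, Matrix.fromBlocks_apply₂₂,
      Matrix.mul_apply, Matrix.of_apply, Finset.univ_unique, Finset.sum_singleton,
      Matrix.transpose_apply, schurComplement, Matrix.add_apply]
    linear_combination (-v * M (.inl ()) (.inr i) * M (.inl ()) (.inr j)) * hv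

theorem det_eq_mul_det_schurComplement (v : R) (M : Matrix (Unit ⊕ S) (Unit ⊕ S) R)
    (hM : M.transpose = M) (hv : M (.inl ()) (.inl ()) * v = 1) :
    M.det = M (.inl ()) (.inl ()) * (schurComplement v M).det := by
  have h1 : (completeSquare v M).det = 1 := by
    rw [completeSquare, Matrix.det_fromBlocks_zero₂₁]
    simp
  conv_lhs => rw [eq_completeSquare v M hM hv]
  rw [Matrix.det_mul, Matrix.det_mul, Matrix.det_transpose, h1, Matrix.det_fromBlocks_zero₂₁]
  simp

omit [Fintype S] [DecidableEq S] in
theorem schurComplement_transpose (v : R) (M : Matrix (Unit ⊕ S) (Unit ⊕ S) R)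
    (hM : M.transpose = M) : (schurComplement v M).transpose = schurComplement v M := by
  ext i j
  have := congrFun (congrFun hM (.inr i)) (.inr j)
  simp only [Matrix.transpose_apply] at this
  simp only [Matrix.transpose_apply, schurComplement, Matrix.of_apply, this]
  ring

end Pivot

section DefinableMatrix

variable {k : Type u} [Field k] {L : DenefPas k} {ι : Type}
  {D : ∀ (K : Type u) [Field K] [Algebra k K], (ι → PowerSeries K) → Prop}

theorem IsDefinableFun.mono {D' : ∀ (K : Type u) [Field K] [Algebra k K],
    (ι → PowerSeries K) → Prop} (hD' : IsDefinableRel L D')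
    (h : ∀ (K : Type u) [Field K] [Algebra k K] (p : ι → PowerSeries K), D' K p → D K p)
    {g : ∀ (K : Type u) [Field K] [Algebra k K], (ι → PowerSeries K) → PowerSeries K}
    (hg : IsDefinableFun L D g) : IsDefinableFun L D' g :=
  ((hD'.comap some).and hg).congr fun K _ _ _ =>
    ⟨fun hq => ⟨hq.1, h K _ hq.1, hq.2⟩, fun hq => ⟨hq.1, hq.2.2⟩⟩

variable (L D) in
/-- A matrix of definable functions. -/
def IsDefinableMatrix {S T : Type} (M : ∀ (K : Type u) [Field K] [Algebra k K],
    (ι → PowerSeries K) → Matrix S T (PowerSeries K)) : Prop :=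
  ∀ i j, IsDefinableFun L D fun K _ _ p => M K p i j

theorem IsDefinableMatrix.mul {S T U : Type} [Fintype T] (hD : IsDefinableRel L D)
    {M : ∀ (K : Type u) [Field K] [Algebra k K], (ι → PowerSeries K) → Matrix S T (PowerSeries K)}
    {N : ∀ (K : Type u) [Field K] [Algebra k K], (ι → PowerSeries K) → Matrix T U (PowerSeries K)}
    (hM : IsDefinableMatrix L D M) (hN : IsDefinableMatrix L D N) :
    IsDefinableMatrix L D fun K _ _ p => M K p * N K p := by
  intro i j
  simp only [Matrix.mul_apply]
  exact IsDefinableFun.sum hD _ fun l _ => (hM i l).mul hD (hN l j)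

theorem IsDefinableMatrix.intCast {S T : Type} (hD : IsDefinableRel L D) (W : Matrix S T ℤ) :
    IsDefinableMatrix L D fun K _ _ _ => W.map (Int.cast : ℤ → PowerSeries K) :=
  fun i j => by simpa using (IsTermFun.intCast (W i j)).isDefinableFun hD

theorem isUnit_two_powerSeries [CharZero k] (K : Type u) [Field K] [Algebra k K] :
    IsUnit (2 : PowerSeries K) := by
  have : CharZero K := charZero_of_injective_algebraMap (algebraMap k K).injective
  rw [PowerSeries.isUnit_iff_constantCoeff, map_ofNat]
  simp

variable (L) in
/-- Symmetric matrices with index set `S` and invertible determinant over `K[[t]]` can be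
diagonalised uniformly in `K`, and definably with respect to parameters. -/
def HasDefinableDiagonalization (ι S : Type) [Fintype S] [DecidableEq S] : Prop :=
  ∀ (D : ∀ (K : Type u) [Field K] [Algebra k K], (ι → PowerSeries K) → Prop)
    (M : ∀ (K : Type u) [Field K] [Algebra k K], (ι → PowerSeries K) → Matrix S S (PowerSeries K)),
    IsDefinableRel L D → IsDefinableMatrix L D M →
    (∀ (K : Type u) [Field K] [Algebra k K] (p : ι → PowerSeries K), D K p →
      (M K p).transpose = M K p ∧ IsUnit (M K p).det) →
    ∃ (P : ∀ (K : Type u) [Field K] [Algebra k K], (ι → PowerSeries K) →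
        Matrix S S (PowerSeries K))
      (d : S → ∀ (K : Type u) [Field K] [Algebra k K], (ι → PowerSeries K) → PowerSeries K),
      IsDefinableMatrix L D P ∧ (∀ i, IsDefinableFun L D (d i)) ∧
      ∀ (K : Type u) [Field K] [Algebra k K] (p : ι → PowerSeries K), D K p →
        M K p = (P K p).transpose * Matrix.diagonal (fun i => d i K p) * P K p

theorem HasDefinableDiagonalization.of_equiv {S T : Type} [Fintype S] [DecidableEq S] [Fintype T]
    [DecidableEq T] (e : T ≃ S) (h : HasDefinableDiagonalization L ι S) :
    HasDefinableDiagonalization L ι T := by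
  intro D M hD hM hs
  obtain ⟨P, d, hP, hd, H⟩ := h D (fun K _ _ p => (M K p).submatrix e.symm e.symm) hD
    (fun i j => hM _ _) (fun K _ _ p hp => by
      rw [Matrix.transpose_submatrix, Matrix.det_submatrix_equiv_self, (hs K p hp).1]
      exact ⟨rfl, (hs K p hp).2⟩)
  refine ⟨fun K _ _ p => (P K p).submatrix e e, fun i => d (e i), fun i j => hP _ _,
    fun i => hd _, fun K _ _ p hp => ?_⟩
  have h1 := congrArg (fun A => A.submatrix e e) (H K p hp)
  simp only [Matrix.submatrix_submatrix, Equiv.symm_comp_self, Matrix.submatrix_id_id] at h1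
  rw [h1, ← Matrix.submatrix_mul_equiv _ _ e e e, ← Matrix.submatrix_mul_equiv _ _ e e e,
    Matrix.transpose_submatrix, Matrix.submatrix_diagonal_equiv]
  rfl

/-- The inductive step: after a definable choice of a pivot, the square of the first variable is
completed, and the induction hypothesis applies to the Schur complement. -/
theorem HasDefinableDiagonalization.unit_sum [CharZero k] {S : Type} [Fintype S] [DecidableEq S]
    (ih : HasDefinableDiagonalization L ι S) : HasDefinableDiagonalization L ι (Unit ⊕ S) := by
  intro D M hD hM hs
  let Ω := (Unit ⊕ S) × (Unit ⊕ S)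
  let W (w : Ω) (K : Type u) [Field K] : Matrix (Unit ⊕ S) (Unit ⊕ S) (PowerSeries K) :=
    (pivotMatrix (Sum.inl ()) w).map (Int.cast : ℤ → PowerSeries K)
  let W' (w : Ω) (K : Type u) [Field K] : Matrix (Unit ⊕ S) (Unit ⊕ S) (PowerSeries K) :=
    ((pivotMatrix (Sum.inl ()) w)⁻¹).map (Int.cast : ℤ → PowerSeries K)
  have hWW' (w : Ω) (K : Type u) [Field K] : W w K * W' w K = 1 := by
    have h1 := Matrix.mul_nonsing_inv _ (isUnit_det_pivotMatrix (Sum.inl ()) w)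
    have h2 := congrArg (fun A : Matrix _ _ ℤ => A.map (Int.castRingHom (PowerSeries K))) h1
    simp only [Matrix.map_mul] at h2
    simpa using! h2
  have hWdet (w : Ω) (K : Type u) [Field K] : IsUnit (W w K).det :=
    Matrix.isUnit_det_of_right_inverse (hWW' w K)
  let M' (w : Ω) (K : Type u) [Field K] [Algebra k K] (p : ι → PowerSeries K) :
    Matrix (Unit ⊕ S) (Unit ⊕ S) (PowerSeries K) := (W w K).transpose * M K p * W w K
  have hM' (w : Ω) : IsDefinableMatrix L D (M' w) :=
    ((IsDefinableMatrix.intCast hD (pivotMatrix (Sum.inl ()) w).transpose).mul hD hM).mul hD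
      (IsDefinableMatrix.intCast hD _)
  obtain ⟨s, hs1, hs2⟩ := exists_definable_choice
    (V := fun w K _ _ p => IsUnit (M' w K p (.inl ()) (.inl ())))
    (fun w => (hM' w (.inl ()) (.inl ())).isUnit hD)
    (fun K _ _ p hp => exists_isUnit_pivot (isUnit_two_powerSeries (k := k) K) (M K p)
      (hs K p hp).1 (hs K p hp).2 (Sum.inl ()))
  let Dw (w : Ω) (K : Type u) [Field K] [Algebra k K] (p : ι → PowerSeries K) : Prop :=
    D K p ∧ s K p = some w
  have hpivot (w : Ω) (K : Type u) [Field K] [Algebra k K] (p : ι → PowerSeries K)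
      (hp : Dw w K p) : IsUnit (M' w K p (.inl ()) (.inl ())) := by
    obtain ⟨w', hw', h⟩ := hs2 K p hp.1
    rw [hp.2, Option.some.injEq] at hw'
    rwa [hw']
  have hM'w (w : Ω) : IsDefinableMatrix L (Dw w) (M' w) :=
    fun i j => (hM' w i j).mono (hs1 w) fun _ _ _ _ h => h.1
  let v (w : Ω) (K : Type u) [Field K] [Algebra k K] (p : ι → PowerSeries K) : PowerSeries K :=
    Ring.inverse (M' w K p (.inl ()) (.inl ()))
  have hv (w : Ω) : IsDefinableFun L (Dw w) (v w) :=
    (hM'w w _ _).inverse (hs1 w) (hpivot w)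
  have hv1 (w : Ω) (K : Type u) [Field K] [Algebra k K] (p : ι → PowerSeries K)
      (hp : Dw w K p) : M' w K p (.inl ()) (.inl ()) * v w K p = 1 :=
    Ring.mul_inverse_cancel _ (hpivot w K p hp)
  have hsymm' (w : Ω) (K : Type u) [Field K] [Algebra k K] (p : ι → PowerSeries K)
      (hp : Dw w K p) : (M' w K p).transpose = M' w K p := by
    simp only [M', Matrix.transpose_mul, Matrix.transpose_transpose, (hs K p hp.1).1,
      Matrix.mul_assoc]
  -- the induction hypothesis is applied to the Schur complement, on the domain of each pivot
  have hrec (w : Ω) := ih (Dw w) (fun K _ _ p => schurComplement (v w K p) (M' w K p)) (hs1 w)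
    (fun i j => (hM'w w _ _).sub (hs1 w)
      ((hv w).mul (hs1 w) ((hM'w w _ _).mul (hs1 w) (hM'w w _ _))))
    (fun K _ _ p hp => ⟨schurComplement_transpose _ _ (hsymm' w K p hp), by
      have h1 : IsUnit (M' w K p).det := by
        simp only [M', Matrix.det_mul, Matrix.det_transpose]
        exact ((hWdet w K).mul (hs K p hp.1).2).mul (hWdet w K)
      rw [det_eq_mul_det_schurComplement _ _ (hsymm' w K p hp) (hv1 w K p hp)] at h1
      exact isUnit_of_mul_isUnit_right h1⟩)
  choose P d hP hd H using hrec
  let Q (w : Ω) (K : Type u) [Field K] [Algebra k K] (p : ι → PowerSeries K) :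
      Matrix (Unit ⊕ S) (Unit ⊕ S) (PowerSeries K) :=
    Matrix.fromBlocks 1 0 0 (P w K p) * completeSquare (v w K p) (M' w K p) * W' w K
  let d' (w : Ω) : Unit ⊕ S → ∀ (K : Type u) [Field K] [Algebra k K], (ι → PowerSeries K) →
      PowerSeries K := fun o => o.elim (fun _ K _ _ p => M' w K p (.inl ()) (.inl ())) (d w)
  have hQ (w : Ω) : IsDefinableMatrix L (Dw w) (Q w) := by
    have h0 : IsDefinableFun L (Dw w) fun _ _ _ _ => 0 := by
      simpa using (IsTermFun.intCast 0).isDefinableFun (hs1 w)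
    have h1 : IsDefinableFun L (Dw w) fun _ _ _ _ => 1 := by
      simpa using (IsTermFun.intCast 1).isDefinableFun (hs1 w)
    refine (IsDefinableMatrix.mul (hs1 w) (IsDefinableMatrix.mul (hs1 w) ?_ ?_)
      (IsDefinableMatrix.intCast (hs1 w) _))
    · rintro (⟨⟩ | i) (⟨⟩ | j)
      · simpa using h1
      · simpa using h0
      · simpa using h0
      · exact hP w i j
    · rintro (⟨⟩ | i) (⟨⟩ | j)
      · simpa [completeSquare] using h1
      · exact (hv w).mul (hs1 w) (hM'w w _ _)
      · simpa [completeSquare] using h0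
      · by_cases hij : i = j
        · simpa [completeSquare, hij] using h1
        · simpa [completeSquare, hij] using h0
  have hd' (w : Ω) (o : Unit ⊕ S) : IsDefinableFun L (Dw w) (d' w o) := by
    rcases o with ⟨⟩ | i
    · exact hM'w w _ _
    · exact hd w i
  have key (w : Ω) (K : Type u) [Field K] [Algebra k K] (p : ι → PowerSeries K) (hp : Dw w K p) :
      M K p = (Q w K p).transpose * Matrix.diagonal (fun i => d' w i K p) * Q w K p := by
    have e1 : M K p = (W' w K).transpose * M' w K p * W' w K := by
      have h1 : (W' w K).transpose * (W w K).transpose = 1 := by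
        rw [← Matrix.transpose_mul, hWW', Matrix.transpose_one]
      calc M K p = ((W' w K).transpose * (W w K).transpose) * M K p * (W w K * W' w K) := by
            rw [h1, hWW', Matrix.one_mul, Matrix.mul_one]
        _ = _ := by simp only [M', Matrix.mul_assoc]
    have e2 : Matrix.diagonal (fun i => d' w i K p) = Matrix.fromBlocks
        (Matrix.of fun _ _ => M' w K p (.inl ()) (.inl ())) 0 0
        (Matrix.diagonal fun i => d w i K p) := by
      ext (⟨⟩ | i) (⟨⟩ | j) <;> simp [d', Matrix.diagonal_apply]
    have e3 : (Matrix.fromBlocks 1 0 0 (P w K p)).transpose *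
        Matrix.diagonal (fun i => d' w i K p) * Matrix.fromBlocks 1 0 0 (P w K p) =
        Matrix.fromBlocks (Matrix.of fun _ _ : Unit => M' w K p (.inl ()) (.inl ())) 0 0
          (schurComplement (v w K p) (M' w K p)) := by
      rw [e2, H w K p hp, Matrix.fromBlocks_transpose, Matrix.fromBlocks_multiply,
        Matrix.fromBlocks_multiply]
      simp
    rw [e1]
    conv_lhs => rw [eq_completeSquare _ _ (hsymm' w K p hp) (hv1 w K p hp), ← e3]
    simp only [Q, Matrix.transpose_mul, Matrix.mul_assoc]
  have hs3 (K : Type u) [Field K] [Algebra k K] (p : ι → PowerSeries K) (hp : D K p) :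
      ∃ w, s K p = some w := (hs2 K p hp).imp fun _ h => h.1
  refine ⟨fun K _ _ p => Matrix.of fun i j => (s K p).elim 0 fun w => Q w K p i j,
    fun i K _ _ p => (s K p).elim 0 fun w => d' w i K p,
    fun i j => IsDefinableFun.cases hs3 fun w => hQ w i j,
    fun i => IsDefinableFun.cases hs3 fun w => hd' w i, fun K _ _ p hp => ?_⟩
  obtain ⟨w, hw⟩ := hs3 K p hp
  simp only [hw, Option.elim_some]
  exact key w K p ⟨hp, hw⟩

theorem hasDefinableDiagonalization [CharZero k] (ι : Type) (N : ℕ) :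
    HasDefinableDiagonalization L ι (Fin N) := by
  induction N with
  | zero =>
    intro D M hD hM hs
    exact ⟨M, Fin.elim0, hM, fun i => i.elim0, fun K _ _ p hp => Subsingleton.elim _ _⟩
  | succ N ih =>
    exact ih.unit_sum.of_equiv ((finCongr (Nat.add_comm N 1)).trans
      (finSumFinEquiv.symm.trans (Equiv.sumCongr finOneEquiv (Equiv.refl _))))

end DefinableMatrix

section MorseChart

open MvPowerSeries

variable {K : Type*} [Field K]

/-! ### Symmetric square roots -/

theorem constantCoeff_mul_left {τ N : Type*} [Fintype N] {E : Matrix N N (MvPowerSeries τ K)}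
    (hE : ∀ i j, constantCoeff (E i j) = 0) (V : Matrix N N (MvPowerSeries τ K)) (i j : N) :
    constantCoeff ((V * E) i j) = 0 := by
  simp [Matrix.mul_apply, hE]

theorem constantCoeff_mul_right {τ N : Type*} [Fintype N] {E : Matrix N N (MvPowerSeries τ K)}
    (hE : ∀ i j, constantCoeff (E i j) = 0) (V : Matrix N N (MvPowerSeries τ K)) (i j : N) :
    constantCoeff ((E * V) i j) = 0 := by
  simp [Matrix.mul_apply, hE]

/-- Two symmetric matrices of power series with the same constant terms, one of them invertible, are
congruent through a matrix `B` with constant term `1`. One takes for `B` the square root of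
`A₀⁻¹ A`: it satisfies `A₀ B = Bᵀ A₀`, because `A₀⁻¹ Bᵀ A₀` is another square root. -/
theorem exists_congruence [CharZero K] {τ N : Type*} [Fintype N] [DecidableEq N]
    {A A₀ V : Matrix N N (MvPowerSeries τ K)} (hA : A.transpose = A) (hA₀ : A₀.transpose = A₀)
    (hV : V * A₀ = 1) (h : ∀ i j, constantCoeff (A i j) = constantCoeff (A₀ i j)) :
    ∃ B : Matrix N N (MvPowerSeries τ K), (∀ i j, constantCoeff ((B - 1) i j) = 0) ∧
      A = B.transpose * A₀ * B ∧
      ∀ B' : Matrix N N (MvPowerSeries τ K), (∀ i j, constantCoeff ((B' - 1) i j) = 0) →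
        (A₀ * (B' * B') = A ↔ B' = B) := by
  have hV' : A₀ * V = 1 := mul_eq_one_comm.mp hV
  have hVt : V.transpose = V := by
    have h1 : A₀ * V.transpose = 1 := by
      rw [← hA₀, ← Matrix.transpose_mul, hV, Matrix.transpose_one]
    calc V.transpose = V * A₀ * V.transpose := by rw [hV, Matrix.one_mul]
      _ = V := by rw [Matrix.mul_assoc, h1, Matrix.mul_one]
  have hdiff (i j : N) : constantCoeff ((A - A₀) i j) = 0 := by
    rw [Matrix.sub_apply, map_sub, h, sub_self]
  have hC (i j : N) : constantCoeff ((V * A - 1) i j) = 0 := by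
    rw [← hV, ← Matrix.mul_sub]
    exact constantCoeff_mul_left hdiff V i j
  obtain ⟨B, ⟨hB1, hB2⟩, huniq⟩ := existsUnique_matrix_sqrt (V * A) hC
  have hsq (B' : Matrix N N (MvPowerSeries τ K)) : A₀ * (B' * B') = A ↔ B' * B' = V * A := by
    constructor
    · intro e
      rw [← e, ← Matrix.mul_assoc, hV, Matrix.one_mul]
    · intro e
      rw [e, ← Matrix.mul_assoc, hV', Matrix.one_mul]
  have hB3 : V * B.transpose * A₀ = B := by
    refine huniq _ ⟨fun i j => ?_, ?_⟩
    · have e : V * B.transpose * A₀ - 1 = V * (B - 1).transpose * A₀ := by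
        rw [Matrix.transpose_sub, Matrix.transpose_one, Matrix.mul_sub, Matrix.sub_mul,
          Matrix.mul_one, hV]
      rw [e]
      exact constantCoeff_mul_right (constantCoeff_mul_left (fun i j => hB1 j i) V) A₀ i j
    · calc V * B.transpose * A₀ * (V * B.transpose * A₀)
          = V * B.transpose * (A₀ * V) * B.transpose * A₀ := by simp only [Matrix.mul_assoc]
        _ = V * (B * B).transpose * A₀ := by
          rw [hV', Matrix.mul_one, Matrix.transpose_mul, Matrix.mul_assoc V]
        _ = V * A * (V * A₀) := by
          rw [hB2, Matrix.transpose_mul, hA, hVt]; simp only [Matrix.mul_assoc]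
        _ = V * A := by rw [hV, Matrix.mul_one]
  refine ⟨B, hB1, ?_, fun B' hB' => ?_⟩
  · have e : B.transpose * A₀ = A₀ * B := by
      conv_rhs => rw [← hB3]
      simp only [← Matrix.mul_assoc]
      rw [hV', Matrix.one_mul]
    rw [e, Matrix.mul_assoc, (hsq B).mpr hB2]
  · rw [hsq]
    constructor
    · exact fun e => huniq B' ⟨hB', e⟩
    · rintro rfl; exact hB2

/-! ### The critical point -/

theorem isUnit_det_iff {n : ℕ} (M : Matrix (Fin n) (Fin n) (PowerSeries K)) :
    IsUnit M.det ↔ (M.map PowerSeries.constantCoeff).det ≠ 0 := by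
  rw [PowerSeries.isUnit_iff_constantCoeff, RingHom.map_det, RingHom.mapMatrix_apply,
    isUnit_iff_ne_zero]

theorem X_pow_dvd_of_mulVec {n a : ℕ} {M : Matrix (Fin n) (Fin n) (PowerSeries K)}
    (hM : IsUnit M.det) {x : Fin n → PowerSeries K}
    (h : ∀ i, PowerSeries.X ^ a ∣ M.mulVec x i) (i : Fin n) : PowerSeries.X ^ a ∣ x i := by
  have e : x = (M⁻¹).mulVec (M.mulVec x) := by
    rw [Matrix.mulVec_mulVec, Matrix.nonsing_inv_mul _ hM, Matrix.one_mulVec]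
  rw [e, Matrix.mulVec_apply_eq_sum]
  exact Finset.dvd_sum fun j _ => Dvd.dvd.mul_left (h j) _

variable {n : ℕ}

/-- The Hessian matrix of `F` at the origin, modulo `t`. -/
noncomputable def residueHessian (F : MvPowerSeries (Option (Fin n)) K) :
    Matrix (Fin n) (Fin n) K :=
  Matrix.of fun i j => constantCoeff (pderiv K (some i) (pderiv K (some j) F))

theorem coeff_single_some (j : Fin n) (G : MvPowerSeries (Option (Fin n)) K) :
    coeff (Finsupp.single (some j) 1) G = constantCoeff (pderiv K (some j) G) := by
  rw [← coeff_zero_eq_constantCoeff_apply, coeff_pderiv]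
  simp

theorem constantCoeff_zero_fun (i : Fin n) :
    PowerSeries.constantCoeff ((0 : Fin n → PowerSeries K) i) = 0 := by
  simp

/-- A series whose gradient at the origin vanishes modulo `t ^ a` and whose Hessian is
nondegenerate modulo `t` has a unique critical point, and it is divisible by `t ^ a`. -/
theorem exists_critical_point {a : ℕ} (ha : 1 ≤ a) (F : MvPowerSeries (Option (Fin n)) K)
    (hgrad : ∀ i, PowerSeries.X ^ a ∣ ev 0 (pderiv K (some i) F))
    (hdet : (residueHessian F).det ≠ 0) :
    ∃ c : Fin n → PowerSeries K, (∀ i, PowerSeries.X ^ a ∣ c i) ∧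
      ∀ x : Fin n → PowerSeries K, (∀ i, PowerSeries.constantCoeff (x i) = 0) →
        ((∀ i, ev x (pderiv K (some i) F) = 0) ↔ x = c) := by
  have hP0 (i : Fin n) : constantCoeff (pderiv K (some i) F) = 0 := by
    rw [← constantCoeff_ev (constantCoeff_zero_fun (K := K)), ← PowerSeries.X_dvd_iff]
    exact (dvd_pow_self _ (by omega)).trans (hgrad i)
  obtain ⟨Q, hQ0, hQ⟩ := exists_inverse_series (fun i => pderiv K (some i) F) hP0 (by
    rw [isUnit_iff_ne_zero, ← Matrix.det_transpose]
    convert hdet using 2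
    ext i j
    exact coeff_single_some (K := K) i (pderiv K (some j) F))
  let c (i : Fin n) : PowerSeries K := ev 0 (Q i)
  have hc0 (i : Fin n) : PowerSeries.constantCoeff (c i) = 0 :=
    (constantCoeff_ev constantCoeff_zero_fun _).trans (hQ0 i)
  have hc := (hQ c 0 hc0 constantCoeff_zero_fun).mpr fun i => rfl
  refine ⟨c, ?_, fun x hx => ?_⟩
  · -- the difference of the gradients at `c` and at `0` is an invertible linear function of `c`
    let M : Matrix (Fin n) (Fin n) (PowerSeries K) :=
      Matrix.of fun i j => ev c (divVar j (pderiv K (some i) F))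
    refine X_pow_dvd_of_mulVec (M := M) ?_ fun i => ?_
    · rw [isUnit_det_iff, ← Matrix.det_transpose]
      convert hdet using 2
      ext i j
      simp only [M, Matrix.transpose_apply, Matrix.map_apply, Matrix.of_apply, residueHessian]
      rw [constantCoeff_ev hc0, ← constantCoeff_ev constantCoeff_zero_fun, ev_zero_divVar,
        constantCoeff_ev constantCoeff_zero_fun]
    · have h1 := hc i
      rw [eq_add_sum_X_mul_divVar (pderiv K (some i) F), ev_add hc0, ev_ofSeries hc0,
        ev_sum hc0] at h1
      have h2 : M.mulVec c i = - ev 0 (pderiv K (some i) F) := by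
        rw [eq_neg_iff_add_eq_zero, add_comm]
        refine Eq.trans ?_ h1
        rw [Matrix.mulVec_apply_eq_sum]
        congr 1
        refine Finset.sum_congr rfl fun j _ => ?_
        rw [ev_mul hc0, ev_X_some hc0, mul_comm]
        rfl
      rw [h2]
      exact (hgrad i).neg_right
  · refine (hQ x 0 hx constantCoeff_zero_fun).trans ?_
    exact funext_iff.symm

/-! ### Morse coordinates -/

/-- The constant series, as a ring homomorphism. -/
noncomputable def ofSeriesHom (n : ℕ) : PowerSeries K →+* MvPowerSeries (Option (Fin n)) K :=
  (substAlgHom hasSubst_X_none).toRingHom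

theorem ofSeriesHom_apply (c : PowerSeries K) : ofSeriesHom n c = ofSeries (Fin n) c :=
  substAlgHom_apply hasSubst_X_none c

/-- The matrix of the quadratic form that `F` defines at the origin. -/
noncomputable def quadForm (F : MvPowerSeries (Option (Fin n)) K) :
    Matrix (Fin n) (Fin n) (PowerSeries K) :=
  (quadMatrix F).map (ev 0)

theorem quadForm_transpose (F : MvPowerSeries (Option (Fin n)) K) :
    (quadForm F).transpose = quadForm F := by
  rw [quadForm, ← Matrix.transpose_map, quadMatrix_transpose]

theorem isUnit_det_quadForm [CharZero K] {F : MvPowerSeries (Option (Fin n)) K}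
    (hdet : (residueHessian F).det ≠ 0) : IsUnit (quadForm F).det := by
  rw [isUnit_det_iff]
  have e : residueHessian F = (2 : K) • (quadForm F).map PowerSeries.constantCoeff := by
    ext i j
    simp only [residueHessian, Matrix.of_apply, Matrix.smul_apply, smul_eq_mul, quadForm,
      Matrix.map_apply]
    rw [constantCoeff_ev constantCoeff_zero_fun, two_mul_constantCoeff_quadMatrix]
  rw [e, Matrix.det_smul] at hdet
  exact right_ne_zero_of_mul hdet

/-- The derivative of a series at a point depends only on the values of the series. -/
theorem ev_pderiv_congr {F G : MvPowerSeries (Option (Fin n)) K} {y : Fin n → PowerSeries K}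
    (hy : ∀ i, PowerSeries.constantCoeff (y i) = 0) (i : Fin n)
    (h : ∀ x : Fin n → PowerSeries K, (∀ i, PowerSeries.constantCoeff (x i) = 0) →
      ev x F = ev x G) : ev y (pderiv K (some i) F) = ev y (pderiv K (some i) G) := by
  refine eq_of_forall_le_X_pow_dvd 1 fun d hd => ?_
  have h0 : PowerSeries.constantCoeff (PowerSeries.X ^ d : PowerSeries K) = 0 := by
    simp [show d ≠ 0 by omega]
  have h1 := X_pow_dvd_taylor hy i h0 dvd_rfl F
  have h2 := X_pow_dvd_taylor hy i h0 dvd_rfl G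
  have hys (j : Fin n) : PowerSeries.constantCoeff
      ((y + Pi.single i (PowerSeries.X ^ d) : Fin n → PowerSeries K) j) = 0 := by
    by_cases hj : j = i
    · subst hj; simp [hy, show d ≠ 0 by omega]
    · simp [hj, hy]
  rw [h _ hys, h _ hy] at h1
  have h3 := dvd_sub h2 h1
  convert h3 using 1
  ring

/-- The residual Hessian does not change under translations by elements of `(t K[[t]])ⁿ`. -/
theorem residueHessian_translate {c : Fin n → PowerSeries K}
    (hc : ∀ i, PowerSeries.constantCoeff (c i) = 0) (F : MvPowerSeries (Option (Fin n)) K) :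
    residueHessian (translate c F) = residueHessian F := by
  have key (i j : Fin n) (y : Fin n → PowerSeries K)
      (hy : ∀ i, PowerSeries.constantCoeff (y i) = 0) :
      ev y (pderiv K (some j) (translate c F)) = ev y (translate c (pderiv K (some j) F)) := by
    rw [ev_pderiv_translate hc hy, ev_translate hc hy]
  ext i j
  simp only [residueHessian, Matrix.of_apply]
  rw [← constantCoeff_ev (constantCoeff_zero_fun (K := K)),
    ev_pderiv_congr constantCoeff_zero_fun i (key i j),
    ev_pderiv_translate hc constantCoeff_zero_fun, constantCoeff_ev (by simpa using hc)]

/-- The formal change of coordinates that diagonalises a series `G` with critical point `0`. For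
`y` near `0`, `B(y)` is characterised by an equation over `K[[t]]`, which makes it definable. -/
theorem exists_morse_matrix [CharZero K] (G : MvPowerSeries (Option (Fin n)) K)
    (hdet : (residueHessian G).det ≠ 0) :
    ∃ B : Matrix (Fin n) (Fin n) (MvPowerSeries (Option (Fin n)) K),
      (∀ i j, constantCoeff ((B - 1) i j) = 0) ∧
      ∀ y : Fin n → PowerSeries K, (∀ i, PowerSeries.constantCoeff (y i) = 0) →
        (quadMatrix G).map (ev y) = (B.map (ev y)).transpose * quadForm G * B.map (ev y) ∧
        ∀ B' : Matrix (Fin n) (Fin n) (PowerSeries K),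
          ((∀ i j, PowerSeries.constantCoeff ((B' - 1) i j) = 0) ∧
            quadForm G * (B' * B') = (quadMatrix G).map (ev y)) ↔ B' = B.map (ev y) := by
  have hV := Matrix.nonsing_inv_mul _ (isUnit_det_quadForm hdet)
  have hcc (i j : Fin n) : PowerSeries.constantCoeff (quadForm G i j) =
      constantCoeff (quadMatrix G i j) := constantCoeff_ev constantCoeff_zero_fun _
  obtain ⟨B, hB1, hB2, hB3⟩ := exists_congruence (A := quadMatrix G)
    (A₀ := (quadForm G).map (ofSeriesHom n)) (V := (quadForm G)⁻¹.map (ofSeriesHom n))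
    (quadMatrix_transpose G) (by rw [← Matrix.transpose_map, quadForm_transpose])
    (by rw [← Matrix.map_mul, hV, Matrix.map_one _ (map_zero _) (map_one _)])
    (fun i j => by
      rw [Matrix.map_apply, ofSeriesHom_apply, constantCoeff_ofSeries, hcc])
  refine ⟨B, hB1, fun y hy => ?_⟩
  obtain ⟨B₁, hB₁, hB₂, hB₃⟩ := exists_congruence (τ := Unit) (A := (quadMatrix G).map (ev y))
    (A₀ := quadForm G) (V := (quadForm G)⁻¹)
    (by rw [← Matrix.transpose_map, quadMatrix_transpose]) (quadForm_transpose G) hV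
    (fun i j => (constantCoeff_ev hy _).trans (hcc i j).symm)
  have hcong (i j : Fin n) : PowerSeries.constantCoeff ((B.map (ev y) - 1) i j) = 0 := by
    rw [← hB1 i j, ← constantCoeff_ev hy]
    congr 1
    rw [Matrix.sub_apply, Matrix.sub_apply, ev_sub hy, Matrix.map_apply]
    congr 1
    rw [← evHom_apply hy, Matrix.one_apply, Matrix.one_apply]
    split_ifs <;> simp
  have hmap : quadForm G * (B.map (ev y) * B.map (ev y)) = (quadMatrix G).map (ev y) := by
    have h1 := congrArg (fun M => M.map (evHom hy)) ((hB3 B hB1).mpr rfl)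
    have hfun : ⇑(evHom hy) = ev y := funext (evHom_apply hy)
    simp only [Matrix.map_mul, Matrix.map_map] at h1
    rw [hfun] at h1
    convert h1 using 2
    ext1 i j
    simp only [Matrix.map_apply, Function.comp_apply]
    rw [ofSeriesHom_apply, ev_ofSeries hy]
  have hBB := (hB₃ _ hcong).mp hmap
  refine ⟨by rw [hBB]; exact hB₂, fun B' => ⟨fun ⟨h1, h2⟩ => ?_, ?_⟩⟩
  · rw [hBB]
    exact (hB₃ B' h1).mp h2
  · rintro rfl
    exact ⟨hcong, hmap⟩

/-- The coordinates `P B(y) y` as power series in `y`. -/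
noncomputable def chartSeries (P : Matrix (Fin n) (Fin n) (PowerSeries K))
    (B : Matrix (Fin n) (Fin n) (MvPowerSeries (Option (Fin n)) K)) (i : Fin n) :
    MvPowerSeries (Option (Fin n)) K :=
  ∑ j, (P.map (ofSeriesHom n) * B) i j * X (some j)

variable {P : Matrix (Fin n) (Fin n) (PowerSeries K)}
  {B : Matrix (Fin n) (Fin n) (MvPowerSeries (Option (Fin n)) K)}

theorem ev_chartSeries {y : Fin n → PowerSeries K}
    (hy : ∀ i, PowerSeries.constantCoeff (y i) = 0) (i : Fin n) :
    ev y (chartSeries P B i) = (P * B.map (ev y)).mulVec y i := by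
  rw [chartSeries, ev_sum hy, Matrix.mulVec_apply_eq_sum]
  refine Finset.sum_congr rfl fun j _ => ?_
  rw [ev_mul hy, ev_X_some hy, Matrix.mul_apply, Matrix.mul_apply, ev_sum hy]
  congr 1
  refine Finset.sum_congr rfl fun l _ => ?_
  rw [ev_mul hy, Matrix.map_apply, Matrix.map_apply, ofSeriesHom_apply, ev_ofSeries hy]

/-- In the coordinates given by `chartSeries`, the series `G` is a constant plus a diagonal
quadratic form. -/
theorem ev_eq_sum_sq [CharZero K] {G : MvPowerSeries (Option (Fin n)) K}
    (hgrad : ∀ i, ev 0 (pderiv K (some i) G) = 0) {d : Fin n → PowerSeries K}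
    (hP : quadForm G = P.transpose * Matrix.diagonal d * P) {y : Fin n → PowerSeries K}
    (hy : ∀ i, PowerSeries.constantCoeff (y i) = 0)
    (hB : (quadMatrix G).map (ev y) = (B.map (ev y)).transpose * quadForm G * B.map (ev y)) :
    ev y G = ev 0 G + ∑ i, d i * ev y (chartSeries P B i) ^ 2 := by
  have h1 : ev y G = ev 0 G + y ⬝ᵥ ((quadMatrix G).map (ev y)).mulVec y := by
    conv_lhs => rw [eq_add_quadMatrix G hgrad, ev_add hy, ev_ofSeries hy, ev_sum hy]
    congr 1
    refine Finset.sum_congr rfl fun i _ => ?_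
    rw [ev_sum hy, Matrix.mulVec, dotProduct, Finset.mul_sum]
    refine Finset.sum_congr rfl fun j _ => ?_
    rw [ev_mul hy, ev_mul hy, ev_X_some hy, ev_X_some hy, Matrix.map_apply]
    ring
  rw [h1, hB, hP]
  congr 1
  have e : (B.map (ev y)).transpose * (P.transpose * Matrix.diagonal d * P) * B.map (ev y) =
      (P * B.map (ev y)).transpose * (Matrix.diagonal d * (P * B.map (ev y))) := by
    simp only [Matrix.transpose_mul, Matrix.mul_assoc]
  rw [e, ← Matrix.mulVec_mulVec, Matrix.dotProduct_mulVec, Matrix.vecMul_transpose,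
    ← Matrix.mulVec_mulVec, dotProduct]
  refine Finset.sum_congr rfl fun i _ => ?_
  rw [ev_chartSeries hy, ← Matrix.mulVec_mulVec, ← Matrix.mulVec_mulVec, Matrix.mulVec_diagonal]
  ring

theorem isUnit_det_chart (hP : IsUnit P.det) (hB : ∀ i j, constantCoeff ((B - 1) i j) = 0)
    {y : Fin n → PowerSeries K} (hy : ∀ i, PowerSeries.constantCoeff (y i) = 0) :
    IsUnit (P * B.map (ev y)).det := by
  rw [Matrix.det_mul]
  refine hP.mul ((isUnit_det_iff _).mpr ?_)
  have e : (B.map (ev y)).map PowerSeries.constantCoeff = 1 := by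
    ext i j
    have := hB i j
    rw [Matrix.sub_apply, map_sub, sub_eq_zero] at this
    rw [Matrix.map_apply, Matrix.map_apply, constantCoeff_ev hy, this, Matrix.one_apply,
      Matrix.one_apply]
    split_ifs <;> simp
  rw [e, Matrix.det_one]
  exact one_ne_zero

/-- The coordinates preserve all balls around the origin, `P B(y)` being invertible over `K[[t]]`.
-/
theorem X_pow_dvd_chartSeries_iff (hP : IsUnit P.det)
    (hB : ∀ i j, constantCoeff ((B - 1) i j) = 0)
    {y : Fin n → PowerSeries K} (hy : ∀ i, PowerSeries.constantCoeff (y i) = 0) (a : ℕ) :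
    (∀ i, PowerSeries.X ^ a ∣ ev y (chartSeries P B i)) ↔ ∀ i, PowerSeries.X ^ a ∣ y i := by
  simp only [ev_chartSeries hy]
  exact ⟨X_pow_dvd_of_mulVec (isUnit_det_chart hP hB hy),
    fun h i => by
      rw [Matrix.mulVec_apply_eq_sum]
      exact Finset.dvd_sum fun j _ => Dvd.dvd.mul_left (h j) _⟩

theorem exists_inverse_chartSeries (hP : IsUnit P.det)
    (hB : ∀ i j, constantCoeff ((B - 1) i j) = 0) :
    ∃ Q : Fin n → MvPowerSeries (Option (Fin n)) K, (∀ i, constantCoeff (Q i) = 0) ∧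
      ∀ x y : Fin n → PowerSeries K, (∀ i, PowerSeries.constantCoeff (x i) = 0) →
        (∀ i, PowerSeries.constantCoeff (y i) = 0) →
        ((∀ i, ev x (chartSeries P B i) = y i) ↔ ∀ i, x i = ev y (Q i)) := by
  refine exists_inverse_series _ (fun i => by simp [chartSeries]) ?_
  have e : (Matrix.of fun i j => coeff (Finsupp.single (some j) 1) (chartSeries P B i)) =
      P.map PowerSeries.constantCoeff := by
    ext i j
    have hterm (l : Fin n) : coeff (Finsupp.single (some j) 1)
        ((P.map (ofSeriesHom n) * B) i l * X (some l)) =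
        if l = j then constantCoeff ((P.map (ofSeriesHom n) * B) i l) else 0 := by
      rw [coeff_single_some, Derivation.leibniz]
      by_cases hl : l = j <;> simp [hl]
    rw [Matrix.of_apply, chartSeries, map_sum]
    simp only [hterm, Finset.sum_ite_eq', Finset.mem_univ, if_true]
    have h1 : P.map (ofSeriesHom n) * B =
        P.map (ofSeriesHom n) + P.map (ofSeriesHom n) * (B - 1) := by
      rw [Matrix.mul_sub, Matrix.mul_one]; abel
    rw [h1, Matrix.add_apply, map_add, constantCoeff_mul_left hB, add_zero, Matrix.map_apply,
      Matrix.map_apply, ofSeriesHom_apply, constantCoeff_ofSeries]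
  rw [e, isUnit_iff_ne_zero]
  exact (isUnit_det_iff P).mp hP

end MorseChart

section DefinableChart

open MvPowerSeries

/-! ### Definability of the critical point and of the Morse coordinates -/

variable {k : Type u} [Field k] {L : DenefPas k} {n : ℕ}
  {a : ∀ (K : Type u) [Field K] [Algebra k K], ℕ}

theorem IsDefinableFun.at_zero (hD : IsDefinableRel L (ball n a))
    {g : ∀ (K : Type u) [Field K] [Algebra k K], (Fin n → PowerSeries K) → PowerSeries K}
    (hg : IsDefinableFun L (ball n a) g) : IsDefinableFun L (ball n a) fun K _ _ _ => g K 0 :=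
  IsDefinableFun.comp hD hg (g := fun _ _ _ _ _ => 0)
    (fun _ => by simpa using (IsTermFun.intCast 0).isDefinableFun hD)
    fun _ _ _ _ _ _ => dvd_zero _

theorem ball_zero {K : Type u} [Field K] [Algebra k K] : ball n a K 0 := fun _ => dvd_zero _

variable (hD : IsDefinableRel L (ball n a)) (ha : ∀ (K : Type u) [Field K] [Algebra k K], 1 ≤ a K)
  {F : ∀ (K : Type u) [Field K] [Algebra k K], MvPowerSeries (Option (Fin n)) K}
  (hF : IsDefinableFun L (ball n a) fun K _ _ p => ev p (F K))

include hD ha hF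

theorem isDefinableFun_ev_quadMatrix [CharZero k] (i j : Fin n) :
    IsDefinableFun L (ball n a) fun K _ _ p => ev p (quadMatrix (F K) i j) := by
  have h1 (i j : Fin n) : IsDefinableFun L (ball n a) fun K _ _ p =>
      ev p (divVar j (divVar i (F K))) :=
    isDefinableFun_ev_divVar hD ha (isDefinableFun_ev_divVar hD ha hF i) j
  have h2 : IsDefinableFun L (ball n a) fun K _ _ _ =>
      PowerSeries.map (algebraMap k K) (PowerSeries.C (1 / 2)) :=
    (IsTermFun.const (PowerSeries.C (1 / 2))).isDefinableFun hD
  refine (h2.mul hD ((h1 i j).add hD (h1 j i))).congr fun K _ _ p hp => ?_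
  have : CharZero K := charZero_of_injective_algebraMap (algebraMap k K).injective
  have hp0 := hp.constantCoeff ha
  rw [quadMatrix, Matrix.of_apply, ev_mul hp0, ev_add hp0]
  congr 1
  -- both sides are inverse to `2`
  have e1 : (2 : PowerSeries K) * ev p (C (1 / 2)) = 1 := by
    have := congrArg (evHom hp0) (two_mul_C_half (K := K) (σ := Option (Fin n)))
    rwa [map_mul, map_ofNat, map_one, evHom_apply] at this
  have e2 : (2 : PowerSeries K) * PowerSeries.map (algebraMap k K) (PowerSeries.C (1 / 2)) = 1 := by
    have := congrArg (PowerSeries.map (algebraMap k K)) (two_mul_C_half (K := k) (σ := Unit))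
    rwa [map_mul, map_ofNat, map_one] at this
  exact (isUnit_two_powerSeries (k := k) K).mul_left_cancel (e1.trans e2.symm)

/-- The critical point is definable, as the only zero of the gradient in the ball. -/
theorem exists_definable_critical_point
    (hgrad : ∀ (K : Type u) [Field K] [Algebra k K] (i : Fin n),
      PowerSeries.X ^ a K ∣ ev 0 (pderiv K (some i) (F K)))
    (hdet : ∀ (K : Type u) [Field K] [Algebra k K], (residueHessian (F K)).det ≠ 0) :
    ∃ c : ∀ (K : Type u) [Field K] [Algebra k K], Fin n → PowerSeries K,
      (∀ j, IsDefinableFun L (ball n a) fun K _ _ _ => c K j) ∧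
      (∀ (K : Type u) [Field K] [Algebra k K], ball n a K (c K)) ∧
      ∀ (K : Type u) [Field K] [Algebra k K] (x : Fin n → PowerSeries K), ball n a K x →
        ((∀ i, ev x (pderiv K (some i) (F K)) = 0) ↔ x = c K) := by
  have h0 (K : Type u) [Field K] [Algebra k K] :=
    exists_critical_point (ha K) (F K) (hgrad K) (hdet K)
  let c (K : Type u) [Field K] [Algebra k K] : Fin n → PowerSeries K := (h0 K).choose
  have hcD (K : Type u) [Field K] [Algebra k K] : ball n a K (c K) := (h0 K).choose_spec.1
  have hc (K : Type u) [Field K] [Algebra k K] (x : Fin n → PowerSeries K) (hx : ball n a K x) :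
      (∀ i, ev x (pderiv K (some i) (F K)) = 0) ↔ x = c K :=
    (h0 K).choose_spec.2 x (hx.constantCoeff ha)
  refine ⟨c, ?_, hcD, hc⟩
  have hD' : IsDefinableRel L fun K _ _ (q : Fin n ⊕ Fin n → PowerSeries K) =>
    ball n a K (q ∘ Sum.inr) := hD.comap Sum.inr
  have h1 := hD'.and (IsDefinableRel.forall_finite fun i : Fin n => IsDefinableFun.eq hD'
    ((isDefinableFun_ev_pderiv hD ha hF i).comap Sum.inr)
    ((IsTermFun.intCast 0).isDefinableFun hD'))
  refine IsDefinableFun.of_rel_tuple hD h1 (g := fun j K _ _ _ => c K j) fun K _ _ p hp y => ?_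
  have e : (Sum.elim p y) ∘ Sum.inr = y := rfl
  simp only [e, Int.cast_zero]
  constructor
  · rintro ⟨hy, h⟩
    exact (hc K y hy).mp fun i => (h i).2
  · rintro rfl
    exact ⟨hcD K, fun i => ⟨hcD K, (hc K _ (hcD K)).mpr rfl i⟩⟩

/-- The values of the matrix `B` are definable, as the only solutions congruent to `1` of the
equation `A(0) B(p) ^ 2 = A(p)` over `K[[t]]`. -/
theorem exists_definable_morse_matrix [CharZero k]
    (hdet : ∀ (K : Type u) [Field K] [Algebra k K], (residueHessian (F K)).det ≠ 0) :
    ∃ B : ∀ (K : Type u) [Field K] [Algebra k K],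
        Matrix (Fin n) (Fin n) (MvPowerSeries (Option (Fin n)) K),
      (IsDefinableMatrix L (ball n a) fun K _ _ p => (B K).map (ev p)) ∧
      ∀ (K : Type u) [Field K] [Algebra k K],
        (∀ i j, constantCoeff ((B K - 1) i j) = 0) ∧
        ∀ y : Fin n → PowerSeries K, (∀ i, PowerSeries.constantCoeff (y i) = 0) →
          (quadMatrix (F K)).map (ev y) =
            ((B K).map (ev y)).transpose * quadForm (F K) * (B K).map (ev y) := by
  have h0 (K : Type u) [Field K] [Algebra k K] :=
    have : CharZero K := charZero_of_injective_algebraMap (algebraMap k K).injective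
    exists_morse_matrix (F K) (hdet K)
  let B (K : Type u) [Field K] [Algebra k K] :
    Matrix (Fin n) (Fin n) (MvPowerSeries (Option (Fin n)) K) := (h0 K).choose
  have hB (K : Type u) [Field K] [Algebra k K] := (h0 K).choose_spec
  refine ⟨B, ?_, fun K _ _ => ⟨(hB K).1, fun y hy => ((hB K).2 y hy).1⟩⟩
  have hA (i j : Fin n) := isDefinableFun_ev_quadMatrix hD ha hF i j
  -- the variables `Sum.inr (i, j)` stand for the entries of a matrix
  let Ω := Fin n ⊕ (Fin n × Fin n)
  have hD' : IsDefinableRel L fun K _ _ (q : Ω → PowerSeries K) =>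
    ball n a K (q ∘ Sum.inl) := hD.comap Sum.inl
  have hvar (i j : Fin n) : IsDefinableFun L (fun K _ _ (q : Ω → PowerSeries K) =>
      ball n a K (q ∘ Sum.inl)) fun K _ _ q => q (Sum.inr (i, j)) :=
    (IsTermFun.var (Sum.inr (i, j))).isDefinableFun hD'
  have h1 := IsDefinableRel.forall_finite fun w : Fin n × Fin n =>
    (((hvar w.1 w.2).sub hD' ((IsTermFun.intCast ((1 : Matrix (Fin n) (Fin n) ℤ) w.1 w.2)
      ).isDefinableFun hD')).isUnit hD').not
  have h2 := IsDefinableRel.forall_finite fun w : Fin n × Fin n => IsDefinableFun.eq hD'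
    (IsDefinableFun.sum hD' Finset.univ fun l _ => ((hA w.1 l).at_zero hD |>.comap Sum.inl).mul hD'
      (IsDefinableFun.sum hD' Finset.univ fun m _ => (hvar l m).mul hD' (hvar m w.2)))
    ((hA w.1 w.2).comap Sum.inl)
  intro i j
  refine IsDefinableFun.of_rel_tuple hD (h1.and h2)
    (g := fun w K _ _ p => ev p (B K w.1 w.2)) (fun K _ _ p hp y => ?_) (i, j)
  have e : (Sum.elim p y) ∘ Sum.inl = p := rfl
  simp only [e, hp, true_and, Sum.elim_inr]
  have hp0 := hp.constantCoeff ha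
  have h3 := ((hB K).2 p hp0).2 (Matrix.of fun i j => y (i, j))
  have h4 : (y = fun w => ev p (B K w.1 w.2)) ↔
      (Matrix.of fun i j => y (i, j)) = (B K).map (ev p) := by
    rw [funext_iff, ← Matrix.ext_iff, Prod.forall]
    rfl
  rw [h4, ← h3]
  refine and_congr ?_ ?_
  · rw [Prod.forall]
    refine forall_congr' fun i => forall_congr' fun j => ?_
    rw [PowerSeries.isUnit_iff_constantCoeff, isUnit_iff_ne_zero, not_not, Matrix.sub_apply,
      Matrix.of_apply, Matrix.one_apply, Matrix.one_apply]
    split_ifs <;> simp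
  · rw [← Matrix.ext_iff, Prod.forall]
    refine forall_congr' fun i => forall_congr' fun j => ?_
    simp only [Matrix.mul_apply, Matrix.of_apply, Matrix.map_apply, quadForm]

/-- The quadratic form at the origin is diagonalised by definable constants. These are encoded as
constant definable functions on the ball. -/
theorem exists_definable_diagonal_form [CharZero k]
    (hdet : ∀ (K : Type u) [Field K] [Algebra k K], (residueHessian (F K)).det ≠ 0) :
    ∃ (P : ∀ (K : Type u) [Field K] [Algebra k K], Matrix (Fin n) (Fin n) (PowerSeries K))
      (d : ∀ (K : Type u) [Field K] [Algebra k K], Fin n → PowerSeries K),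
      (IsDefinableMatrix L (ball n a) fun K _ _ _ => P K) ∧
      (∀ i, IsDefinableFun L (ball n a) fun K _ _ _ => d K i) ∧
      ∀ (K : Type u) [Field K] [Algebra k K], IsUnit (P K).det ∧ (∀ i, IsUnit (d K i)) ∧
        quadForm (F K) = (P K).transpose * Matrix.diagonal (d K) * P K := by
  obtain ⟨P, d, hP, hd, H⟩ := hasDefinableDiagonalization (L := L) (Fin n) n (ball n a)
    (fun K _ _ _ => quadForm (F K)) hD
    (fun i j => (isDefinableFun_ev_quadMatrix hD ha hF i j).at_zero hD)
    (fun K _ _ _ _ => by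
      have : CharZero K := charZero_of_injective_algebraMap (algebraMap k K).injective
      exact ⟨quadForm_transpose _, isUnit_det_quadForm (hdet K)⟩)
  refine ⟨fun K _ _ => P K 0, fun K _ _ i => d i K 0, fun i j => (hP i j).at_zero hD,
    fun i => (hd i).at_zero hD, fun K _ _ => ?_⟩
  have : CharZero K := charZero_of_injective_algebraMap (algebraMap k K).injective
  have h1 := H K 0 ball_zero
  have h2 := isUnit_det_quadForm (hdet K)
  rw [h1, Matrix.det_mul, Matrix.det_mul, Matrix.det_diagonal, IsUnit.mul_iff, IsUnit.mul_iff] at h2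
  exact ⟨h2.2, fun i => (IsUnit.prod_univ_iff.mp h2.1.2) i, h1⟩

end DefinableChart

section DefinableChart

open MvPowerSeries

variable {k : Type u} [Field k] {L : DenefPas k} {n : ℕ}
  {a : ∀ (K : Type u) [Field K] [Algebra k K], ℕ}
variable (hD : IsDefinableRel L (ball n a)) (ha : ∀ (K : Type u) [Field K] [Algebra k K], 1 ≤ a K)
  {F : ∀ (K : Type u) [Field K] [Algebra k K], MvPowerSeries (Option (Fin n)) K}
  (hF : IsDefinableFun L (ball n a) fun K _ _ p => ev p (F K))

include hD

/-- The compositional inverse of a definable self-map of a ball is definable: its graph is the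
transposed graph. -/
theorem IsDefinableFun.of_inverse {T S : ∀ (K : Type u) [Field K] [Algebra k K],
      (Fin n → PowerSeries K) → Fin n → PowerSeries K}
    (hT : ∀ i, IsDefinableFun L (ball n a) fun K _ _ p => T K p i)
    (hS : ∀ (K : Type u) [Field K] [Algebra k K] (p : Fin n → PowerSeries K),
      ball n a K p → ball n a K (S K p))
    (hST : ∀ (K : Type u) [Field K] [Algebra k K] (p : Fin n → PowerSeries K),
      ball n a K p → S K (T K p) = p)
    (hTS : ∀ (K : Type u) [Field K] [Algebra k K] (p : Fin n → PowerSeries K),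
      ball n a K p → T K (S K p) = p) (i : Fin n) :
    IsDefinableFun L (ball n a) fun K _ _ p => S K p i := by
  have hD' : IsDefinableRel L fun K _ _ (q : Fin n ⊕ Fin n → PowerSeries K) =>
    ball n a K (q ∘ Sum.inr) := hD.comap Sum.inr
  have h1 := hD'.and (IsDefinableRel.forall_finite fun i : Fin n => IsDefinableFun.eq hD'
    ((hT i).comap Sum.inr) ((IsTermFun.var (Sum.inl i)).isDefinableFun hD'))
  refine IsDefinableFun.of_rel_tuple hD h1 (g := fun j K _ _ p => S K p j)
    (fun K _ _ p hp y => ?_) i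
  have e : (Sum.elim p y) ∘ Sum.inr = y := rfl
  simp only [e, Sum.elim_inl]
  constructor
  · rintro ⟨hy, h⟩
    rw [← hST K y hy, funext fun i => (h i).2]
  · rintro rfl
    have hy := hS K p hp
    exact ⟨hy, fun i => ⟨hy, congrFun (hTS K p hp) i⟩⟩

include ha hF

/-- The Morse lemma at the level of points with coordinates in `K[[t]]`: the coordinates are
`T(x) = P B(x - c) (x - c)`, where `P` diagonalises the quadratic form at the critical point `c`. -/
theorem exists_definable_morse_chart [CharZero k]
    (hgrad : ∀ (K : Type u) [Field K] [Algebra k K] (i : Fin n),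
      PowerSeries.X ^ a K ∣ ev 0 (pderiv K (some i) (F K)))
    (hdet : ∀ (K : Type u) [Field K] [Algebra k K], (residueHessian (F K)).det ≠ 0) :
    ∃ (c d : ∀ (K : Type u) [Field K] [Algebra k K], Fin n → PowerSeries K)
      (T S : ∀ (K : Type u) [Field K] [Algebra k K], Fin n → MvPowerSeries (Option (Fin n)) K),
      (∀ j, IsDefinableFun L (ball n a) fun K _ _ _ => c K j) ∧
      (∀ j, IsDefinableFun L (ball n a) fun K _ _ _ => d K j) ∧
      (∀ j, IsDefinableFun L (ball n a) fun K _ _ p => ev p (T K j)) ∧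
      (∀ j, IsDefinableFun L (ball n a) fun K _ _ p => ev p (S K j)) ∧
      ∀ (K : Type u) [Field K] [Algebra k K],
        ball n a K (c K) ∧ (∀ j, IsUnit (d K j)) ∧ (∀ j, ev (c K) (T K j) = 0) ∧
        ∀ p : Fin n → PowerSeries K, ball n a K p →
          ((∀ i, ev p (pderiv K (some i) (F K)) = 0) ↔ p = c K) ∧
          ball n a K (fun j => ev p (T K j)) ∧ ball n a K (fun j => ev p (S K j)) ∧
          (∀ i, ev (fun j => ev p (T K j)) (S K i) = p i) ∧
          (∀ i, ev (fun j => ev p (S K j)) (T K i) = p i) ∧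
          ev p (F K) = ev (c K) (F K) + ∑ i, d K i * ev p (T K i) ^ 2 := by
  obtain ⟨c, hc, hcD, hcrit⟩ := exists_definable_critical_point hD ha hF hgrad hdet
  have hc0 (K : Type u) [Field K] [Algebra k K] (i : Fin n) := (hcD K).constantCoeff ha i
  let G (K : Type u) [Field K] [Algebra k K] : MvPowerSeries (Option (Fin n)) K :=
    translate (c K) (F K)
  have hG : IsDefinableFun L (ball n a) fun K _ _ p => ev p (G K) :=
    isDefinableFun_ev_translate hD ha hF hc hcD
  have hGdet (K : Type u) [Field K] [Algebra k K] : (residueHessian (G K)).det ≠ 0 := by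
    rw [residueHessian_translate (hc0 K)]
    exact hdet K
  have hGgrad (K : Type u) [Field K] [Algebra k K] (i : Fin n) :
      ev 0 (pderiv K (some i) (G K)) = 0 := by
    rw [ev_pderiv_translate (hc0 K) constantCoeff_zero_fun, add_zero]
    exact (hcrit K _ (hcD K)).mpr rfl i
  obtain ⟨B, hBdef, hB⟩ := exists_definable_morse_matrix hD ha hG hGdet
  obtain ⟨P, d, hPdef, hd, hP⟩ := exists_definable_diagonal_form hD ha hG hGdet
  have hQ (K : Type u) [Field K] [Algebra k K] :=
    exists_inverse_chartSeries (hP K).1 (hB K).1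
  choose Q hQ0 hQ using hQ
  let T (K : Type u) [Field K] [Algebra k K] (i : Fin n) : MvPowerSeries (Option (Fin n)) K :=
    translate (-c K) (chartSeries (P K) (B K) i)
  let S (K : Type u) [Field K] [Algebra k K] (i : Fin n) : MvPowerSeries (Option (Fin n)) K :=
    ofSeries (Fin n) (c K i) + Q K i
  have hsub (K : Type u) [Field K] [Algebra k K] (p : Fin n → PowerSeries K)
      (hp : ball n a K p) : ball n a K (-c K + p) := fun i => dvd_add (hcD K i).neg_right (hp i)
  have hTev (K : Type u) [Field K] [Algebra k K] (p : Fin n → PowerSeries K)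
      (hp : ball n a K p) (i : Fin n) :
      ev p (T K i) = ev (-c K + p) (chartSeries (P K) (B K) i) :=
    ev_translate (fun i => by simp [hc0]) (hp.constantCoeff ha) _
  have hSev (K : Type u) [Field K] [Algebra k K] (p : Fin n → PowerSeries K)
      (hp : ball n a K p) (i : Fin n) : ev p (S K i) = c K i + ev p (Q K i) := by
    rw [ev_add (hp.constantCoeff ha), ev_ofSeries (hp.constantCoeff ha)]
  have hTD (K : Type u) [Field K] [Algebra k K] (p : Fin n → PowerSeries K)
      (hp : ball n a K p) : ball n a K (fun j => ev p (T K j)) := by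
    intro j
    beta_reduce
    rw [hTev K p hp]
    exact (X_pow_dvd_chartSeries_iff (hP K).1 (hB K).1 ((hsub K p hp).constantCoeff ha) _).mpr
      (hsub K p hp) j
  have hQc (K : Type u) [Field K] [Algebra k K] (p : Fin n → PowerSeries K)
      (hp : ball n a K p) (i : Fin n) : PowerSeries.constantCoeff (ev p (Q K i)) = 0 :=
    (constantCoeff_ev (hp.constantCoeff ha) _).trans (hQ0 K i)
  have hQT (K : Type u) [Field K] [Algebra k K] (p : Fin n → PowerSeries K)
      (hp : ball n a K p) (i : Fin n) :
      ev (fun i => ev p (Q K i)) (chartSeries (P K) (B K) i) = p i :=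
    (hQ K _ p (hQc K p hp) (hp.constantCoeff ha)).mpr (fun _ => rfl) i
  have hSD (K : Type u) [Field K] [Algebra k K] (p : Fin n → PowerSeries K)
      (hp : ball n a K p) : ball n a K (fun j => ev p (S K j)) := by
    intro j
    beta_reduce
    rw [hSev K p hp]
    refine dvd_add (hcD K j) ((X_pow_dvd_chartSeries_iff (hP K).1 (hB K).1 (hQc K p hp) _).mp
      (fun i => ?_) j)
    rw [hQT K p hp]
    exact hp i
  have hST (K : Type u) [Field K] [Algebra k K] (p : Fin n → PowerSeries K)
      (hp : ball n a K p) (i : Fin n) : ev (fun j => ev p (T K j)) (S K i) = p i := by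
    have h1 := (hQ K (-c K + p) (fun j => ev p (T K j)) ((hsub K p hp).constantCoeff ha)
      ((hTD K p hp).constantCoeff ha)).mp (fun i => (hTev K p hp i).symm) i
    rw [hSev K _ (hTD K p hp), ← h1]
    simp
  have hTS (K : Type u) [Field K] [Algebra k K] (p : Fin n → PowerSeries K)
      (hp : ball n a K p) (i : Fin n) : ev (fun j => ev p (S K j)) (T K i) = p i := by
    rw [hTev K _ (hSD K p hp), ← hQT K p hp i]
    congr 1
    funext j
    rw [Pi.add_apply, hSev K p hp]
    simp
  have hTdef (i : Fin n) : IsDefinableFun L (ball n a) fun K _ _ p => ev p (T K i) := by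
    have hy (j : Fin n) : IsDefinableFun L (ball n a) fun K _ _ p => - c K j + p j :=
      ((hc j).neg hD).add hD ((IsTermFun.var j).isDefinableFun hD)
    have hBy : IsDefinableMatrix L (ball n a) fun K _ _ p => (B K).map (ev (-c K + p)) :=
      fun i j => IsDefinableFun.comp hD (hBdef i j) hy hsub
    refine (IsDefinableFun.sum hD Finset.univ fun j _ =>
      (hPdef.mul hD hBy i j).mul hD (hy j)).congr fun K _ _ p hp => ?_
    rw [hTev K p hp, ev_chartSeries ((hsub K p hp).constantCoeff ha), Matrix.mulVec_apply_eq_sum]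
    rfl
  refine ⟨c, d, T, S, hc, hd, hTdef, ?_, fun K _ _ => ⟨hcD K, (hP K).2.1, fun j => ?_,
    fun p hp => ⟨hcrit K p hp, hTD K p hp, hSD K p hp, hST K p hp, hTS K p hp, ?_⟩⟩⟩
  · exact IsDefinableFun.of_inverse hD (T := fun K _ _ p j => ev p (T K j)) hTdef hSD
      (fun K _ _ p hp => funext (hST K p hp)) (fun K _ _ p hp => funext (hTS K p hp))
  · rw [hTev K _ (hcD K), neg_add_cancel, ev_chartSeries constantCoeff_zero_fun, Matrix.mulVec_zero]
    rfl
  · have : CharZero K := charZero_of_injective_algebraMap (algebraMap k K).injective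
    have hy0 := (hsub K p hp).constantCoeff ha
    have h1 := ev_eq_sum_sq (hGgrad K) (hP K).2.2 hy0 ((hB K).2 _ hy0)
    rw [ev_translate (hc0 K) hy0, ev_translate (hc0 K) constantCoeff_zero_fun, add_zero,
      add_neg_cancel_left] at h1
    simp only [hTev K p hp]
    exact h1

end DefinableChart

section IntegralPoints

open MvPowerSeries

/-! ### Definable morphisms between sets of integral points -/

variable {k : Type u} [Field k] {L : DenefPas k}

theorem integralPoint_injective {m : ℕ} {K : Type u} [Field K] :
    Function.Injective (integralPoint : (Fin m → PowerSeries K) → HPoint m 0 0 K) := by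
  intro p q h
  funext i
  exact coe_injective (congrFun (congrArg HPoint.vf h) i)

theorem eq_integralPoint {m : ℕ} {K : Type u} [Field K] {x : HPoint m 0 0 K}
    {p : Fin m → PowerSeries K} (h : ∀ i, (p i : LaurentSeries K) = x.vf i) :
    x = integralPoint p := by
  ext i
  · rw [← h i]; rfl
  · exact i.elim0
  · exact i.elim0

theorem append_integralPoint {m n : ℕ} {K : Type u} [Field K] (p : Fin m → PowerSeries K)
    (q : Fin n → PowerSeries K) :
    (integralPoint p).append (integralPoint q) = integralPoint (Fin.append p q) := by
  refine eq_integralPoint fun i => ?_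
  refine Fin.addCases (fun i => ?_) (fun i => ?_) i <;> simp [HPoint.append, integralPoint]

theorem IsDefinable.isDefinableRel {m : ℕ} {X : Subassignment k m 0 0} (hX : IsDefinable L X) :
    IsDefinableRel L fun K _ _ p => integralPoint p ∈ X K := by
  obtain ⟨φ, hφ⟩ := hX
  exact fun _ σ => ⟨φ.rename σ, fun K _ _ p => (φ.realize_rename σ _).trans (hφ K _).symm⟩

/-- The formula expressing that the variables in a list have nonnegative valuation. -/
def Formula.allIntegral {n l r : ℕ} : List (Fin n) → Formula L n l r
  | [] => .vgEq .zero .zero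
  | i :: is => .and (.vgLe .zero (.ord (.var i))) (Formula.allIntegral is)

theorem Formula.realize_allIntegral {n l r : ℕ} {K : Type u} [Field K] [Algebra k K]
    (is : List (Fin n)) (p : HPoint n l r K) :
    (Formula.allIntegral (L := L) is).Realize p ↔ ∀ i ∈ is, 0 ≤ (p.vf i).order := by
  induction is with
  | nil => simp [Formula.allIntegral, Formula.Realize]
  | cons i is ih =>
    simp only [Formula.allIntegral, Formula.Realize, VGTerm.eval, VFTerm.eval, ih,
      List.forall_mem_cons]

theorem IsDefinableRel.isDefinable {m : ℕ} {R : ∀ (K : Type u) [Field K] [Algebra k K],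
    (Fin m → PowerSeries K) → Prop} (hR : IsDefinableRel L R) :
    IsDefinable L (n := m) (l := 0) (r := 0)
      fun K _ _ => {x | ∃ p, R K p ∧ x = integralPoint p} := by
  obtain ⟨φ, hφ⟩ := hR m id
  refine ⟨.and (Formula.allIntegral (List.finRange m)) φ, fun K _ _ x => ?_⟩
  simp only [Formula.Realize, Formula.realize_allIntegral, List.mem_finRange, true_implies,
    ← exists_coe_eq_iff_order_nonneg, Set.mem_ofPred_eq]
  constructor
  · rintro ⟨p, hp, rfl⟩
    exact ⟨fun i => ⟨p i, rfl⟩, (hφ K p).mpr hp⟩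
  · rintro ⟨h, hx⟩
    choose p hp using h
    obtain rfl := eq_integralPoint hp
    exact ⟨p, (hφ K p).mp hx, rfl⟩

/-- Definable functions on `K[[t]]` define definable morphisms. -/
theorem exists_defMor {n m : ℕ} {D : ∀ (K : Type u) [Field K] [Algebra k K],
      (Fin n → PowerSeries K) → Prop} {X : Subassignment k n 0 0} {Y : Subassignment k m 0 0}
    (hX : ∀ (K : Type u) [Field K] [Algebra k K] (x : HPoint n 0 0 K),
      x ∈ X K ↔ ∃ p, D K p ∧ x = integralPoint p)
    {g : Fin m → ∀ (K : Type u) [Field K] [Algebra k K], (Fin n → PowerSeries K) → PowerSeries K}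
    (hD : IsDefinableRel L D) (hg : ∀ j, IsDefinableFun L D (g j))
    (hY : ∀ (K : Type u) [Field K] [Algebra k K] (p : Fin n → PowerSeries K), D K p →
      integralPoint (fun j => g j K p) ∈ Y K) :
    ∃ T : DefMor L X Y, ∀ (K : Type u) [Field K] [Algebra k K] (p : Fin n → PowerSeries K)
      (hp : integralPoint p ∈ X K),
      (T.app K ⟨integralPoint p, hp⟩).1 = integralPoint fun j => g j K p := by
  let pt (K : Type u) [Field K] [Algebra k K] (x : X K) : Fin n → PowerSeries K :=
    ((hX K x.1).mp x.2).choose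
  have hpt (K : Type u) [Field K] [Algebra k K] (x : X K) :
    D K (pt K x) ∧ x.1 = integralPoint (pt K x) := ((hX K x.1).mp x.2).choose_spec
  have hpt' (K : Type u) [Field K] [Algebra k K] (p : Fin n → PowerSeries K)
      (hp : integralPoint p ∈ X K) : pt K ⟨integralPoint p, hp⟩ = p :=
    integralPoint_injective (hpt K ⟨_, hp⟩).2.symm
  have hgraph : IsDefinableRel L fun K _ _ (q : Fin (n + m) → PowerSeries K) =>
      ∀ j : Fin m, D K (q ∘ Fin.castAdd m) ∧ q (Fin.natAdd n j) = g j K (q ∘ Fin.castAdd m) :=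
    IsDefinableRel.forall_finite fun j => IsDefinableRel.comap (hg j)
      (fun o : Option (Fin n) => o.elim (Fin.natAdd n j) (Fin.castAdd m))
  have hgraph := (IsDefinableRel.comap hD (Fin.castAdd m)).and hgraph
  refine ⟨⟨fun K _ _ x => ⟨integralPoint fun j => g j K (pt K x), hY K _ (hpt K x).1⟩, ?_⟩, ?_⟩
  · obtain ⟨φ, hφ⟩ := hgraph.isDefinable
    refine ⟨φ, fun K _ _ x => ?_⟩
    rw [← hφ]
    constructor
    · rintro ⟨x, rfl⟩
      refine ⟨Fin.append (pt K x) fun j => g j K (pt K x), ?_, ?_⟩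
      · have e : (Fin.append (pt K x) fun j => g j K (pt K x)) ∘ Fin.castAdd m = pt K x := by
          funext i; simp
        rw [e]
        exact ⟨(hpt K x).1, fun j => ⟨(hpt K x).1, by simp⟩⟩
      · rw [← append_integralPoint]
        exact congrArg (fun y => HPoint.append y _) (hpt K x).2
    · rintro ⟨q, ⟨hq, hq'⟩, rfl⟩
      have hx : integralPoint (q ∘ Fin.castAdd m) ∈ X K := (hX K _).mpr ⟨_, hq, rfl⟩
      refine ⟨⟨_, hx⟩, ?_⟩
      simp only [hpt', append_integralPoint]
      congr 1
      funext i
      refine Fin.addCases (fun i => by simp) (fun j => ?_) i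
      rw [Fin.append_right]
      exact (hq' j).2
  · intro K _ _ p hp
    beta_reduce
    simp only [hpt']

end IntegralPoints

section IntegralPoints

open MvPowerSeries

variable {k : Type u} [Field k] {L : DenefPas k}

/-- A tuple of constant definable functions on a ball gives a definable constant. -/
theorem exists_defConst {n m : ℕ} {a : ∀ (K : Type u) [Field K] [Algebra k K], ℕ}
    {c : ∀ (K : Type u) [Field K] [Algebra k K], Fin m → PowerSeries K}
    {Y : Subassignment k m 0 0}
    (hc : ∀ j, IsDefinableFun L (ball n a) fun K _ _ _ => c K j)
    (hY : ∀ (K : Type u) [Field K] [Algebra k K], integralPoint (c K) ∈ Y K) :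
    ∃ c' : DefConst L Y, ∀ (K : Type u) [Field K] [Algebra k K],
      (c'.val K).1 = integralPoint (c K) := by
  obtain ⟨T, hT⟩ := exists_defMor (L := L) (n := 0) (D := fun _ _ _ _ => True) (X := full k 0 0 0)
    (g := fun j K _ _ _ => c K j)
    (fun K _ _ x => ⟨fun _ => ⟨Fin.elim0, trivial, eq_integralPoint fun i => i.elim0⟩,
      fun _ => trivial⟩) IsDefinableRel.true
    (fun j => IsDefinableFun.comp IsDefinableRel.true (hc j) (g := fun _ _ _ _ _ => 0)
      (fun _ => by simpa using (IsTermFun.intCast 0).isDefinableFun IsDefinableRel.true)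
      fun K _ _ _ _ _ => dvd_zero _)
    (fun K _ _ _ _ => hY K)
  refine ⟨T, fun K _ _ => ?_⟩
  rw [← hT K Fin.elim0 trivial, DefMor.val]
  congr 2
  exact Subtype.ext (eq_integralPoint fun i => i.elim0)

theorem DefMor.ext_val {n l r : ℕ} {Y : Subassignment k n l r} {c c' : DefConst L Y}
    (h : ∀ (K : Type u) [Field K] [Algebra k K], c.val K = c'.val K) : c = c' := by
  rcases c with ⟨f, hf⟩
  rcases c' with ⟨f', hf'⟩
  congr 1
  funext K _ _ x
  have hx : x = ⟨⟨Fin.elim0, Fin.elim0, Fin.elim0⟩, trivial⟩ := by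
    refine Subtype.ext (HPoint.ext ?_ ?_ ?_) <;> exact funext fun i => i.elim0
  rw [hx]
  exact h K

theorem append_eq_iff {n m : ℕ} {K : Type u} [Field K] (p p' : HPoint n 0 0 K)
    (q q' : HPoint m 0 0 K) : p.append q = p'.append q' ↔ p = p' ∧ q = q' := by
  constructor
  · intro h
    have h1 := congrArg HPoint.vf h
    refine ⟨HPoint.ext (funext fun i => ?_) (funext fun i => i.elim0) (funext fun i => i.elim0),
      HPoint.ext (funext fun i => ?_) (funext fun i => i.elim0) (funext fun i => i.elim0)⟩
    · simpa [HPoint.append] using congrFun h1 (Fin.castAdd m i)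
    · simpa [HPoint.append] using congrFun h1 (Fin.natAdd n i)
  · rintro ⟨rfl, rfl⟩; rfl

/-- A definable morphism with values in `𝒪` defined on a set of integral points is given by a
definable function. -/
theorem DefMor.isDefinableFun {n : ℕ} {D : ∀ (K : Type u) [Field K] [Algebra k K],
      (Fin n → PowerSeries K) → Prop} {X : Subassignment k n 0 0} {Y : Subassignment k 1 0 0}
    (hX : ∀ (K : Type u) [Field K] [Algebra k K] (x : HPoint n 0 0 K),
      x ∈ X K ↔ ∃ p, D K p ∧ x = integralPoint p) (f : DefMor L X Y)
    {g : ∀ (K : Type u) [Field K] [Algebra k K], (Fin n → PowerSeries K) → PowerSeries K}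
    (hfg : ∀ (K : Type u) [Field K] [Algebra k K] (p : Fin n → PowerSeries K)
      (hp : integralPoint p ∈ X K),
      (f.app K ⟨integralPoint p, hp⟩).1 = integralPoint fun _ => g K p) :
    IsDefinableRel L D ∧ IsDefinableFun L D g := by
  have h1 : IsDefinableRel L fun K _ _ (q : Fin (n + 1) → PowerSeries K) =>
      ∃ x : X K, integralPoint q = x.1.append (f.app K x).1 :=
    IsDefinable.isDefinableRel f.definable_graph
  have h2 : IsDefinableFun L D g := by
    refine (h1.comap (Fin.append some fun _ => none)).congr fun K _ _ q => ?_
    have e : q ∘ (Fin.append some fun _ : Fin 1 => none) =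
        Fin.append (q ∘ some) fun _ => q none := by
      funext i
      refine Fin.addCases (fun i => ?_) (fun i => ?_) i <;> simp
    rw [e, ← append_integralPoint]
    constructor
    · rintro ⟨hq, e⟩
      have hx : integralPoint (q ∘ some) ∈ X K := (hX K _).mpr ⟨_, hq, rfl⟩
      exact ⟨⟨_, hx⟩, by rw [hfg, e]⟩
    · rintro ⟨x, hx⟩
      obtain ⟨h3, h4⟩ := (append_eq_iff _ _ _ _).mp hx
      obtain ⟨p, hp, hxp⟩ := (hX K _).mp x.2
      have e2 : q ∘ some = p := integralPoint_injective (h3.trans hxp)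
      obtain ⟨x, hx'⟩ := x
      obtain rfl : x = integralPoint p := hxp
      rw [hfg] at h4
      rw [e2]
      exact ⟨hp, congrFun (integralPoint_injective h4) 0⟩
  refine ⟨IsDefinableRel.congr (IsDefinableRel.ex h2) fun K _ _ p => ?_, h2⟩
  have e (y : PowerSeries K) : ((fun o => o.elim y p : Option (Fin n) → PowerSeries K) ∘ some) =
    p := rfl
  simp only [e, Option.elim_none, exists_and_left, exists_eq, and_true]

/-! ### The polydisc and the units -/

/-- The integer `α_K` as a natural number. -/
noncomputable def radius (α : DefConst L (full k 0 0 1)) (K : Type u) [Field K] [Algebra k K] : ℕ :=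
  (intVal α K).toNat

theorem mem_polydisc_iff {α : DefConst L (full k 0 0 1)}
    (hα : ∀ (K : Type u) [Field K] [Algebra k K], 1 ≤ intVal α K) {n : ℕ} (K : Type u) [Field K]
    [Algebra k K] (x : HPoint n 0 0 K) :
    x ∈ polydisc α n K ↔ ∃ p, ball n (radius α) K p ∧ x = integralPoint p := by
  have e : intVal α K = (radius α K : ℤ) := (Int.toNat_of_nonneg (by linarith [hα K])).symm
  change (∀ i, (intVal α K : WithTop ℤ) ≤ (x.vf i).orderTop) ↔ _
  rw [e]
  simp only [le_orderTop_iff_exists]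
  constructor
  · intro h
    choose p hp hx using h
    exact ⟨p, hp, eq_integralPoint hx⟩
  · rintro ⟨p, hp, rfl⟩ i
    exact ⟨p i, hp i, rfl⟩

theorem integralPoint_mem_integerUnits {K : Type u} [Field K] [Algebra k K] {z : PowerSeries K}
    (hz : IsUnit z) : integralPoint (fun _ => z) ∈ integerUnits k K := by
  have h0 := (le_orderTop_iff_exists 0 (z : LaurentSeries K)).mpr ⟨z, one_dvd _, rfl⟩
  have h1 : ¬ ((1 : ℕ) : ℤ) ≤ (z : LaurentSeries K).orderTop := by
    rw [le_orderTop_iff_exists]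
    rintro ⟨w, hw, e⟩
    obtain rfl : w = z := coe_injective e
    exact PowerSeries.X_prime.not_isUnit (isUnit_of_dvd_unit (by simpa using hw) hz)
  change (z : LaurentSeries K).orderTop = 0
  revert h0 h1
  generalize (z : LaurentSeries K).orderTop = o
  cases o with
  | top => simp
  | coe m =>
    norm_cast
    omega

end IntegralPoints

section Analytic

open MvPowerSeries

variable {k : Type u} [Field k] {L : DenefPas k} {n : ℕ}

/-! ### Analytic morphisms on the polydisc -/

/-- A globally analytic morphism on the polydisc is a family of power series in `t` and the
coordinates. -/
theorem DefMor.IsGloballyAnalytic.exists_series {α : DefConst L (full k 0 0 1)}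
    (hα : ∀ (K : Type u) [Field K] [Algebra k K], 1 ≤ intVal α K)
    {f : DefMor L (polydisc α n) (integers k)} (hf : f.IsGloballyAnalytic) :
    ∃ F : ∀ (K : Type u) [Field K] [Algebra k K], MvPowerSeries (Option (Fin n)) K,
      ∀ (K : Type u) [Field K] [Algebra k K] (p : Fin n → PowerSeries K)
        (hp : integralPoint p ∈ polydisc α n K),
        (f.app K ⟨integralPoint p, hp⟩).1 = integralPoint fun _ => ev p (F K) := by
  refine ⟨fun K _ _ => flatten (hf K 0).choose, fun K _ _ p hp => ?_⟩
  have h1 := (hf K 0).choose_spec ⟨integralPoint p, hp⟩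
  obtain ⟨q, hq, e⟩ := (mem_polydisc_iff hα K _).mp hp
  obtain rfl := integralPoint_injective e
  have h2 := hasSum_ev_flatten (hf K 0).choose
    (hq.constantCoeff fun K _ _ => Int.toNat_le_toNat (hα K))
  refine eq_integralPoint fun i => ?_
  rw [Subsingleton.elim i 0]
  exact h2.unique h1

/-- Conversely, a morphism given by power series in `t` and the coordinates is globally analytic. -/
theorem isGloballyAnalytic_of_series {α : DefConst L (full k 0 0 1)}
    (hα : ∀ (K : Type u) [Field K] [Algebra k K], 1 ≤ intVal α K) {m : ℕ}
    {Y : Subassignment k m 0 0} {T : DefMor L (polydisc α n) Y}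
    {F : ∀ (K : Type u) [Field K] [Algebra k K], Fin m → MvPowerSeries (Option (Fin n)) K}
    (hT : ∀ (K : Type u) [Field K] [Algebra k K] (p : Fin n → PowerSeries K)
        (hp : integralPoint p ∈ polydisc α n K),
        (T.app K ⟨integralPoint p, hp⟩).1 = integralPoint fun j => ev p (F K j)) :
    T.IsGloballyAnalytic := by
  intro K _ _ j
  refine ⟨unflatten (F K j), ?_⟩
  rintro ⟨x, hx⟩
  obtain ⟨p, hp, rfl⟩ := (mem_polydisc_iff hα K _).mp hx
  have h := hasSum_ev_flatten (unflatten (F K j))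
    (hp.constantCoeff fun K _ _ => Int.toNat_le_toNat (hα K))
  rw [flatten_unflatten] at h
  beta_reduce
  rw [hT]
  exact h

section Derivatives

variable {α : DefConst L (full k 0 0 1)}
    (hα : ∀ (K : Type u) [Field K] [Algebra k K], 1 ≤ intVal α K)
    {f : DefMor L (polydisc α n) (integers k)}
    {F : ∀ (K : Type u) [Field K] [Algebra k K], MvPowerSeries (Option (Fin n)) K}
    (hF : ∀ (K : Type u) [Field K] [Algebra k K] (p : Fin n → PowerSeries K)
        (hp : integralPoint p ∈ polydisc α n K),
        (f.app K ⟨integralPoint p, hp⟩).1 = integralPoint fun _ => ev p (F K))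
    (K : Type u) [Field K] [Algebra k K] {p : Fin n → PowerSeries K} (hp : ball n (radius α) K p)

include hα hF hp

theorem extend_eq_ev :
    f.extend K (fun i => (p i : LaurentSeries K)) = (ev p (F K) : PowerSeries K) := by
  have h1 : integralPoint p ∈ polydisc α n K := (mem_polydisc_iff hα K _).mpr ⟨p, hp, rfl⟩
  refine (dif_pos h1).trans ?_
  exact congrArg (fun x : HPoint 1 0 0 K => x.vf 0) (hF K p h1)

theorem partialDeriv_extend_eq_ev (i : Fin n) :
    partialDeriv (f.extend K) i (fun i => (p i : LaurentSeries K)) =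
      (ev p (pderiv K (some i) (F K)) : PowerSeries K) :=
  partialDeriv_eq_ev_pderiv (f.extend K) (Int.toNat_le_toNat (hα K)) (F K)
    (fun _ hq => extend_eq_ev hα hF K hq) i p hp

theorem partialDeriv_partialDeriv_extend_eq_ev (i j : Fin n) :
    partialDeriv (partialDeriv (f.extend K) j) i (fun i => (p i : LaurentSeries K)) =
      (ev p (pderiv K (some i) (pderiv K (some j) (F K))) : PowerSeries K) :=
  partialDeriv_eq_ev_pderiv _ (Int.toNat_le_toNat (hα K)) _
    (fun _ hq => partialDeriv_extend_eq_ev hα hF K hq j) i p hp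

theorem grad_eq_zero_iff (h1 : integralPoint p ∈ polydisc α n K) :
    f.grad K ⟨integralPoint p, h1⟩ = 0 ↔ ∀ i, ev p (pderiv K (some i) (F K)) = 0 := by
  rw [funext_iff]
  refine forall_congr' fun i => ?_
  have h2 : f.grad K ⟨integralPoint p, h1⟩ i = (ev p (pderiv K (some i) (F K)) : PowerSeries K) :=
    partialDeriv_extend_eq_ev hα hF K hp i
  rw [h2, Pi.zero_apply]
  exact ⟨fun h => coe_injective (h.trans (map_zero _).symm), fun h => by rw [h, map_zero]⟩

end Derivatives

theorem val_origin (α : DefConst L (full k 0 0 1)) (K : Type u) [Field K] [Algebra k K] :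
    ((origin α n).val K).1 = integralPoint 0 :=
  eq_integralPoint fun _ => map_zero _

end Analytic

end MotivicMorse

/-! ### The Morse lemma -/

open MotivicMorse in
theorem proposition2 {k : Type u} [Field k] [CharZero k] (L : MotivicMorse.DenefPas k)
    (n : ℕ) (α : MotivicMorse.DefConst L (MotivicMorse.full k 0 0 1))
    (hα : ∀ (K : Type u) [Field K] [Algebra k K], 1 ≤ MotivicMorse.intVal α K)
    (f : MotivicMorse.DefMor L (MotivicMorse.polydisc α n) (MotivicMorse.integers k))
    (hf : f.IsGloballyAnalytic)
    (hcrit : f.IsCriticalPointMod α (MotivicMorse.origin α n))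
    (hnondeg : f.IsNondegenerateMod (MotivicMorse.origin α n)) :
    ∃ c : MotivicMorse.DefConst L (MotivicMorse.polydisc α n),
      f.IsCriticalPoint c ∧
      (∀ c' : MotivicMorse.DefConst L (MotivicMorse.polydisc α n),
        f.IsCriticalPoint c' → c' = c) ∧
      (∀ (K : Type u) [Field K] [Algebra k K] (x : MotivicMorse.polydisc α n K),
        f.grad K x = 0 → x = c.val K) ∧
      ∃ (T : MotivicMorse.DefMor L (MotivicMorse.polydisc α n) (MotivicMorse.polydisc α n))
        (a : Fin n → MotivicMorse.DefConst L (MotivicMorse.integerUnits k)),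
        T.IsBianalytic ∧
        (∀ (K : Type u) [Field K] [Algebra k K],
          T.app K (c.val K) = (MotivicMorse.origin α n).val K) ∧
        ∀ (K : Type u) [Field K] [Algebra k K] (x : MotivicMorse.polydisc α n K),
          (f.app K x).1.vf 0 = (f.app K (c.val K)).1.vf 0 +
            ∑ i : Fin n, ((a i).val K).1.vf 0 * ((T.app K x).1.vf i) ^ 2 := by
  obtain ⟨F, hF⟩ := hf.exists_series hα
  have ha (K : Type u) [Field K] [Algebra k K] : 1 ≤ radius α K := Int.toNat_le_toNat (hα K)
  have hmem (K : Type u) [Field K] [Algebra k K] (x : HPoint n 0 0 K) :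
    x ∈ polydisc α n K ↔ ∃ p, ball n (radius α) K p ∧ x = integralPoint p := mem_polydisc_iff hα K x
  have hmem' {K : Type u} [Field K] [Algebra k K] {p : Fin n → PowerSeries K}
    (hp : ball n (radius α) K p) : integralPoint p ∈ polydisc α n K := (hmem K _).mpr ⟨p, hp, rfl⟩
  obtain ⟨hD, hFD⟩ := DefMor.isDefinableFun hmem f hF
  have horigin (K : Type u) [Field K] [Algebra k K] :
      ((origin α n).val K).1.vf = fun i => (((0 : Fin n → PowerSeries K) i : PowerSeries K) :
        LaurentSeries K) := congrArg HPoint.vf (val_origin α K)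
  -- the hypotheses on `f`, expressed by formal derivatives of `F`
  have hgrad (K : Type u) [Field K] [Algebra k K] (i : Fin n) :
      PowerSeries.X ^ radius α K ∣ ev 0 (MvPowerSeries.pderiv K (some i) (F K)) := by
    have h1 := hcrit K i
    rw [DefMor.grad, horigin, partialDeriv_extend_eq_ev hα hF K ball_zero,
      ← Int.toNat_of_nonneg (zero_le_one.trans (hα K))] at h1
    obtain ⟨z, hz, e⟩ := (le_orderTop_iff_exists _ _).mp h1
    exact coe_injective e ▸ hz
  have hdet (K : Type u) [Field K] [Algebra k K] : (residueHessian (F K)).det ≠ 0 := by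
    let M : Matrix (Fin n) (Fin n) (PowerSeries K) := Matrix.of fun i j =>
      ev 0 (MvPowerSeries.pderiv K (some i) (MvPowerSeries.pderiv K (some j) (F K)))
    have h1 : f.hess K ((origin α n).val K) = (HahnSeries.ofPowerSeries ℤ K).mapMatrix M := by
      ext1 i j
      rw [DefMor.hess, horigin]
      exact partialDeriv_partialDeriv_extend_eq_ev hα hF K ball_zero i j
    have h2 : residueHessian (F K) = M.map PowerSeries.constantCoeff := by
      ext i j
      exact (constantCoeff_ev (constantCoeff_zero_fun (K := K)) (MvPowerSeries.pderiv K (some i)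
        (MvPowerSeries.pderiv K (some j) (F K)))).symm
    intro h3
    have h4 := hnondeg K
    rw [h1, ← RingHom.map_det] at h4
    refine h4 ((le_orderTop_iff_exists 1 _).mpr ⟨M.det, ?_, rfl⟩)
    rw [pow_one, PowerSeries.X_dvd_iff, RingHom.map_det, RingHom.mapMatrix_apply, ← h2, h3]
  obtain ⟨c, d, T, S, hc, hd, hT, hS, H⟩ := exists_definable_morse_chart hD ha hFD hgrad hdet
  obtain ⟨c', hc'⟩ := exists_defConst hc (Y := polydisc α n) fun K _ _ => hmem' (H K).1
  have hcval (K : Type u) [Field K] [Algebra k K] :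
      c'.val K = ⟨integralPoint (c K), hmem' (H K).1⟩ := Subtype.ext (hc' K)
  have huniq (K : Type u) [Field K] [Algebra k K] (x : polydisc α n K) (hx : f.grad K x = 0) :
      x = c'.val K := by
    obtain ⟨x, hx'⟩ := x
    obtain ⟨p, hp, rfl⟩ := (hmem K x).mp hx'
    rw [hcval, Subtype.mk.injEq, ← ((H K).2.2.2 p hp).1.mp
      ((grad_eq_zero_iff hα hF K hp hx').mp hx)]
  have hcc : f.IsCriticalPoint c' := by
    intro K _ _
    rw [hcval, grad_eq_zero_iff hα hF K (H K).1]
    exact ((H K).2.2.2 _ (H K).1).1.mpr rfl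
  obtain ⟨T', hT'⟩ := exists_defMor hmem (Y := polydisc α n) hD hT
    fun K _ _ p hp => hmem' ((H K).2.2.2 p hp).2.1
  obtain ⟨S', hS'⟩ := exists_defMor hmem (Y := polydisc α n) hD hS
    fun K _ _ p hp => hmem' ((H K).2.2.2 p hp).2.2.1
  have ha' (i : Fin n) := exists_defConst (m := 1) (c := fun K _ _ _ => d K i) (fun _ => hd i)
    (Y := integerUnits k) fun K _ _ => integralPoint_mem_integerUnits ((H K).2.1 i)
  choose a' ha' using ha'
  refine ⟨c', hcc, fun c'' h => DefMor.ext_val fun K _ _ => huniq K _ (h K), huniq, T', a',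
    ⟨isGloballyAnalytic_of_series hα hT', S', isGloballyAnalytic_of_series hα hS',
      fun K _ _ => ⟨?_, ?_⟩⟩, fun K _ _ => ?_, fun K _ _ => ?_⟩
  · rintro ⟨x, hx⟩
    obtain ⟨p, hp, rfl⟩ := (hmem K x).mp hx
    have h1 : T'.app K ⟨_, hx⟩ = ⟨_, hmem' ((H K).2.2.2 p hp).2.1⟩ := Subtype.ext (hT' K p hx)
    refine Subtype.ext ?_
    rw [h1, hS', funext ((H K).2.2.2 p hp).2.2.2.1]
  · rintro ⟨x, hx⟩
    obtain ⟨p, hp, rfl⟩ := (hmem K x).mp hx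
    have h1 : S'.app K ⟨_, hx⟩ = ⟨_, hmem' ((H K).2.2.2 p hp).2.2.1⟩ := Subtype.ext (hS' K p hx)
    refine Subtype.ext ?_
    rw [h1, hT', funext ((H K).2.2.2 p hp).2.2.2.2.1]
  · refine Subtype.ext ?_
    rw [hcval, hT', val_origin, funext (H K).2.2.1]
    rfl
  · rintro ⟨x, hx⟩
    obtain ⟨p, hp, rfl⟩ := (hmem K x).mp hx
    have h1 := congrArg (HahnSeries.ofPowerSeries ℤ K) ((H K).2.2.2 p hp).2.2.2.2.2
    rw [map_add, map_sum] at h1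
    simp only [map_mul, map_pow] at h1
    rw [hcval, hF, hF, hT']
    simp only [ha']
    exact h1
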